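/- **Conventions.** For a map $u$ in a category with pullbacks, $u_!\dashv u^*$ denote composition with $u$ and pullback along $u$ between slices; if the category is locally cartesian closed, $\Pi_u$ denotes the right adjoint of $u^*$. A functor is called cartesian if it preserves pullbacks, and a natural transformation is called cartesian if all its naturality squares are pullbacks. **(1) Cartesian endofunctors.** Let $\mathcal C$ be a category with pullbacks and $P:\mathcal C\to\mathcal C$ a cartesian functor. A $P$-span from $D$ to $C$ is a diagram $PD\xleftarrow{d}N\xrightarrow{c}C$; a morphism of $P$-spans (with varying endpoints) is a triple $f:D'\to D$, $g:N'\to N$, $h:C'\to C$ with $dg=P(f)d'$ and $cg=hc'$. Let $P\text{-}\mathbf{Span}_{\mathcal C}$ be the category of $P$-spans. Let $\mathbf{Cart}_{\mathcal C}/P$ be the category whose objects are cartesian functors $Q:\mathcal C/D\to\mathcal C/C$ with a cartesian transformation from $\mathcal C/D\xrightarrow{Q}\mathcal C/C\to\mathcal C$ to $\mathcal C/D\to\mathcal C\xrightarrow{P}\mathcal C$, and whose morphisms from $Q'$ to $Q$ are triples of $u:D'\to D$, $v:C'\to C$ and a cartesian transformation $v_!Q'\Rightarrow Q\,u_!$ compatible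 with the transformations to $P$. Then the extension functor $$\operatorname{Ext}:P\text{-}\mathbf{Span}_{\mathcal C}\to\mathbf{Cart}_{\mathcal C}/P,$$ sending $PD\xleftarrow{d}N\xrightarrow{c}C$ to the functor $c_!\,d^*\,P_{/D}:\mathcal C/D\to\mathcal C/PD\to\mathcal C/N\to\mathcal C/C$ with its projection to $P$, is an equivalence of categories. **(2) Polynomial monads.** Let $\mathcal E$ be a locally cartesian closed category (with pullbacks), let $I\in\mathcal E$, and let $P$ be a polynomial monad on $\mathcal E/I$: a monad whose unit and multiplication are cartesian and whose functor is polynomial, i.e. isomorphic to $t_!\Pi_f s^*$ for some diagram $I\xleftarrow{s}B\xrightarrow{f}A\xrightarrow{t}I$. Consider the following two double categories; in both, objects and vertical arrows are those of $\mathcal E/I$. * $P\text{-}\mathbf{Span}_{\mathcal E/I}$: horizontal arrows are $P$-spans in $\mathcal E/I$ and squares are morphisms of $P$-spans. The composite of $PD\xleftarrow{d}N\xrightarrow{c}C$ and $PC\xleftarrow{s}U\xrightarrow{t}B$ has apex $PN\times_{PC}U$ and legs $PN\times_{PC}U\to PN\xrightarrow{Pd}PPD\xrightarrow{\mu_D}PD$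 and $PN\times_{PC}U\to U\xrightarrow{t}B$; the identity of $D$ is $PD\xleftarrow{\eta_D}D\xrightarrow{1}D$. * $\mathbf{Poly}^{\mathrm c}_{\mathcal E}/P$: horizontal arrows from $D$ to $C$ are polynomial functors $Q:\mathcal E/D\to\mathcal E/C$ with a cartesian transformation $(C\to I)_!\,Q\Rightarrow P\,(D\to I)_!$; squares over $u:D'\to D$, $v:C'\to C$ are cartesian transformations $v_!Q'\Rightarrow Q\,u_!$ compatible with the transformations to $P$. Horizontal composition is composition of functors, with structure transformation the horizontal composite followed by $\mu$; the horizontal identity is the identity functor with structure transformation $\eta$. Extension (as in (1), under the identifications $(\mathcal E/I)/D\simeq\mathcal E/D$), which is the identity on objects and vertical arrows, carries $P$-spans to polynomials cartesian over $P$. Its comparison maps for horizontal composition, given by the Beck-Chevalley isomorphisms for the pullback squares $PN\times_{PC}U$, together with comparison maps for identities, make it a (pseudo) double functor $$\operatorname{Ext}:P\text{-}\mathbf{Span}_{\mathcal E/I}\to\mathbf{Poly}^{\mathrm c}_{\mathcal E}/P ,$$ and this is an equivalence of framed bicategories: both double categories are framed bicategories (the functor sending a horizontal arrow to its endpoints is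 a bifibration), and there is a double functor in the other direction such that both composites are isomorphic to identities by invertible vertical transformations. **(3) Direct comparison.** In the situation of (2), let $I\xleftarrow{s}B\xrightarrow{f}A\xrightarrow{t}I$ be any polynomial representing the functor $P$, with a chosen isomorphism $P\cong t_!\Pi_f s^*$, and let $D$, $C$ be objects of $\mathcal E/I$ with structure maps $u:D\to I$ and $C\to I$. Let $\mathbf{Poly}^{\mathrm c}_{\mathcal E}(D,C)/P$ be the category of polynomial diagrams $Q:\ D\leftarrow M\to N\to C$ with maps $M\to B$ and $N\to A$ such that the squares over $u$ and over $C\to I$ commute and the square $M\to N$ over $f$ is a pullback; a morphism $Q\to Q'$ consists of maps $M\to M'$, $N\to N'$ commuting with all the given maps and forming a pullback square. The source lift of the polynomial along $u$ is the diagram $$D\leftarrow PD\times_A B\to PD\to I$$ over it, where $PD$ is identified with the domain of $\Pi_f s^*D\to A$, the left leg is evaluation, i.e. the counit of $s_!f^*\dashv\Pi_f s^*$, and the right leg is $PD\to A\xrightarrow{t}I$. Every $Q$ as above, with its right leg composed with $C\to I$, admits a unique morphism to the source lift; indeed the source lift is a terminal object of $\mathbf{Poly}^{\mathrm c}_{\mathcal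 E}(D,I)/P$. Sending $Q$ to the $P$-span $PD\leftarrow N\to C$, whose left leg is the component $N\to PD$ of this unique morphism and whose right leg is that of $Q$, defines a functor which is an equivalence of hom categories $$\mathbf{Poly}^{\mathrm c}_{\mathcal E}(D,C)/P\ \simeq\ P\text{-}\mathbf{Span}_{\mathcal E/I}(D,C).$$ -/

import Mathlib

set_option linter.unusedSectionVars false
set_option linter.checkUnivs false

open CategoryTheory CategoryTheory.Limits

namespace PolySpan

universe u v w x u' v' w' x' u'' v'' w'' x''

/-! ## Double categories and framed bicategories -/

/-- The total collection of horizontal arrows of a double category: a horizontal arrow together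
with its horizontal source and target. -/
structure HorTotal {Obj : Type u} (Hor : Obj → Obj → Type w) where
  /-- horizontal source -/
  src : Obj
  /-- horizontal target -/
  tgt : Obj
  /-- the horizontal arrow -/
  hor : Hor src tgt

/-- A horizontal arrow, regarded as an object of the category of horizontal arrows and squares. -/
abbrev tot {Obj : Type u} {Hor : Obj → Obj → Type w} {A B : Obj} (M : Hor A B) : HorTotal Hor :=
  ⟨A, B, M⟩

/-- A (pseudo) double category: a category of objects and vertical arrows, a category of
horizontal arrows and squares, source and target functors, and a horizontal composition which is
functorial on horizontally composable squares, and is associative and unital up to coherent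
invertible squares with identity vertical boundary. -/
structure DoubleCat where
  /-- objects -/
  Obj : Type u
  /-- vertical arrows -/
  [objCat : Category.{v} Obj]
  /-- horizontal arrows -/
  Hor : Obj → Obj → Type w
  /-- squares, with their vertical composition -/
  [sqCat : Category.{x} (HorTotal Hor)]
  /-- the vertical arrow at the horizontal source of a square -/
  left : ∀ {M N : HorTotal Hor}, (M ⟶ N) → (M.src ⟶ N.src)
  /-- the vertical arrow at the horizontal target of a square -/
  right : ∀ {M N : HorTotal Hor}, (M ⟶ N) → (M.tgt ⟶ N.tgt)
  left_id : ∀ M : HorTotal Hor, left (𝟙 M) = 𝟙 M.src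
  right_id : ∀ M : HorTotal Hor, right (𝟙 M) = 𝟙 M.tgt
  left_comp : ∀ {M N K : HorTotal Hor} (α : M ⟶ N) (β : N ⟶ K), left (α ≫ β) = left α ≫ left β
  right_comp : ∀ {M N K : HorTotal Hor} (α : M ⟶ N) (β : N ⟶ K),
    right (α ≫ β) = right α ≫ right β
  /-- horizontal identity arrows -/
  hid : ∀ A : Obj, Hor A A
  /-- horizontal identity squares -/
  hidSq : ∀ {A B : Obj} (_ : A ⟶ B), tot (hid A) ⟶ tot (hid B)
  left_hidSq : ∀ {A B : Obj} (f : A ⟶ B), left (hidSq f) = f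
  right_hidSq : ∀ {A B : Obj} (f : A ⟶ B), right (hidSq f) = f
  hidSq_id : ∀ A : Obj, hidSq (𝟙 A) = 𝟙 _
  hidSq_comp : ∀ {A B C : Obj} (f : A ⟶ B) (g : B ⟶ C), hidSq (f ≫ g) = hidSq f ≫ hidSq g
  /-- horizontal composition of horizontal arrows, in diagrammatic order -/
  hcomp : ∀ {A B C : Obj}, Hor A B → Hor B C → Hor A C
  /-- horizontal composition of squares, in diagrammatic order -/
  hcompSq : ∀ {A B C A' B' C' : Obj} {M : Hor A B} {N : Hor B C} {M' : Hor A' B'} {N' : Hor B' C'}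
    (α : tot M ⟶ tot M') (β : tot N ⟶ tot N'), right α = left β →
      (tot (hcomp M N) ⟶ tot (hcomp M' N'))
  left_hcompSq : ∀ {A B C A' B' C' : Obj} {M : Hor A B} {N : Hor B C} {M' : Hor A' B'}
    {N' : Hor B' C'} (α : tot M ⟶ tot M') (β : tot N ⟶ tot N') (h : right α = left β),
      left (hcompSq α β h) = left α
  right_hcompSq : ∀ {A B C A' B' C' : Obj} {M : Hor A B} {N : Hor B C} {M' : Hor A' B'}
    {N' : Hor B' C'} (α : tot M ⟶ tot M') (β : tot N ⟶ tot N') (h : right α = left β),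
      right (hcompSq α β h) = right β
  hcompSq_id : ∀ {A B C : Obj} (M : Hor A B) (N : Hor B C) (h : right (𝟙 (tot M)) = left (𝟙 (tot N))),
    hcompSq (𝟙 (tot M)) (𝟙 (tot N)) h = 𝟙 _
  hcompSq_comp : ∀ {A B C A' B' C' A'' B'' C'' : Obj} {M : Hor A B} {N : Hor B C} {M' : Hor A' B'}
    {N' : Hor B' C'} {M'' : Hor A'' B''} {N'' : Hor B'' C''}
    (α : tot M ⟶ tot M') (β : tot N ⟶ tot N') (h : right α = left β)
    (α' : tot M' ⟶ tot M'') (β' : tot N' ⟶ tot N'') (h' : right α' = left β')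
    (h'' : right (α ≫ α') = left (β ≫ β')),
      hcompSq (α ≫ α') (β ≫ β') h'' = hcompSq α β h ≫ hcompSq α' β' h'
  /-- the associativity constraint -/
  assoc : ∀ {A B C D : Obj} (M : Hor A B) (N : Hor B C) (K : Hor C D),
    tot (hcomp (hcomp M N) K) ≅ tot (hcomp M (hcomp N K))
  /-- the left unit constraint -/
  lunit : ∀ {A B : Obj} (M : Hor A B), tot (hcomp (hid A) M) ≅ tot M
  /-- the right unit constraint -/
  runit : ∀ {A B : Obj} (M : Hor A B), tot (hcomp M (hid B)) ≅ tot M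
  left_assoc : ∀ {A B C D : Obj} (M : Hor A B) (N : Hor B C) (K : Hor C D),
    left (assoc M N K).hom = 𝟙 A
  right_assoc : ∀ {A B C D : Obj} (M : Hor A B) (N : Hor B C) (K : Hor C D),
    right (assoc M N K).hom = 𝟙 D
  left_lunit : ∀ {A B : Obj} (M : Hor A B), left (lunit M).hom = 𝟙 A
  right_lunit : ∀ {A B : Obj} (M : Hor A B), right (lunit M).hom = 𝟙 B
  left_runit : ∀ {A B : Obj} (M : Hor A B), left (runit M).hom = 𝟙 A
  right_runit : ∀ {A B : Obj} (M : Hor A B), right (runit M).hom = 𝟙 B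
  assoc_naturality : ∀ {A B C D A' B' C' D' : Obj} {M : Hor A B} {N : Hor B C} {K : Hor C D}
    {M' : Hor A' B'} {N' : Hor B' C'} {K' : Hor C' D'}
    (α : tot M ⟶ tot M') (β : tot N ⟶ tot N') (γ : tot K ⟶ tot K')
    (h₁ : right α = left β) (h₂ : right β = left γ)
    (h₃ : right (hcompSq α β h₁) = left γ) (h₄ : right α = left (hcompSq β γ h₂)),
      hcompSq (hcompSq α β h₁) γ h₃ ≫ (assoc M' N' K').hom =
        (assoc M N K).hom ≫ hcompSq α (hcompSq β γ h₂) h₄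
  lunit_naturality : ∀ {A B A' B' : Obj} {M : Hor A B} {M' : Hor A' B'} (α : tot M ⟶ tot M')
    (h : right (hidSq (left α)) = left α),
      hcompSq (hidSq (left α)) α h ≫ (lunit M').hom = (lunit M).hom ≫ α
  runit_naturality : ∀ {A B A' B' : Obj} {M : Hor A B} {M' : Hor A' B'} (α : tot M ⟶ tot M')
    (h : right α = left (hidSq (right α))),
      hcompSq α (hidSq (right α)) h ≫ (runit M').hom = (runit M).hom ≫ α
  pentagon : ∀ {A B C D E : Obj} (M : Hor A B) (N : Hor B C) (K : Hor C D) (L : Hor D E)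
    (h₁ : right (assoc M N K).hom = left (𝟙 (tot L)))
    (h₂ : right (𝟙 (tot M)) = left (assoc N K L).hom),
      hcompSq (assoc M N K).hom (𝟙 (tot L)) h₁ ≫ (assoc M (hcomp N K) L).hom ≫
          hcompSq (𝟙 (tot M)) (assoc N K L).hom h₂ =
        (assoc (hcomp M N) K L).hom ≫ (assoc M N (hcomp K L)).hom
  triangle : ∀ {A B C : Obj} (M : Hor A B) (N : Hor B C)
    (h₁ : right (runit M).hom = left (𝟙 (tot N)))
    (h₂ : right (𝟙 (tot M)) = left (lunit N).hom),
      (assoc M (hid B) N).hom ≫ hcompSq (𝟙 (tot M)) (lunit N).hom h₂ =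
        hcompSq (runit M).hom (𝟙 (tot N)) h₁

attribute [instance] DoubleCat.objCat DoubleCat.sqCat

namespace DoubleCat

/-- The functor sending a horizontal arrow to its pair of endpoints. -/
def ends (C : DoubleCat.{u, v, w, x}) : HorTotal C.Hor ⥤ C.Obj × C.Obj where
  obj M := (M.src, M.tgt)
  map α := (C.left α, C.right α)
  map_id M := by
    ext
    · exact C.left_id M
    · exact C.right_id M
  map_comp α β := by
    ext
    · exact C.left_comp α β
    · exact C.right_comp α β

end DoubleCat

/-- A bifibration: a functor along which every arrow into (the image of) an object has a cartesian
lift, and every arrow out of (the image of) an object has an opcartesian lift. -/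
def IsBifibration {X : Type u} [Category.{v} X] {S : Type u'} [Category.{v'} S] (p : X ⥤ S) :
    Prop :=
  (∀ (a : X) (r : S) (f : r ⟶ p.obj a), ∃ (b : X) (φ : b ⟶ a), p.IsStronglyCartesian f φ) ∧
    (∀ (a : X) (r : S) (f : p.obj a ⟶ r), ∃ (b : X) (φ : a ⟶ b), p.IsStronglyCocartesian f φ)

/-- A framed bicategory is a double category whose endpoints functor is a bifibration. -/
def DoubleCat.IsFramed (C : DoubleCat.{u, v, w, x}) : Prop := IsBifibration C.ends

/-- The underlying data of a double functor: a functor on objects and vertical arrows, and a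
functor on horizontal arrows and squares, compatible with endpoints. -/
structure DoubleMap (C : DoubleCat.{u, v, w, x}) (D : DoubleCat.{u', v', w', x'}) where
  /-- action on objects and vertical arrows -/
  vert : C.Obj ⥤ D.Obj
  /-- action on horizontal arrows -/
  hor : ∀ {A B : C.Obj}, C.Hor A B → D.Hor (vert.obj A) (vert.obj B)
  /-- action on squares -/
  sq : ∀ {A B A' B' : C.Obj} {M : C.Hor A B} {M' : C.Hor A' B'},
    (tot M ⟶ tot M') → (tot (hor M) ⟶ tot (hor M'))
  left_sq : ∀ {A B A' B' : C.Obj} {M : C.Hor A B} {M' : C.Hor A' B'} (α : tot M ⟶ tot M'),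
    D.left (sq α) = vert.map (C.left α)
  right_sq : ∀ {A B A' B' : C.Obj} {M : C.Hor A B} {M' : C.Hor A' B'} (α : tot M ⟶ tot M'),
    D.right (sq α) = vert.map (C.right α)
  sq_id : ∀ {A B : C.Obj} (M : C.Hor A B), sq (𝟙 (tot M)) = 𝟙 _
  sq_comp : ∀ {A B A' B' A'' B'' : C.Obj} {M : C.Hor A B} {M' : C.Hor A' B'}
    {M'' : C.Hor A'' B''} (α : tot M ⟶ tot M') (β : tot M' ⟶ tot M''),
    sq (α ≫ β) = sq α ≫ sq β

/-- Coherent compatibility of a double map with horizontal composition and identities, up to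
invertible squares with identity vertical boundary. -/
structure PseudoStructure {C : DoubleCat.{u, v, w, x}} {D : DoubleCat.{u', v', w', x'}}
    (F : DoubleMap C D) where
  /-- comparison for horizontal composition -/
  comp : ∀ {X Y Z : C.Obj} (M : C.Hor X Y) (N : C.Hor Y Z),
    tot (D.hcomp (F.hor M) (F.hor N)) ≅ tot (F.hor (C.hcomp M N))
  /-- comparison for horizontal identities -/
  unit : ∀ X : C.Obj, tot (D.hid (F.vert.obj X)) ≅ tot (F.hor (C.hid X))
  left_comp : ∀ {X Y Z : C.Obj} (M : C.Hor X Y) (N : C.Hor Y Z), D.left (comp M N).hom = 𝟙 _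
  right_comp : ∀ {X Y Z : C.Obj} (M : C.Hor X Y) (N : C.Hor Y Z), D.right (comp M N).hom = 𝟙 _
  left_unit : ∀ X : C.Obj, D.left (unit X).hom = 𝟙 _
  right_unit : ∀ X : C.Obj, D.right (unit X).hom = 𝟙 _
  comp_naturality : ∀ {X Y Z X' Y' Z' : C.Obj} {M : C.Hor X Y} {N : C.Hor Y Z} {M' : C.Hor X' Y'}
    {N' : C.Hor Y' Z'} (α : tot M ⟶ tot M') (β : tot N ⟶ tot N') (h : C.right α = C.left β)
    (h' : D.right (F.sq α) = D.left (F.sq β)),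
      D.hcompSq (F.sq α) (F.sq β) h' ≫ (comp M' N').hom =
        (comp M N).hom ≫ F.sq (C.hcompSq α β h)
  unit_naturality : ∀ {X Y : C.Obj} (f : X ⟶ Y),
    D.hidSq (F.vert.map f) ≫ (unit Y).hom = (unit X).hom ≫ F.sq (C.hidSq f)
  comp_assoc : ∀ {X Y Z W : C.Obj} (M : C.Hor X Y) (N : C.Hor Y Z) (K : C.Hor Z W)
    (h₁ : D.right (comp M N).hom = D.left (𝟙 (tot (F.hor K))))
    (h₂ : D.right (𝟙 (tot (F.hor M))) = D.left (comp N K).hom),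
      D.hcompSq (comp M N).hom (𝟙 (tot (F.hor K))) h₁ ≫ (comp (C.hcomp M N) K).hom ≫
          F.sq (C.assoc M N K).hom =
        (D.assoc (F.hor M) (F.hor N) (F.hor K)).hom ≫
          D.hcompSq (𝟙 (tot (F.hor M))) (comp N K).hom h₂ ≫ (comp M (C.hcomp N K)).hom
  comp_lunit : ∀ {X Y : C.Obj} (M : C.Hor X Y)
    (h : D.right (unit X).hom = D.left (𝟙 (tot (F.hor M)))),
      D.hcompSq (unit X).hom (𝟙 (tot (F.hor M))) h ≫ (comp (C.hid X) M).hom ≫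
        F.sq (C.lunit M).hom = (D.lunit (F.hor M)).hom
  comp_runit : ∀ {X Y : C.Obj} (M : C.Hor X Y)
    (h : D.right (𝟙 (tot (F.hor M))) = D.left (unit Y).hom),
      D.hcompSq (𝟙 (tot (F.hor M))) (unit Y).hom h ≫ (comp M (C.hid Y)).hom ≫
        F.sq (C.runit M).hom = (D.runit (F.hor M)).hom

/-- A pseudo double functor. Between framed bicategories this is a (strong) framed functor. -/
structure DoubleFunctor (C : DoubleCat.{u, v, w, x}) (D : DoubleCat.{u', v', w', x'}) where
  /-- the underlying data -/
  toMap : DoubleMap C D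
  /-- compatibility with horizontal composition -/
  str : PseudoStructure toMap

namespace DoubleMap

variable {C : DoubleCat.{u, v, w, x}} {D : DoubleCat.{u', v', w', x'}}

/-- The image of an invertible square. -/
def sqIso (F : DoubleMap C D) {A B A' B' : C.Obj} {M : C.Hor A B} {M' : C.Hor A' B'}
    (e : tot M ≅ tot M') : tot (F.hor M) ≅ tot (F.hor M') where
  hom := F.sq e.hom
  inv := F.sq e.inv
  hom_inv_id := by rw [← F.sq_comp, e.hom_inv_id, F.sq_id]
  inv_hom_id := by rw [← F.sq_comp, e.inv_hom_id, F.sq_id]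

/-- The identity double map. -/
def id (C : DoubleCat.{u, v, w, x}) : DoubleMap C C where
  vert := 𝟭 _
  hor M := M
  sq α := α
  left_sq _ := rfl
  right_sq _ := rfl
  sq_id _ := rfl
  sq_comp _ _ := rfl

/-- Composition of double maps. -/
def comp {E : DoubleCat.{u'', v'', w'', x''}} (F : DoubleMap C D) (G : DoubleMap D E) :
    DoubleMap C E where
  vert := F.vert ⋙ G.vert
  hor M := G.hor (F.hor M)
  sq α := G.sq (F.sq α)
  left_sq α := by rw [G.left_sq, F.left_sq]; rfl
  right_sq α := by rw [G.right_sq, F.right_sq]; rfl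
  sq_id M := (congrArg _ (F.sq_id M)).trans (G.sq_id _)
  sq_comp α β := by rw [F.sq_comp, G.sq_comp]

end DoubleMap

namespace DoubleCat

variable (C : DoubleCat.{u, v, w, x})

theorem id_coh_assoc {X Y Z W : C.Obj} (M : C.Hor X Y) (N : C.Hor Y Z) (K : C.Hor Z W)
    (h₁ : C.right (𝟙 (tot (C.hcomp M N))) = C.left (𝟙 (tot K)))
    (h₂ : C.right (𝟙 (tot M)) = C.left (𝟙 (tot (C.hcomp N K)))) :
    C.hcompSq (𝟙 (tot (C.hcomp M N))) (𝟙 (tot K)) h₁ ≫ 𝟙 _ ≫ (C.assoc M N K).hom =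
      (C.assoc M N K).hom ≫ C.hcompSq (𝟙 (tot M)) (𝟙 (tot (C.hcomp N K))) h₂ ≫ 𝟙 _ := by
  rw [C.hcompSq_id, C.hcompSq_id]
  simp

theorem id_coh_lunit {X Y : C.Obj} (M : C.Hor X Y)
    (h : C.right (𝟙 (tot (C.hid X))) = C.left (𝟙 (tot M))) :
    C.hcompSq (𝟙 (tot (C.hid X))) (𝟙 (tot M)) h ≫ 𝟙 _ ≫ (C.lunit M).hom = (C.lunit M).hom := by
  rw [C.hcompSq_id]
  simp

theorem id_coh_runit {X Y : C.Obj} (M : C.Hor X Y)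
    (h : C.right (𝟙 (tot M)) = C.left (𝟙 (tot (C.hid Y)))) :
    C.hcompSq (𝟙 (tot M)) (𝟙 (tot (C.hid Y))) h ≫ 𝟙 _ ≫ (C.runit M).hom = (C.runit M).hom := by
  rw [C.hcompSq_id]
  simp

variable {C}

theorem hcompSq_congr {X Y Z X' Y' Z' : C.Obj} {M : C.Hor X Y} {N : C.Hor Y Z} {M' : C.Hor X' Y'}
    {N' : C.Hor Y' Z'} {α α' : tot M ⟶ tot M'} {β β' : tot N ⟶ tot N'} (hα : α = α') (hβ : β = β')
    (h : C.right α = C.left β) (h' : C.right α' = C.left β') :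
    C.hcompSq α β h = C.hcompSq α' β' h' := by
  subst hα hβ
  rfl

end DoubleCat

namespace DoubleFunctor

/-- The identity double functor. -/
def id (C : DoubleCat.{u, v, w, x}) : DoubleFunctor C C where
  toMap := DoubleMap.id C
  str :=
    { comp := fun _ _ => Iso.refl _
      unit := fun _ => Iso.refl _
      left_comp := fun _ _ => C.left_id _
      right_comp := fun _ _ => C.right_id _
      left_unit := fun _ => C.left_id _
      right_unit := fun _ => C.right_id _
      comp_naturality := fun _ _ _ _ => (Category.comp_id _).trans (Category.id_comp _).symm
      unit_naturality := fun _ => (Category.comp_id _).trans (Category.id_comp _).symm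
      comp_assoc := fun M N K h₁ h₂ => C.id_coh_assoc M N K h₁ h₂
      comp_lunit := fun M h => C.id_coh_lunit M h
      comp_runit := fun M h => C.id_coh_runit M h }

section Comp

variable {C : DoubleCat.{u, v, w, x}} {D : DoubleCat.{u', v', w', x'}}
  {E : DoubleCat.{u'', v'', w'', x''}} (F : DoubleFunctor C D) (G : DoubleFunctor D E)

/-- The comparison for horizontal composition of a composite double functor. -/
def compIso {X Y Z : C.Obj} (M : C.Hor X Y) (N : C.Hor Y Z) :
    tot (E.hcomp (G.toMap.hor (F.toMap.hor M)) (G.toMap.hor (F.toMap.hor N))) ≅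
      tot (G.toMap.hor (F.toMap.hor (C.hcomp M N))) :=
  G.str.comp (F.toMap.hor M) (F.toMap.hor N) ≪≫ G.toMap.sqIso (F.str.comp M N)

/-- The comparison for horizontal identities of a composite double functor. -/
def unitIso (X : C.Obj) :
    tot (E.hid (G.toMap.vert.obj (F.toMap.vert.obj X))) ≅
      tot (G.toMap.hor (F.toMap.hor (C.hid X))) :=
  G.str.unit (F.toMap.vert.obj X) ≪≫ G.toMap.sqIso (F.str.unit X)

theorem compIso_hom {X Y Z : C.Obj} (M : C.Hor X Y) (N : C.Hor Y Z) :
    (compIso F G M N).hom = (G.str.comp (F.toMap.hor M) (F.toMap.hor N)).hom ≫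
      G.toMap.sq (F.str.comp M N).hom := rfl

theorem unitIso_hom (X : C.Obj) :
    (unitIso F G X).hom = (G.str.unit (F.toMap.vert.obj X)).hom ≫
      G.toMap.sq (F.str.unit X).hom := rfl

theorem left_compIso {X Y Z : C.Obj} (M : C.Hor X Y) (N : C.Hor Y Z) :
    E.left (compIso F G M N).hom = 𝟙 _ := by
  rw [compIso_hom, E.left_comp, G.str.left_comp, G.toMap.left_sq, F.str.left_comp]
  refine (Category.id_comp _).trans (G.toMap.vert.map_id _)

theorem right_compIso {X Y Z : C.Obj} (M : C.Hor X Y) (N : C.Hor Y Z) :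
    E.right (compIso F G M N).hom = 𝟙 _ := by
  rw [compIso_hom, E.right_comp, G.str.right_comp, G.toMap.right_sq, F.str.right_comp]
  refine (Category.id_comp _).trans (G.toMap.vert.map_id _)

theorem left_unitIso (X : C.Obj) : E.left (unitIso F G X).hom = 𝟙 _ := by
  rw [unitIso_hom, E.left_comp, G.str.left_unit, G.toMap.left_sq, F.str.left_unit]
  refine (Category.id_comp _).trans (G.toMap.vert.map_id _)

theorem right_unitIso (X : C.Obj) : E.right (unitIso F G X).hom = 𝟙 _ := by
  rw [unitIso_hom, E.right_comp, G.str.right_unit, G.toMap.right_sq, F.str.right_unit]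
  refine (Category.id_comp _).trans (G.toMap.vert.map_id _)

theorem compIso_naturality {X Y Z X' Y' Z' : C.Obj} {M : C.Hor X Y} {N : C.Hor Y Z}
    {M' : C.Hor X' Y'} {N' : C.Hor Y' Z'} (α : tot M ⟶ tot M') (β : tot N ⟶ tot N')
    (h : C.right α = C.left β)
    (h' : E.right (G.toMap.sq (F.toMap.sq α)) = E.left (G.toMap.sq (F.toMap.sq β))) :
    E.hcompSq (G.toMap.sq (F.toMap.sq α)) (G.toMap.sq (F.toMap.sq β)) h' ≫
        (compIso F G M' N').hom =
      (compIso F G M N).hom ≫ G.toMap.sq (F.toMap.sq (C.hcompSq α β h)) := by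
  have k : D.right (F.toMap.sq α) = D.left (F.toMap.sq β) := by
    rw [F.toMap.right_sq, F.toMap.left_sq, h]
  rw [compIso_hom, compIso_hom, ← Category.assoc, G.str.comp_naturality _ _ k, Category.assoc,
    Category.assoc, ← G.toMap.sq_comp, ← G.toMap.sq_comp, F.str.comp_naturality]

theorem unitIso_naturality {X Y : C.Obj} (f : X ⟶ Y) :
    E.hidSq (G.toMap.vert.map (F.toMap.vert.map f)) ≫ (unitIso F G Y).hom =
      (unitIso F G X).hom ≫ G.toMap.sq (F.toMap.sq (C.hidSq f)) := by
  rw [unitIso_hom, unitIso_hom, ← Category.assoc, G.str.unit_naturality, Category.assoc,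
    Category.assoc, ← G.toMap.sq_comp, ← G.toMap.sq_comp, F.str.unit_naturality]

theorem compIso_assoc {X Y Z W : C.Obj} (M : C.Hor X Y) (N : C.Hor Y Z) (K : C.Hor Z W)
    (h₁ : E.right (compIso F G M N).hom = E.left (𝟙 (tot (G.toMap.hor (F.toMap.hor K)))))
    (h₂ : E.right (𝟙 (tot (G.toMap.hor (F.toMap.hor M)))) = E.left (compIso F G N K).hom) :
    E.hcompSq (compIso F G M N).hom (𝟙 (tot (G.toMap.hor (F.toMap.hor K)))) h₁ ≫
        (compIso F G (C.hcomp M N) K).hom ≫ G.toMap.sq (F.toMap.sq (C.assoc M N K).hom) =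
      (E.assoc (G.toMap.hor (F.toMap.hor M)) (G.toMap.hor (F.toMap.hor N))
          (G.toMap.hor (F.toMap.hor K))).hom ≫
        E.hcompSq (𝟙 (tot (G.toMap.hor (F.toMap.hor M)))) (compIso F G N K).hom h₂ ≫
          (compIso F G M (C.hcomp N K)).hom := by
  have k₁ : D.right (F.str.comp M N).hom = D.left (𝟙 (tot (F.toMap.hor K))) := by
    rw [F.str.right_comp, D.left_id]
  have k₂ : D.right (𝟙 (tot (F.toMap.hor M))) = D.left (F.str.comp N K).hom := by
    rw [F.str.left_comp, D.right_id]
  have l₁ : E.right (G.str.comp (F.toMap.hor M) (F.toMap.hor N)).hom =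
      E.left (𝟙 (tot (G.toMap.hor (F.toMap.hor K)))) := by
    rw [G.str.right_comp, E.left_id]
  have l₂ : E.right (𝟙 (tot (G.toMap.hor (F.toMap.hor M)))) =
      E.left (G.str.comp (F.toMap.hor N) (F.toMap.hor K)).hom := by
    rw [G.str.left_comp, E.right_id]
  have m₁ : E.right (G.toMap.sq (F.str.comp M N).hom) =
      E.left (G.toMap.sq (𝟙 (tot (F.toMap.hor K)))) := by
    rw [G.toMap.right_sq, G.toMap.left_sq, k₁]
  have m₂ : E.right (G.toMap.sq (𝟙 (tot (F.toMap.hor M)))) =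
      E.left (G.toMap.sq (F.str.comp N K).hom) := by
    rw [G.toMap.right_sq, G.toMap.left_sq, k₂]
  have e₁ : E.hcompSq (compIso F G M N).hom (𝟙 (tot (G.toMap.hor (F.toMap.hor K)))) h₁ =
      E.hcompSq (G.str.comp (F.toMap.hor M) (F.toMap.hor N)).hom (𝟙 _) l₁ ≫
        E.hcompSq (G.toMap.sq (F.str.comp M N).hom) (G.toMap.sq (𝟙 (tot (F.toMap.hor K)))) m₁ := by
    rw [← E.hcompSq_comp _ _ _ _ _ _
      (by rw [E.right_comp, E.left_comp, l₁, m₁])]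
    exact DoubleCat.hcompSq_congr rfl (by rw [G.toMap.sq_id, Category.id_comp]) _ _
  have e₂ : E.hcompSq (𝟙 (tot (G.toMap.hor (F.toMap.hor M)))) (compIso F G N K).hom h₂ =
      E.hcompSq (𝟙 _) (G.str.comp (F.toMap.hor N) (F.toMap.hor K)).hom l₂ ≫
        E.hcompSq (G.toMap.sq (𝟙 (tot (F.toMap.hor M)))) (G.toMap.sq (F.str.comp N K).hom) m₂ := by
    rw [← E.hcompSq_comp _ _ _ _ _ _
      (by rw [E.right_comp, E.left_comp, l₂, m₂])]
    exact DoubleCat.hcompSq_congr (by rw [G.toMap.sq_id, Category.id_comp]) rfl _ _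
  have n₁ := G.str.comp_naturality (F.str.comp M N).hom (𝟙 (tot (F.toMap.hor K))) k₁ m₁
  have n₂ := G.str.comp_naturality (𝟙 (tot (F.toMap.hor M))) (F.str.comp N K).hom k₂ m₂
  have f := congrArg G.toMap.sq (F.str.comp_assoc M N K k₁ k₂)
  rw [G.toMap.sq_comp, G.toMap.sq_comp, G.toMap.sq_comp, G.toMap.sq_comp] at f
  have g := G.str.comp_assoc (F.toMap.hor M) (F.toMap.hor N) (F.toMap.hor K) l₁ l₂
  rw [e₁, e₂, compIso_hom, compIso_hom, Category.assoc, Category.assoc]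
  rw [← Category.assoc (E.hcompSq (G.toMap.sq (F.str.comp M N).hom) _ _), n₁, Category.assoc, f]
  rw [Category.assoc, ← Category.assoc (E.hcompSq (G.toMap.sq (𝟙 (tot (F.toMap.hor M)))) _ _), n₂]
  simp only [← Category.assoc] at g ⊢
  rw [g]

theorem compIso_lunit {X Y : C.Obj} (M : C.Hor X Y)
    (h : E.right (unitIso F G X).hom = E.left (𝟙 (tot (G.toMap.hor (F.toMap.hor M))))) :
    E.hcompSq (unitIso F G X).hom (𝟙 (tot (G.toMap.hor (F.toMap.hor M)))) h ≫
        (compIso F G (C.hid X) M).hom ≫ G.toMap.sq (F.toMap.sq (C.lunit M).hom) =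
      (E.lunit (G.toMap.hor (F.toMap.hor M))).hom := by
  have k : D.right (F.str.unit X).hom = D.left (𝟙 (tot (F.toMap.hor M))) := by
    rw [F.str.right_unit, D.left_id]
  have l : E.right (G.str.unit (F.toMap.vert.obj X)).hom =
      E.left (𝟙 (tot (G.toMap.hor (F.toMap.hor M)))) := by
    rw [G.str.right_unit, E.left_id]
  have m : E.right (G.toMap.sq (F.str.unit X).hom) =
      E.left (G.toMap.sq (𝟙 (tot (F.toMap.hor M)))) := by
    rw [G.toMap.right_sq, G.toMap.left_sq, k]
  have e : E.hcompSq (unitIso F G X).hom (𝟙 (tot (G.toMap.hor (F.toMap.hor M)))) h =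
      E.hcompSq (G.str.unit (F.toMap.vert.obj X)).hom (𝟙 _) l ≫
        E.hcompSq (G.toMap.sq (F.str.unit X).hom) (G.toMap.sq (𝟙 (tot (F.toMap.hor M)))) m := by
    rw [← E.hcompSq_comp _ _ _ _ _ _
      (by rw [E.right_comp, E.left_comp, l, m])]
    exact DoubleCat.hcompSq_congr rfl (by rw [G.toMap.sq_id, Category.id_comp]) _ _
  have n := G.str.comp_naturality (F.str.unit X).hom (𝟙 (tot (F.toMap.hor M))) k m
  have f := congrArg G.toMap.sq (F.str.comp_lunit M k)
  rw [G.toMap.sq_comp, G.toMap.sq_comp] at f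
  have g := G.str.comp_lunit (F.toMap.hor M) l
  rw [e, compIso_hom, Category.assoc, Category.assoc]
  rw [← Category.assoc (E.hcompSq (G.toMap.sq (F.str.unit X).hom) _ _), n, Category.assoc, f]
  exact g

theorem compIso_runit {X Y : C.Obj} (M : C.Hor X Y)
    (h : E.right (𝟙 (tot (G.toMap.hor (F.toMap.hor M)))) = E.left (unitIso F G Y).hom) :
    E.hcompSq (𝟙 (tot (G.toMap.hor (F.toMap.hor M)))) (unitIso F G Y).hom h ≫
        (compIso F G M (C.hid Y)).hom ≫ G.toMap.sq (F.toMap.sq (C.runit M).hom) =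
      (E.runit (G.toMap.hor (F.toMap.hor M))).hom := by
  have k : D.right (𝟙 (tot (F.toMap.hor M))) = D.left (F.str.unit Y).hom := by
    rw [F.str.left_unit, D.right_id]
  have l : E.right (𝟙 (tot (G.toMap.hor (F.toMap.hor M)))) =
      E.left (G.str.unit (F.toMap.vert.obj Y)).hom := by
    rw [G.str.left_unit, E.right_id]
  have m : E.right (G.toMap.sq (𝟙 (tot (F.toMap.hor M)))) =
      E.left (G.toMap.sq (F.str.unit Y).hom) := by
    rw [G.toMap.right_sq, G.toMap.left_sq, k]
  have e : E.hcompSq (𝟙 (tot (G.toMap.hor (F.toMap.hor M)))) (unitIso F G Y).hom h =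
      E.hcompSq (𝟙 _) (G.str.unit (F.toMap.vert.obj Y)).hom l ≫
        E.hcompSq (G.toMap.sq (𝟙 (tot (F.toMap.hor M)))) (G.toMap.sq (F.str.unit Y).hom) m := by
    rw [← E.hcompSq_comp _ _ _ _ _ _
      (by rw [E.right_comp, E.left_comp, l, m])]
    exact DoubleCat.hcompSq_congr (by rw [G.toMap.sq_id, Category.id_comp]) rfl _ _
  have n := G.str.comp_naturality (𝟙 (tot (F.toMap.hor M))) (F.str.unit Y).hom k m
  have f := congrArg G.toMap.sq (F.str.comp_runit M k)
  rw [G.toMap.sq_comp, G.toMap.sq_comp] at f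
  have g := G.str.comp_runit (F.toMap.hor M) l
  rw [e, compIso_hom, Category.assoc, Category.assoc]
  rw [← Category.assoc (E.hcompSq _ (G.toMap.sq (F.str.unit Y).hom) _), n, Category.assoc, f]
  exact g

/-- Compatibility of a composite double functor with horizontal composition. -/
def compStr : PseudoStructure (F.toMap.comp G.toMap) where
  comp M N := compIso F G M N
  unit X := unitIso F G X
  left_comp M N := left_compIso F G M N
  right_comp M N := right_compIso F G M N
  left_unit X := left_unitIso F G X
  right_unit X := right_unitIso F G X
  comp_naturality α β h h' := compIso_naturality F G α β h h'
  unit_naturality f := unitIso_naturality F G f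
  comp_assoc M N K h₁ h₂ := compIso_assoc F G M N K h₁ h₂
  comp_lunit M h := compIso_lunit F G M h
  comp_runit M h := compIso_runit F G M h

/-- Composition of double functors. -/
def comp : DoubleFunctor C E := ⟨F.toMap.comp G.toMap, compStr F G⟩

end Comp

end DoubleFunctor

/-- An invertible vertical transformation between double functors. -/
structure DoubleNatIso {C : DoubleCat.{u, v, w, x}} {D : DoubleCat.{u', v', w', x'}}
    (F G : DoubleFunctor C D) where
  /-- the components at objects -/
  vert : F.toMap.vert ≅ G.toMap.vert
  /-- the components at horizontal arrows -/
  sq : ∀ {X Y : C.Obj} (M : C.Hor X Y), tot (F.toMap.hor M) ≅ tot (G.toMap.hor M)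
  left_sq : ∀ {X Y : C.Obj} (M : C.Hor X Y), D.left (sq M).hom = vert.hom.app X
  right_sq : ∀ {X Y : C.Obj} (M : C.Hor X Y), D.right (sq M).hom = vert.hom.app Y
  naturality : ∀ {X Y X' Y' : C.Obj} {M : C.Hor X Y} {M' : C.Hor X' Y'} (α : tot M ⟶ tot M'),
    F.toMap.sq α ≫ (sq M').hom = (sq M).hom ≫ G.toMap.sq α
  comp : ∀ {X Y Z : C.Obj} (M : C.Hor X Y) (N : C.Hor Y Z)
    (h : D.right (sq M).hom = D.left (sq N).hom),
      (F.str.comp M N).hom ≫ (sq (C.hcomp M N)).hom =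
        D.hcompSq (sq M).hom (sq N).hom h ≫ (G.str.comp M N).hom
  unit : ∀ X : C.Obj, (F.str.unit X).hom ≫ (sq (C.hid X)).hom =
    D.hidSq (vert.hom.app X) ≫ (G.str.unit X).hom

/-- An equivalence of framed bicategories: a double functor between framed bicategories which has
a quasi-inverse double functor, up to invertible vertical transformations. -/
def DoubleFunctor.IsFramedEquivalence {C : DoubleCat.{u, v, w, x}}
    {D : DoubleCat.{u', v', w', x'}} (F : DoubleFunctor C D) : Prop :=
  C.IsFramed ∧ D.IsFramed ∧ ∃ G : DoubleFunctor D C,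
    Nonempty (DoubleNatIso (DoubleFunctor.id C) (F.comp G)) ∧
      Nonempty (DoubleNatIso (G.comp F) (DoubleFunctor.id D))

/-! ## Spans relative to an endofunctor -/

section PSpan

variable {C : Type u} [Category.{v} C]

/-- A `P`-span from `A` to `B`: a diagram `P A ⟵ N ⟶ B`. -/
structure PSpan (P : C ⥤ C) (A B : C) where
  /-- the apex -/
  apex : C
  /-- the leg to `P A` -/
  dom : apex ⟶ P.obj A
  /-- the leg to `B` -/
  cod : apex ⟶ B

/-- A morphism of `P`-spans, with varying endpoints. -/
@[ext]
structure PSpanSq {P : C ⥤ C} (M N : HorTotal (PSpan P)) where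
  /-- the map on sources -/
  left : M.src ⟶ N.src
  /-- the map on targets -/
  right : M.tgt ⟶ N.tgt
  /-- the map on apices -/
  mid : M.hor.apex ⟶ N.hor.apex
  dom_comm : mid ≫ N.hor.dom = M.hor.dom ≫ P.map left
  cod_comm : mid ≫ N.hor.cod = M.hor.cod ≫ right

/-- The category of all `P`-spans. -/
instance pspanCategory (P : C ⥤ C) : Category (HorTotal (PSpan P)) where
  Hom M N := PSpanSq M N
  id M := ⟨𝟙 _, 𝟙 _, 𝟙 _, by simp, by simp⟩
  comp α β := ⟨α.left ≫ β.left, α.right ≫ β.right, α.mid ≫ β.mid,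
    by rw [Category.assoc, β.dom_comm, ← Category.assoc, α.dom_comm, Category.assoc, P.map_comp],
    by rw [Category.assoc, β.cod_comm, ← Category.assoc, α.cod_comm, Category.assoc]⟩
  id_comp α := by ext <;> exact Category.id_comp _
  comp_id α := by ext <;> exact Category.comp_id _
  assoc α β γ := by ext <;> exact Category.assoc _ _ _

namespace PSpanSq

variable {P : C ⥤ C}

@[ext]
theorem hom_ext {M N : HorTotal (PSpan P)} {α β : M ⟶ N} (h₁ : PSpanSq.left α = PSpanSq.left β)
    (h₂ : PSpanSq.right α = PSpanSq.right β) (h₃ : PSpanSq.mid α = PSpanSq.mid β) : α = β :=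
  PSpanSq.ext h₁ h₂ h₃

@[simp] theorem id_left (M : HorTotal (PSpan P)) : PSpanSq.left (𝟙 M) = 𝟙 _ := rfl
@[simp] theorem id_right (M : HorTotal (PSpan P)) : PSpanSq.right (𝟙 M) = 𝟙 _ := rfl
@[simp] theorem id_mid (M : HorTotal (PSpan P)) : PSpanSq.mid (𝟙 M) = 𝟙 _ := rfl
@[simp] theorem comp_left {M N K : HorTotal (PSpan P)} (α : M ⟶ N) (β : N ⟶ K) :
    PSpanSq.left (α ≫ β) = PSpanSq.left α ≫ PSpanSq.left β := rfl
@[simp] theorem comp_right {M N K : HorTotal (PSpan P)} (α : M ⟶ N) (β : N ⟶ K) :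
    PSpanSq.right (α ≫ β) = PSpanSq.right α ≫ PSpanSq.right β := rfl
@[simp] theorem comp_mid {M N K : HorTotal (PSpan P)} (α : M ⟶ N) (β : N ⟶ K) :
    PSpanSq.mid (α ≫ β) = PSpanSq.mid α ≫ PSpanSq.mid β := rfl

/-- An isomorphism of `P`-spans with identity endpoints. -/
def globIso {A B : C} {M N : PSpan P A B} (e : M.apex ≅ N.apex) (h₁ : e.hom ≫ N.dom = M.dom)
    (h₂ : e.hom ≫ N.cod = M.cod) : tot M ≅ tot N where
  hom := ⟨𝟙 _, 𝟙 _, e.hom, by simpa using h₁, by simpa using h₂⟩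
  inv := ⟨𝟙 _, 𝟙 _, e.inv, by simp [← h₁], by simp [← h₂]⟩
  hom_inv_id := by ext <;> simp
  inv_hom_id := by ext <;> simp

end PSpanSq

/-- A cartesian monad: the functor preserves pullbacks, and all naturality squares of the unit and
of the multiplication are pullbacks. -/
structure IsCartesianMonad (T : Monad C) : Prop where
  preserves : PreservesLimitsOfShape WalkingCospan T.toFunctor
  unit : NatTrans.Equifibered T.η
  mult : NatTrans.Equifibered T.μ

variable [HasPullbacks C] (T : Monad C)

namespace PSpan

/-- The identity span `T A ⟵ A ⟶ A`, with legs the unit and the identity. -/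
abbrev hid (A : C) : PSpan T.toFunctor A A := ⟨A, T.η.app A, 𝟙 A⟩

variable {T}

/-- The composite of `T A ⟵ N ⟶ B` and `T B ⟵ U ⟶ D`: its apex is the pullback of
`T N ⟶ T B ⟵ U`, and its leg to `T A` is `T N ⟶ T (T A) ⟶ T A` on the first factor. -/
noncomputable def hcomp {A B D : C} (M : PSpan T.toFunctor A B) (N : PSpan T.toFunctor B D) :
    PSpan T.toFunctor A D where
  apex := pullback (T.map M.cod) N.dom
  dom := pullback.fst _ _ ≫ T.map M.dom ≫ T.μ.app A
  cod := pullback.snd _ _ ≫ N.cod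

/-- First projection from the apex of a composite span. -/
noncomputable def fst {A B D : C} (M : PSpan T.toFunctor A B) (N : PSpan T.toFunctor B D) :
    (hcomp M N).apex ⟶ T.obj M.apex := pullback.fst _ _

/-- Second projection from the apex of a composite span. -/
noncomputable def snd {A B D : C} (M : PSpan T.toFunctor A B) (N : PSpan T.toFunctor B D) :
    (hcomp M N).apex ⟶ N.apex := pullback.snd _ _

section Lemmas

variable {A B D : C} (M : PSpan T.toFunctor A B) (N : PSpan T.toFunctor B D)

theorem isPullback : IsPullback (fst M N) (snd M N) (T.map M.cod) N.dom :=
  IsPullback.of_hasPullback _ _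

theorem hcomp_dom : (hcomp M N).dom = fst M N ≫ T.map M.dom ≫ T.μ.app A := rfl

theorem hcomp_cod : (hcomp M N).cod = snd M N ≫ N.cod := rfl

theorem condition : fst M N ≫ T.map M.cod = snd M N ≫ N.dom := (isPullback M N).w

variable {M N}

/-- The universal property of the apex of a composite span. -/
noncomputable def lift {X : C} (f : X ⟶ T.obj M.apex) (g : X ⟶ N.apex)
    (h : f ≫ T.map M.cod = g ≫ N.dom) : X ⟶ (hcomp M N).apex :=
  (isPullback M N).lift f g h

@[simp]
theorem lift_fst {X : C} (f : X ⟶ T.obj M.apex) (g : X ⟶ N.apex)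
    (h : f ≫ T.map M.cod = g ≫ N.dom) : lift f g h ≫ fst M N = f :=
  (isPullback M N).lift_fst f g h

@[simp]
theorem lift_snd {X : C} (f : X ⟶ T.obj M.apex) (g : X ⟶ N.apex)
    (h : f ≫ T.map M.cod = g ≫ N.dom) : lift f g h ≫ snd M N = g :=
  (isPullback M N).lift_snd f g h

@[simp]
theorem lift_fst_assoc {X Y : C} (f : X ⟶ T.obj M.apex) (g : X ⟶ N.apex)
    (h : f ≫ T.map M.cod = g ≫ N.dom) (k : T.obj M.apex ⟶ Y) :
    lift f g h ≫ fst M N ≫ k = f ≫ k := by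
  rw [← Category.assoc, lift_fst]

@[simp]
theorem lift_snd_assoc {X Y : C} (f : X ⟶ T.obj M.apex) (g : X ⟶ N.apex)
    (h : f ≫ T.map M.cod = g ≫ N.dom) (k : N.apex ⟶ Y) :
    lift f g h ≫ snd M N ≫ k = g ≫ k := by
  rw [← Category.assoc, lift_snd]

theorem hom_ext {X : C} {f g : X ⟶ (hcomp M N).apex} (h₁ : f ≫ fst M N = g ≫ fst M N)
    (h₂ : f ≫ snd M N = g ≫ snd M N) : f = g :=
  (isPullback M N).hom_ext h₁ h₂

theorem isPullback_mult (hT : IsCartesianMonad T) :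
    IsPullback (T.map (fst M N) ≫ T.μ.app M.apex) (T.map (snd M N)) (T.map M.cod)
      (T.map N.dom ≫ T.μ.app B) := by
  have := hT.preserves
  exact ((isPullback M N).map T.toFunctor).flip.paste_vert (hT.mult M.cod) |>.flip

end Lemmas

/-- Horizontal composition of morphisms of spans. -/
noncomputable def hcompSq {A B D A' B' D' : C} {M : PSpan T.toFunctor A B}
    {N : PSpan T.toFunctor B D} {M' : PSpan T.toFunctor A' B'} {N' : PSpan T.toFunctor B' D'}
    (α : tot M ⟶ tot M') (β : tot N ⟶ tot N') (h : PSpanSq.right α = PSpanSq.left β) :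
    tot (hcomp M N) ⟶ tot (hcomp M' N') :=
  PSpanSq.mk (M := tot (hcomp M N)) (N := tot (hcomp M' N'))
    (PSpanSq.left (M := tot M) (N := tot M') α) (PSpanSq.right (M := tot N) (N := tot N') β)
    (lift (fst M N ≫ T.map (PSpanSq.mid α)) (snd M N ≫ PSpanSq.mid β) (by
      have h₁ := PSpanSq.cod_comm α
      have h₂ := PSpanSq.dom_comm β
      rw [Category.assoc, Category.assoc, ← T.map_comp, h₁, h₂, T.map_comp, ← h,
        ← Category.assoc, condition, Category.assoc]))
    (by
      have h₁ := PSpanSq.dom_comm α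
      have h₃ := T.μ.naturality (PSpanSq.left (M := tot M) (N := tot M') α)
      dsimp at h₃
      rw [hcomp_dom, hcomp_dom, lift_fst_assoc, Category.assoc, ← T.map_comp_assoc, h₁]
      simp only [Category.assoc, T.map_comp]
      rw [h₃])
    (by
      have h₂ := PSpanSq.cod_comm β
      rw [hcomp_cod, hcomp_cod, lift_snd_assoc, Category.assoc, h₂, Category.assoc])

section HcompSq

variable {A B D A' B' D' : C} {M : PSpan T.toFunctor A B}
    {N : PSpan T.toFunctor B D} {M' : PSpan T.toFunctor A' B'} {N' : PSpan T.toFunctor B' D'}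
    (α : tot M ⟶ tot M') (β : tot N ⟶ tot N') (h : PSpanSq.right α = PSpanSq.left β)

@[simp] theorem hcompSq_left : PSpanSq.left (hcompSq α β h) = PSpanSq.left α := rfl
@[simp] theorem hcompSq_right : PSpanSq.right (hcompSq α β h) = PSpanSq.right β := rfl

@[simp]
theorem hcompSq_fst :
    PSpanSq.mid (hcompSq α β h) ≫ fst M' N' = fst M N ≫ T.map (PSpanSq.mid α) := lift_fst _ _ _

@[simp]
theorem hcompSq_snd :
    PSpanSq.mid (hcompSq α β h) ≫ snd M' N' = snd M N ≫ PSpanSq.mid β := lift_snd _ _ _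

@[simp]
theorem hcompSq_fst_assoc {X : C} (k : T.obj M'.apex ⟶ X) :
    PSpanSq.mid (hcompSq α β h) ≫ fst M' N' ≫ k = fst M N ≫ T.map (PSpanSq.mid α) ≫ k := by
  rw [← Category.assoc, hcompSq_fst, Category.assoc]

@[simp]
theorem hcompSq_snd_assoc {X : C} (k : N'.apex ⟶ X) :
    PSpanSq.mid (hcompSq α β h) ≫ snd M' N' ≫ k = snd M N ≫ PSpanSq.mid β ≫ k := by
  rw [← Category.assoc, hcompSq_snd, Category.assoc]

end HcompSq

section Assoc

variable {A B D E : C} (M : PSpan T.toFunctor A B) (N : PSpan T.toFunctor B D)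
  (K : PSpan T.toFunctor D E)

/-- The associativity comparison on apices. -/
noncomputable def assocHom : (hcomp (hcomp M N) K).apex ⟶ (hcomp M (hcomp N K)).apex :=
  lift (fst (hcomp M N) K ≫ T.map (fst M N) ≫ T.μ.app M.apex)
    (lift (fst (hcomp M N) K ≫ T.map (snd M N)) (snd (hcomp M N) K) (by
      rw [Category.assoc, ← T.map_comp, ← hcomp_cod, condition]))
    (by
      have h := T.μ.naturality M.cod
      dsimp at h
      rw [hcomp_dom, lift_fst_assoc, Category.assoc, Category.assoc, Category.assoc, ← h,
        ← T.map_comp_assoc, condition, T.map_comp_assoc])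

theorem assocHom_fst : assocHom M N K ≫ fst M (hcomp N K) =
    fst (hcomp M N) K ≫ T.map (fst M N) ≫ T.μ.app M.apex := lift_fst _ _ _

theorem assocHom_snd_fst : assocHom M N K ≫ snd M (hcomp N K) ≫ fst N K =
    fst (hcomp M N) K ≫ T.map (snd M N) := by
  rw [← Category.assoc, assocHom, lift_snd, lift_fst]

theorem assocHom_snd_snd : assocHom M N K ≫ snd M (hcomp N K) ≫ snd N K =
    snd (hcomp M N) K := by
  rw [← Category.assoc, assocHom, lift_snd, lift_snd]

theorem assocHom_fst_assoc {X : C} (k : T.obj M.apex ⟶ X) :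
    assocHom M N K ≫ fst M (hcomp N K) ≫ k =
      fst (hcomp M N) K ≫ T.map (fst M N) ≫ T.μ.app M.apex ≫ k := by
  rw [← Category.assoc, assocHom_fst]
  simp only [Category.assoc]

theorem assocHom_snd_fst_assoc {X : C} (k : T.obj N.apex ⟶ X) :
    assocHom M N K ≫ snd M (hcomp N K) ≫ fst N K ≫ k =
      fst (hcomp M N) K ≫ T.map (snd M N) ≫ k := by
  have h := assocHom_snd_fst M N K
  rw [← Category.assoc] at h
  rw [← Category.assoc, ← Category.assoc, h, Category.assoc]

theorem assocHom_snd_snd_assoc {X : C} (k : K.apex ⟶ X) :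
    assocHom M N K ≫ snd M (hcomp N K) ≫ snd N K ≫ k = snd (hcomp M N) K ≫ k := by
  have h := assocHom_snd_snd M N K
  rw [← Category.assoc] at h
  rw [← Category.assoc, ← Category.assoc, h]

variable (hT : IsCartesianMonad T)

/-- The inverse associativity comparison on apices. -/
noncomputable def assocInv : (hcomp M (hcomp N K)).apex ⟶ (hcomp (hcomp M N) K).apex :=
  lift ((isPullback_mult hT).lift (fst M (hcomp N K)) (snd M (hcomp N K) ≫ fst N K) (by
      rw [condition, hcomp_dom, Category.assoc]))
    (snd M (hcomp N K) ≫ snd N K) (by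
      rw [hcomp_cod, T.map_comp, ← Category.assoc, IsPullback.lift_snd, Category.assoc,
        condition, Category.assoc])

/-- The associativity comparison on apices is invertible. -/
noncomputable def assocApex : (hcomp (hcomp M N) K).apex ≅ (hcomp M (hcomp N K)).apex where
  hom := assocHom M N K
  inv := assocInv M N K hT
  hom_inv_id := by
    refine hom_ext ((isPullback_mult hT).hom_ext ?_ ?_) ?_
    · rw [Category.id_comp, Category.assoc, Category.assoc, assocInv, lift_fst_assoc,
        IsPullback.lift_fst, assocHom_fst]
    · rw [Category.id_comp, Category.assoc, Category.assoc, assocInv, lift_fst_assoc,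
        IsPullback.lift_snd, assocHom_snd_fst]
    · rw [Category.id_comp, Category.assoc, assocInv, lift_snd, assocHom_snd_snd]
  inv_hom_id := by
    refine hom_ext ?_ (hom_ext ?_ ?_)
    · rw [Category.id_comp, Category.assoc, assocHom_fst, assocInv, lift_fst_assoc,
        IsPullback.lift_fst]
    · rw [Category.id_comp, Category.assoc, Category.assoc, assocHom_snd_fst, assocInv,
        lift_fst_assoc, IsPullback.lift_snd]
    · rw [Category.id_comp, Category.assoc, Category.assoc, assocHom_snd_snd, assocInv, lift_snd]

/-- The associativity constraint for composition of spans. -/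
noncomputable def assocIso : tot (hcomp (hcomp M N) K) ≅ tot (hcomp M (hcomp N K)) :=
  PSpanSq.globIso (assocApex M N K hT)
    (by
      have h := T.μ.naturality M.dom
      have h' := T.assoc A
      dsimp at h h'
      change assocHom M N K ≫ _ = _
      rw [hcomp_dom, hcomp_dom, hcomp_dom, ← Category.assoc, assocHom_fst]
      simp only [Category.assoc, T.map_comp]
      rw [h', reassoc_of% h])
    (by
      change assocHom M N K ≫ _ = _
      rw [hcomp_cod, hcomp_cod, hcomp_cod, ← Category.assoc (snd M _), ← Category.assoc,
        assocHom_snd_snd])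

theorem assocIso_mid : PSpanSq.mid (assocIso M N K hT).hom = assocHom M N K := rfl

theorem hcomp₃_hom_ext {X : C} {f g : X ⟶ (hcomp M (hcomp N K)).apex}
    (h₁ : f ≫ fst M (hcomp N K) = g ≫ fst M (hcomp N K))
    (h₂ : f ≫ snd M (hcomp N K) ≫ fst N K = g ≫ snd M (hcomp N K) ≫ fst N K)
    (h₃ : f ≫ snd M (hcomp N K) ≫ snd N K = g ≫ snd M (hcomp N K) ≫ snd N K) : f = g :=
  hom_ext h₁ (hom_ext (by rw [Category.assoc, h₂, Category.assoc])
    (by rw [Category.assoc, h₃, Category.assoc]))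

theorem assocHom_naturality {A' B' D' E' : C} {M : PSpan T.toFunctor A B}
    {N : PSpan T.toFunctor B D} {K : PSpan T.toFunctor D E} {M' : PSpan T.toFunctor A' B'}
    {N' : PSpan T.toFunctor B' D'} {K' : PSpan T.toFunctor D' E'}
    (α : tot M ⟶ tot M') (β : tot N ⟶ tot N') (γ : tot K ⟶ tot K')
    (h₁ : PSpanSq.right α = PSpanSq.left β) (h₂ : PSpanSq.right β = PSpanSq.left γ)
    (h₃ : PSpanSq.right (hcompSq α β h₁) = PSpanSq.left γ)
    (h₄ : PSpanSq.right α = PSpanSq.left (hcompSq β γ h₂)) :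
    PSpanSq.mid (hcompSq (hcompSq α β h₁) γ h₃) ≫ assocHom M' N' K' =
      assocHom M N K ≫ PSpanSq.mid (hcompSq α (hcompSq β γ h₂) h₄) := by
  have hμ := T.μ.naturality (PSpanSq.mid (M := tot M) (N := tot M') α)
  dsimp at hμ
  refine hcomp₃_hom_ext M' N' K' ?_ ?_ ?_
  · rw [Category.assoc, assocHom_fst, Category.assoc, hcompSq_fst, ← Category.assoc (assocHom _ _ _),
      assocHom_fst, hcompSq_fst_assoc, ← T.map_comp_assoc, hcompSq_fst]
    simp only [Category.assoc, T.map_comp]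
    rw [hμ]
  · rw [Category.assoc, assocHom_snd_fst, Category.assoc, hcompSq_snd_assoc, hcompSq_fst_assoc,
      hcompSq_fst, ← T.map_comp, hcompSq_snd, T.map_comp, ← Category.assoc, ← Category.assoc,
      ← Category.assoc, Category.assoc (assocHom _ _ _), assocHom_snd_fst]
  · rw [Category.assoc, assocHom_snd_snd, Category.assoc, hcompSq_snd_assoc, hcompSq_snd,
      hcompSq_snd, ← Category.assoc, ← Category.assoc, Category.assoc (assocHom _ _ _),
      assocHom_snd_snd]

end Assoc

section Pentagon

variable {A B D E F : C} (M : PSpan T.toFunctor A B) (N : PSpan T.toFunctor B D)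
  (K : PSpan T.toFunctor D E) (L : PSpan T.toFunctor E F) (hT : IsCartesianMonad T)

theorem pentagon_mid
    (h₁ : PSpanSq.right (assocIso M N K hT).hom = PSpanSq.left (𝟙 (tot L)))
    (h₂ : PSpanSq.right (𝟙 (tot M)) = PSpanSq.left (assocIso N K L hT).hom) :
    PSpanSq.mid (hcompSq (assocIso M N K hT).hom (𝟙 (tot L)) h₁) ≫ assocHom M (hcomp N K) L ≫
        PSpanSq.mid (hcompSq (𝟙 (tot M)) (assocIso N K L hT).hom h₂) =
      assocHom (hcomp M N) K L ≫ assocHom M N (hcomp K L) := by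
  have hμ := T.μ.naturality (fst M N)
  have hν := T.μ.naturality (snd M N)
  have hμ' := T.assoc M.apex
  dsimp at hμ hν hμ'
  refine hom_ext ?_ (hcomp₃_hom_ext N K L ?_ ?_ ?_)
  · simp only [Category.assoc, hcompSq_fst, PSpanSq.id_mid, T.map_id, Category.comp_id,
      assocHom_fst, assocHom_fst_assoc, hcompSq_fst_assoc, assocIso_mid]
    rw [← T.map_comp_assoc, assocHom_fst]
    simp only [T.map_comp, Category.assoc]
    rw [hμ', reassoc_of% hμ]
  · simp only [Category.assoc, hcompSq_snd_assoc, assocIso_mid, assocHom_fst, assocHom_snd_fst,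
      assocHom_snd_fst_assoc, hcompSq_fst_assoc]
    have e := congrArg (fun k => T.map k ≫ T.μ.app N.apex) (assocHom_snd_fst M N K)
    simp only [T.map_comp, Category.assoc] at e
    rw [e, hν, assocHom_fst_assoc]
  · simp only [Category.assoc, hcompSq_snd_assoc, assocIso_mid, assocHom_snd_fst,
      assocHom_snd_snd_assoc, assocHom_snd_fst_assoc, hcompSq_fst_assoc]
    rw [← T.map_comp, ← T.map_comp, assocHom_snd_snd]
  · simp only [Category.assoc, assocIso_mid, assocHom_snd_snd,
      assocHom_snd_snd_assoc, hcompSq_snd, PSpanSq.id_mid, Category.comp_id]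

end Pentagon

section Unit

variable {A B : C} (M : PSpan T.toFunctor A B)

theorem lunit_cond : M.dom ≫ T.map (hid T A).cod = 𝟙 M.apex ≫ M.dom := by simp

theorem lunit_condition : fst (hid T A) M = snd (hid T A) M ≫ M.dom := by
  have h := condition (hid T A) M
  rw [T.map_id] at h
  exact (Category.comp_id _).symm.trans h

/-- The left unit comparison on apices. -/
noncomputable def lunitApex : (hcomp (hid T A) M).apex ≅ M.apex where
  hom := snd (hid T A) M
  inv := lift (M := hid T A) M.dom (𝟙 _) (lunit_cond M)
  hom_inv_id := by
    refine hom_ext ?_ ?_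
    · rw [Category.id_comp, Category.assoc, lift_fst, lunit_condition]
    · rw [Category.id_comp, Category.assoc, lift_snd, Category.comp_id]
  inv_hom_id := lift_snd _ _ _

/-- The left unit constraint for composition of spans. -/
noncomputable def lunitIso : tot (hcomp (hid T A) M) ≅ tot M :=
  PSpanSq.globIso (lunitApex M)
    (by
      have h : T.map (T.η.app A) ≫ T.μ.app A = 𝟙 _ := T.right_unit A
      rw [hcomp_dom]
      change snd (hid T A) M ≫ M.dom = fst (hid T A) M ≫ T.map (T.η.app A) ≫ T.μ.app A
      rw [h, ← lunit_condition]
      exact (Category.comp_id _).symm)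
    (hcomp_cod _ _).symm

theorem runit_cond : T.η.app M.apex ≫ T.map M.cod = M.cod ≫ (hid T B).dom :=
  (T.η.naturality M.cod).symm

variable (hT : IsCartesianMonad T)

/-- The right unit comparison on apices. -/
noncomputable def runitApex : (hcomp M (hid T B)).apex ≅ M.apex where
  hom := (hT.unit M.cod).lift (snd M (hid T B)) (fst M (hid T B)) (condition M (hid T B)).symm
  inv := lift (M := M) (N := hid T B) (T.η.app M.apex) M.cod (runit_cond M)
  hom_inv_id := by
    refine hom_ext ?_ ?_
    · rw [Category.id_comp, Category.assoc, lift_fst]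
      exact IsPullback.lift_snd _ _ _ _
    · rw [Category.id_comp, Category.assoc, lift_snd]
      exact IsPullback.lift_fst _ _ _ _
  inv_hom_id := by
    refine (hT.unit M.cod).hom_ext ?_ ?_
    · rw [Category.assoc, IsPullback.lift_fst, lift_snd]
      exact (Category.id_comp _).symm
    · rw [Category.assoc, IsPullback.lift_snd, lift_fst]
      exact (Category.id_comp _).symm

/-- The right unit constraint for composition of spans. -/
noncomputable def runitIso : tot (hcomp M (hid T B)) ≅ tot M :=
  PSpanSq.globIso (runitApex M hT)
    (by
      have h₁ : (runitApex M hT).hom ≫ T.η.app M.apex = fst M (hid T B) :=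
        IsPullback.lift_snd _ _ _ _
      have h₂ := T.η.naturality M.dom
      have h₃ := T.left_unit A
      dsimp at h₂ h₃
      rw [hcomp_dom, ← h₁, Category.assoc, ← reassoc_of% h₂, h₃, Category.comp_id])
    (by
      have h₁ : (runitApex M hT).hom ≫ M.cod = snd M (hid T B) :=
        IsPullback.lift_fst _ _ _ _
      rw [hcomp_cod, h₁]
      exact (Category.comp_id _).symm)

theorem runit_fst : (runitApex M hT).hom ≫ T.η.app M.apex = fst M (hid T B) :=
  IsPullback.lift_snd _ _ _ _

theorem runit_snd : (runitApex M hT).hom ≫ M.cod = snd M (hid T B) :=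
  IsPullback.lift_fst _ _ _ _

theorem runitIso_mid : PSpanSq.mid (runitIso M hT).hom = (runitApex M hT).hom := rfl

end Unit

theorem runit_naturality_mid (hT : IsCartesianMonad T) {A B A' B' : C} {M : PSpan T.toFunctor A B}
    {M' : PSpan T.toFunctor A' B'} (α : tot M ⟶ tot M')
    {β : tot (hid T B) ⟶ tot (hid T B')} (hβ : PSpanSq.mid β = PSpanSq.right α)
    (h : PSpanSq.right α = PSpanSq.left β) :
    PSpanSq.mid (hcompSq α β h) ≫ (runitApex M' hT).hom =
      (runitApex M hT).hom ≫ PSpanSq.mid α := by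
  have hη := T.η.naturality (PSpanSq.mid (M := tot M) (N := tot M') α)
  dsimp at hη
  refine (hT.unit M'.cod).hom_ext ?_ ?_
  · have e : (PSpanSq.mid (hcompSq α β h) ≫ (runitApex M' hT).hom) ≫ M'.cod =
        ((runitApex M hT).hom ≫ PSpanSq.mid α) ≫ M'.cod := by
      rw [Category.assoc, runit_snd, hcompSq_snd, Category.assoc, PSpanSq.cod_comm, hβ,
        ← Category.assoc, runit_snd]
    exact e
  · rw [Category.assoc, runit_fst, hcompSq_fst, Category.assoc, hη, ← Category.assoc, runit_fst]

theorem triangle_mid (hT : IsCartesianMonad T) {A B D : C} (M : PSpan T.toFunctor A B)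
    (N : PSpan T.toFunctor B D)
    (h₁ : PSpanSq.right (runitIso M hT).hom = PSpanSq.left (𝟙 (tot N)))
    (h₂ : PSpanSq.right (𝟙 (tot M)) = PSpanSq.left (lunitIso N).hom) :
    assocHom M (hid T B) N ≫ PSpanSq.mid (hcompSq (𝟙 (tot M)) (lunitIso N).hom h₂) =
      PSpanSq.mid (hcompSq (runitIso M hT).hom (𝟙 (tot N)) h₁) := by
  have e := T.right_unit M.apex
  dsimp at e
  refine hom_ext ?_ ?_
  · simp only [Category.assoc, hcompSq_fst, PSpanSq.id_mid, T.map_id, Category.comp_id,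
      assocHom_fst, runitIso_mid, ← runit_fst M hT, T.map_comp, e]
  · simp only [Category.assoc, hcompSq_snd, PSpanSq.id_mid, Category.comp_id]
    exact assocHom_snd_snd M (hid T B) N

end PSpan

/-- The double category of `T`-spans, for a cartesian monad `T`: objects and vertical arrows are
those of the ambient category, horizontal arrows are `T`-spans, squares are morphisms of
`T`-spans. -/
noncomputable def pspanDouble (hT : IsCartesianMonad T) : DoubleCat where
  Obj := C
  Hor := PSpan T.toFunctor
  left α := PSpanSq.left α
  right α := PSpanSq.right α
  left_id _ := rfl
  right_id _ := rfl
  left_comp _ _ := rfl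
  right_comp _ _ := rfl
  hid A := PSpan.hid T A
  hidSq {A B} f := PSpanSq.mk (M := tot (PSpan.hid T A)) (N := tot (PSpan.hid T B)) f f f
    (T.η.naturality f) (by simp)
  left_hidSq _ := rfl
  right_hidSq _ := rfl
  hidSq_id _ := rfl
  hidSq_comp _ _ := rfl
  hcomp M N := PSpan.hcomp M N
  hcompSq α β h := PSpan.hcompSq α β h
  left_hcompSq _ _ _ := rfl
  right_hcompSq _ _ _ := rfl
  hcompSq_id M N h := by
    refine PSpanSq.hom_ext rfl rfl (PSpan.hom_ext ?_ ?_)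
    · rw [PSpan.hcompSq_fst]; simp
    · rw [PSpan.hcompSq_snd]; simp
  hcompSq_comp α β h α' β' h' h'' := by
    refine PSpanSq.hom_ext rfl rfl (PSpan.hom_ext ?_ ?_)
    · rw [PSpan.hcompSq_fst]; simp
    · rw [PSpan.hcompSq_snd]; simp
  assoc M N K := PSpan.assocIso M N K hT
  lunit M := PSpan.lunitIso M
  runit M := PSpan.runitIso M hT
  left_assoc _ _ _ := rfl
  right_assoc _ _ _ := rfl
  left_lunit _ := rfl
  right_lunit _ := rfl
  left_runit _ := rfl
  right_runit _ := rfl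
  assoc_naturality α β γ h₁ h₂ h₃ h₄ := by
    refine PSpanSq.hom_ext ?_ ?_ (PSpan.assocHom_naturality α β γ h₁ h₂ h₃ h₄)
    · exact (Category.comp_id _).trans (Category.id_comp _).symm
    · exact (Category.comp_id _).trans (Category.id_comp _).symm
  lunit_naturality α h := by
    refine PSpanSq.hom_ext ?_ ?_ (PSpan.hcompSq_snd _ _ _)
    · exact (Category.comp_id _).trans (Category.id_comp _).symm
    · exact (Category.comp_id _).trans (Category.id_comp _).symm
  runit_naturality {_ _ _ _ M M'} α h := by
    refine PSpanSq.hom_ext ?_ ?_ ?_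
    · exact (Category.comp_id _).trans (Category.id_comp _).symm
    · exact (Category.comp_id _).trans (Category.id_comp _).symm
    · exact PSpan.runit_naturality_mid hT α rfl h
  pentagon M N K L h₁ h₂ := by
    refine PSpanSq.hom_ext ?_ ?_ (PSpan.pentagon_mid M N K L hT h₁ h₂)
    · exact Category.id_comp _
    · exact Category.id_comp _
  triangle M N h₁ h₂ := by
    refine PSpanSq.hom_ext ?_ ?_ (PSpan.triangle_mid hT M N h₁ h₂)
    · exact Category.id_comp _
    · exact Category.id_comp _

end PSpan

/-! ## Cartesian functors between slices, over an endofunctor -/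

section Generic

variable {C : Type u} [Category.{v} C] {K : Type u'} [Category.{v'} K]

/-- A functor into a slice which is cartesian over a pullback-preserving functor preserves
pullbacks. -/
theorem preserves_of_equifibered {B : C} {F : K ⥤ Over B} {H : K ⥤ C}
    (φ : F ⋙ Over.forget B ⟶ H) (hφ : NatTrans.Equifibered φ)
    (hH : PreservesLimitsOfShape WalkingCospan H) : PreservesLimitsOfShape WalkingCospan F := by
  refine preservesLimitsOfShape_walkingCospan_of_forall_isPullback fun X Y Z f g _ => ?_
  refine ⟨pullback f g, pullback.fst f g, pullback.snd f g, IsPullback.of_hasPullback f g, ?_⟩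
  have h := (IsPullback.of_hasPullback f g).map H
  have h₁ := (hφ (pullback.fst f g)).paste_vert h
  have e : F.map (pullback.fst f g) ≫ F.map f = F.map (pullback.snd f g) ≫ F.map g := by
    rw [← F.map_comp, ← F.map_comp, pullback.condition]
  refine IsPullback.of_map (Over.forget B) e ?_
  rw [← φ.naturality, ← φ.naturality] at h₁
  exact h₁.of_bot (congrArg CommaMorphism.left e) (hφ g)

/-- A transformation between functors to a slice is cartesian as soon as it commutes with
cartesian transformations to a third functor. -/
theorem equifibered_of_comp {B : C} {F G : K ⥤ Over B} {H : K ⥤ C} (ψ : F ⟶ G)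
    (φ : F ⋙ Over.forget B ⟶ H) (φ' : G ⋙ Over.forget B ⟶ H)
    (hφ : NatTrans.Equifibered φ) (hφ' : NatTrans.Equifibered φ')
    (h : ∀ X, (ψ.app X).left ≫ φ'.app X = φ.app X) : NatTrans.Equifibered ψ := by
  intro X Y f
  have h₁ := hφ f
  rw [← h X, ← h Y] at h₁
  exact IsPullback.of_map (Over.forget B) (ψ.naturality f)
    (h₁.of_bot (congrArg CommaMorphism.left (ψ.naturality f)) (hφ' f))

end Generic

section Mate

variable {C : Type u} [Category.{v} C]

/-- The value of a transformation `r_! F ⟶ F' l_!` at a map `g` over `l`. -/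
def valueAt {A B A' B' : C} {F : Over A ⥤ Over B} {F' : Over A' ⥤ Over B'} {l : A ⟶ A'}
    {r : B ⟶ B'} (n : F ⋙ Over.map r ⟶ Over.map l ⋙ F') {X : Over A} {Y : Over A'}
    (g : X.left ⟶ Y.left) (h : g ≫ Y.hom = X.hom ≫ l) : (F.obj X).left ⟶ (F'.obj Y).left :=
  (n.app X).left ≫ (F'.map (Over.homMk g h : (Over.map l).obj X ⟶ Y)).left

section

variable {A B A' B' : C} {F : Over A ⥤ Over B} {F' : Over A' ⥤ Over B'} {l : A ⟶ A'}
    {r : B ⟶ B'} (n : F ⋙ Over.map r ⟶ Over.map l ⋙ F')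

theorem app_left_eq (X : Over A) :
    (n.app X).left = valueAt n (X := X) (Y := (Over.map l).obj X) (𝟙 X.left) (by simp) := by
  have : (Over.homMk (𝟙 X.left) (by simp) : (Over.map l).obj X ⟶ (Over.map l).obj X) = 𝟙 _ := by
    ext; simp
  rw [valueAt, this]
  simp

theorem valueAt_w {X : Over A} {Y : Over A'} (g : X.left ⟶ Y.left)
    (h : g ≫ Y.hom = X.hom ≫ l) : valueAt n g h ≫ (F'.obj Y).hom = (F.obj X).hom ≫ r := by
  rw [valueAt, Category.assoc, Over.w]
  exact Over.w (n.app X)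

theorem valueAt_comp {X : Over A} {Y Z : Over A'} (g : X.left ⟶ Y.left)
    (h : g ≫ Y.hom = X.hom ≫ l) (k : Y ⟶ Z) (h' : (g ≫ k.left) ≫ Z.hom = X.hom ≫ l) :
    valueAt n g h ≫ (F'.map k).left = valueAt n (g ≫ k.left) h' := by
  have : (Over.homMk (g ≫ k.left) h' : (Over.map l).obj X ⟶ Z) =
    (Over.homMk g h : (Over.map l).obj X ⟶ Y) ≫ k := by ext; simp
  rw [valueAt, valueAt, this, F'.map_comp, Over.comp_left, Category.assoc]

theorem comp_valueAt {W X : Over A} {Y : Over A'} (k : W ⟶ X) (g : X.left ⟶ Y.left)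
    (h : g ≫ Y.hom = X.hom ≫ l) (h' : (k.left ≫ g) ≫ Y.hom = W.hom ≫ l) :
    (F.map k).left ≫ valueAt n g h = valueAt n (k.left ≫ g) h' := by
  have : (Over.homMk (k.left ≫ g) h' : (Over.map l).obj W ⟶ Y) =
    (Over.map l).map k ≫ (Over.homMk g h : (Over.map l).obj X ⟶ Y) := by ext; simp
  have e := congrArg (fun t => t.left) (n.naturality k)
  rw [valueAt, valueAt, this, F'.map_comp, Over.comp_left]
  dsimp at e ⊢
  rw [← Category.assoc, e, Category.assoc]

/-- Horizontal composition of transformations between functors of slices. -/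
def mateHComp {D D' : C} {G : Over B ⥤ Over D} {G' : Over B' ⥤ Over D'} {r' : B ⟶ B'}
    {s : D ⟶ D'} (m : G ⋙ Over.map s ⟶ Over.map r' ⋙ G') (h : r = r') :
    (F ⋙ G) ⋙ Over.map s ⟶ Over.map l ⋙ (F' ⋙ G') :=
  Functor.whiskerLeft F m ≫ Functor.whiskerRight
    (Functor.whiskerLeft F (Over.mapCongr r' r h.symm).hom ≫ n) G'

theorem valueAt_mateHComp {D D' : C} {G : Over B ⥤ Over D} {G' : Over B' ⥤ Over D'} {r' : B ⟶ B'}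
    {s : D ⟶ D'} (m : G ⋙ Over.map s ⟶ Over.map r' ⋙ G') (e : r = r') {X : Over A} {Y : Over A'}
    (g : X.left ⟶ Y.left) (h : g ≫ Y.hom = X.hom ≫ l) :
    valueAt (mateHComp n m e) g h =
      valueAt m (valueAt n g h) ((valueAt_w n g h).trans (by rw [e])) := by
  subst e
  have : (Over.homMk (valueAt n g h) (valueAt_w n g h) : (Over.map r).obj (F.obj X) ⟶ F'.obj Y) =
      n.app X ≫ F'.map (Over.homMk g h) := by
    ext; rfl
  rw [valueAt, valueAt, this, G'.map_comp]
  simp [mateHComp]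

end

/-- Transformations are determined by their values. -/
theorem mate_ext {A B A' B' : C} {F : Over A ⥤ Over B} {F' : Over A' ⥤ Over B'} {l : A ⟶ A'}
    {r : B ⟶ B'} {n n' : F ⋙ Over.map r ⟶ Over.map l ⋙ F'}
    (h : ∀ (X : Over A) (Y : Over A') (g : X.left ⟶ Y.left) (h : g ≫ Y.hom = X.hom ≫ l),
      valueAt n g h = valueAt n' g h) : n = n' := by
  ext X
  rw [app_left_eq, app_left_eq]
  exact h _ _ _ _

/-- The identity transformation, along identities. -/
def mateId {A B : C} (F : Over A ⥤ Over B) : F ⋙ Over.map (𝟙 B) ⟶ Over.map (𝟙 A) ⋙ F :=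
  Functor.whiskerLeft _ (Over.mapId _).hom ≫ Functor.whiskerRight (Over.mapId _).inv _

theorem valueAt_mateId {A B : C} (F : Over A ⥤ Over B) {X Y : Over A} (g : X.left ⟶ Y.left)
    (h : g ≫ Y.hom = X.hom ≫ 𝟙 A) :
    valueAt (mateId F) g h = (F.map (Over.homMk g (by rw [h, Category.comp_id]) : X ⟶ Y)).left := by
  have : (Over.homMk g (by rw [h, Category.comp_id]) : X ⟶ Y) =
    (Over.mapId _).inv.app X ≫ Over.homMk g h := by ext; simp
  rw [valueAt, this, F.map_comp]
  simp [mateId]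

/-- Vertical composition of transformations between functors of slices. -/
def mateVComp {A B A' B' A'' B'' : C} {F : Over A ⥤ Over B} {F' : Over A' ⥤ Over B'}
    {F'' : Over A'' ⥤ Over B''} {l : A ⟶ A'} {r : B ⟶ B'} {l' : A' ⟶ A''} {r' : B' ⟶ B''}
    (n : F ⋙ Over.map r ⟶ Over.map l ⋙ F') (m : F' ⋙ Over.map r' ⟶ Over.map l' ⋙ F'') :
    F ⋙ Over.map (r ≫ r') ⟶ Over.map (l ≫ l') ⋙ F'' :=
  Functor.whiskerLeft _ (Over.mapComp _ _).hom ≫ Functor.whiskerRight n (Over.map r') ≫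
    Functor.whiskerLeft (Over.map l) m ≫ Functor.whiskerRight (Over.mapComp _ _).inv F''

theorem valueAt_mateVComp {A B A' B' A'' B'' : C} {F : Over A ⥤ Over B} {F' : Over A' ⥤ Over B'}
    {F'' : Over A'' ⥤ Over B''} {l : A ⟶ A'} {r : B ⟶ B'} {l' : A' ⟶ A''} {r' : B' ⟶ B''}
    (n : F ⋙ Over.map r ⟶ Over.map l ⋙ F') (m : F' ⋙ Over.map r' ⟶ Over.map l' ⋙ F'')
    {X : Over A} {Y : Over A'} {Z : Over A''} (g : X.left ⟶ Y.left) (k : Y.left ⟶ Z.left)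
    (h : g ≫ Y.hom = X.hom ≫ l) (h' : k ≫ Z.hom = Y.hom ≫ l')
    (h'' : (g ≫ k) ≫ Z.hom = X.hom ≫ l ≫ l') :
    valueAt (mateVComp n m) (g ≫ k) h'' = valueAt n g h ≫ valueAt m k h' := by
  have e₁ := comp_valueAt m (Over.homMk g h : (Over.map l).obj X ⟶ Y) k h'
    (by simpa using h'')
  have e₂ : (Over.mapComp l l').inv.app X ≫ (Over.homMk (g ≫ k) h'' : (Over.map (l ≫ l')).obj X ⟶ Z)
      = (Over.homMk (g ≫ k) (by simpa using h'') : (Over.map l').obj ((Over.map l).obj X) ⟶ Z) := by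
    ext; simp
  rw [valueAt, valueAt, Category.assoc, e₁]
  simp only [mateVComp, NatTrans.comp_app, Over.comp_left, Functor.whiskerLeft_app,
    Functor.whiskerRight_app, Category.assoc]
  rw [← Over.comp_left, ← F''.map_comp, e₂, valueAt]
  simp

theorem valueAt_mateVComp' {A B A' B' A'' B'' : C} {F : Over A ⥤ Over B} {F' : Over A' ⥤ Over B'}
    {F'' : Over A'' ⥤ Over B''} {l : A ⟶ A'} {r : B ⟶ B'} {l' : A' ⟶ A''} {r' : B' ⟶ B''}
    (n : F ⋙ Over.map r ⟶ Over.map l ⋙ F') (m : F' ⋙ Over.map r' ⟶ Over.map l' ⋙ F'')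
    {X : Over A} {Z : Over A''} (g : X.left ⟶ Z.left) (h : g ≫ Z.hom = X.hom ≫ l ≫ l') :
    valueAt (mateVComp n m) g h =
      valueAt n (X := X) (Y := Over.mk (X.hom ≫ l)) (𝟙 X.left) (Category.id_comp _) ≫
        valueAt m (X := Over.mk (X.hom ≫ l)) g (by simpa using h) := by
  have e : valueAt (mateVComp n m) g h = valueAt (mateVComp n m) (𝟙 X.left ≫ g)
    ((congrArg (· ≫ Z.hom) (Category.id_comp g)).trans h) := by
    congr 1
    exact (Category.id_comp g).symm
  rw [e]
  exact valueAt_mateVComp n m (Y := Over.mk (X.hom ≫ l)) _ _ _ _ _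

theorem valueAt_id_comp {A B A' B' : C} {F : Over A ⥤ Over B} {F' : Over A' ⥤ Over B'}
    {l : A ⟶ A'} {r : B ⟶ B'} (n : F ⋙ Over.map r ⟶ Over.map l ⋙ F') {X : Over A} {Z : Over A'}
    (g : X.left ⟶ Z.left) (h : g ≫ Z.hom = X.hom ≫ 𝟙 A ≫ l) (h' : g ≫ Z.hom = X.hom ≫ l) :
    valueAt (mateVComp (mateId F) n) g h = valueAt n g h' := by
  rw [valueAt_mateVComp', valueAt_mateId, comp_valueAt n _ _ _ (by simpa using h')]
  congr 1
  exact Category.id_comp _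

theorem valueAt_comp_id {A B A' B' : C} {F : Over A ⥤ Over B} {F' : Over A' ⥤ Over B'}
    {l : A ⟶ A'} {r : B ⟶ B'} (n : F ⋙ Over.map r ⟶ Over.map l ⋙ F') {X : Over A} {Z : Over A'}
    (g : X.left ⟶ Z.left) (h : g ≫ Z.hom = X.hom ≫ l ≫ 𝟙 A') (h' : g ≫ Z.hom = X.hom ≫ l) :
    valueAt (mateVComp n (mateId F')) g h = valueAt n g h' := by
  rw [valueAt_mateVComp', valueAt_mateId, valueAt_comp n _ _ _ (by simpa using h')]
  congr 1
  exact Category.id_comp _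

theorem valueAt_assoc {A₁ A₂ A₃ A₄ B₁ B₂ B₃ B₄ : C} {F₁ : Over A₁ ⥤ Over B₁}
    {F₂ : Over A₂ ⥤ Over B₂} {F₃ : Over A₃ ⥤ Over B₃} {F₄ : Over A₄ ⥤ Over B₄}
    {l₁ : A₁ ⟶ A₂} {r₁ : B₁ ⟶ B₂} {l₂ : A₂ ⟶ A₃} {r₂ : B₂ ⟶ B₃} {l₃ : A₃ ⟶ A₄} {r₃ : B₃ ⟶ B₄}
    (n₁ : F₁ ⋙ Over.map r₁ ⟶ Over.map l₁ ⋙ F₂) (n₂ : F₂ ⋙ Over.map r₂ ⟶ Over.map l₂ ⋙ F₃)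
    (n₃ : F₃ ⋙ Over.map r₃ ⟶ Over.map l₃ ⋙ F₄) {X : Over A₁} {Z : Over A₄}
    (g : X.left ⟶ Z.left) (h : g ≫ Z.hom = X.hom ≫ (l₁ ≫ l₂) ≫ l₃)
    (h' : g ≫ Z.hom = X.hom ≫ l₁ ≫ l₂ ≫ l₃) :
    valueAt (mateVComp (mateVComp n₁ n₂) n₃) g h = valueAt (mateVComp n₁ (mateVComp n₂ n₃)) g h' := by
  have e := comp_valueAt n₃ (X := Over.mk (X.hom ≫ l₁ ≫ l₂)) (W := Over.mk ((X.hom ≫ l₁) ≫ l₂))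
    (Over.homMk (𝟙 X.left) (by simp)) g (by simpa using h') (by simpa using h')
  have e' := valueAt_comp n₂ (X := Over.mk (X.hom ≫ l₁)) (Y := Over.mk ((X.hom ≫ l₁) ≫ l₂))
    (𝟙 X.left) (Category.id_comp _)
    (Over.homMk (𝟙 X.left) (by simp) : Over.mk ((X.hom ≫ l₁) ≫ l₂) ⟶ Over.mk (X.hom ≫ l₁ ≫ l₂))
    (by simp)
  have e₃ : valueAt n₃ (X := Over.mk ((X.hom ≫ l₁) ≫ l₂)) g (by simpa using h') =
      valueAt n₃ (X := Over.mk ((X.hom ≫ l₁) ≫ l₂)) (𝟙 X.left ≫ g) (by simpa using h') := by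
    congr 1
    exact (Category.id_comp _).symm
  have e₂ : valueAt n₂ (X := Over.mk (X.hom ≫ l₁)) (Y := Over.mk (X.hom ≫ l₁ ≫ l₂)) (𝟙 X.left)
      (by simp) = valueAt n₂ (X := Over.mk (X.hom ≫ l₁)) (Y := Over.mk (X.hom ≫ l₁ ≫ l₂))
        (𝟙 X.left ≫ 𝟙 X.left) (by simp) := by
    congr 1
    exact (Category.id_comp _).symm
  rw [valueAt_mateVComp', valueAt_mateVComp', valueAt_mateVComp', valueAt_mateVComp', Category.assoc]
  refine congrArg _ ?_
  refine (congrArg (· ≫ _) (e₂.trans e'.symm)).trans ?_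
  rw [Category.assoc]
  exact congrArg _ (e.trans e₃.symm)

end Mate

section Cart

variable {C : Type u} [Category.{v} C]

theorem mateId_equifibered {A B : C} (F : Over A ⥤ Over B) : NatTrans.Equifibered (mateId F) :=
  NatTrans.Equifibered.comp (.of_isIso _) (.of_isIso _)

theorem mateVComp_equifibered {A B A' B' A'' B'' : C} {F : Over A ⥤ Over B}
    {F' : Over A' ⥤ Over B'} {F'' : Over A'' ⥤ Over B''} {l : A ⟶ A'} {r : B ⟶ B'} {l' : A' ⟶ A''}
    {r' : B' ⟶ B''} {n : F ⋙ Over.map r ⟶ Over.map l ⋙ F'}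
    {m : F' ⋙ Over.map r' ⟶ Over.map l' ⋙ F''} (hn : NatTrans.Equifibered n)
    (hm : NatTrans.Equifibered m) : NatTrans.Equifibered (mateVComp n m) := by
  refine NatTrans.Equifibered.comp (.of_isIso _) (.comp ?_ (.comp ?_ (.of_isIso _)))
  · intro X Y f
    refine IsPullback.of_map (Over.forget _) (NatTrans.naturality _ f) ?_
    exact (hn f).map (Over.forget _)
  · exact hm.whiskerLeft _

/-- A cartesian (pullback-preserving) functor `C/A ⥤ C/B`, together with a cartesian
transformation to `P`, along the forgetful functors. -/
structure CartOver (P : C ⥤ C) (A B : C) where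
  /-- the functor -/
  functor : Over A ⥤ Over B
  preserves : PreservesLimitsOfShape WalkingCospan functor
  /-- the transformation to `P` -/
  toP : functor ⋙ Over.forget B ⟶ Over.forget A ⋙ P
  toP_cart : NatTrans.Equifibered toP

/-- The components of the transformation to `P`. -/
def CartOver.str {P : C ⥤ C} {A B : C} (M : CartOver P A B) (X : Over A) :
    (M.functor.obj X).left ⟶ P.obj X.left := M.toP.app X

theorem CartOver.str_naturality {P : C ⥤ C} {A B : C} (M : CartOver P A B) {X Y : Over A}
    (f : X ⟶ Y) : (M.functor.map f).left ≫ M.str Y = M.str X ≫ P.map f.left :=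
  M.toP.naturality f

/-- A square of cartesian functors over `P`: a cartesian transformation, compatible with the
transformations to `P`. -/
structure CartOverSq {P : C ⥤ C} (M N : HorTotal (CartOver P)) where
  /-- the map on sources -/
  left : M.src ⟶ N.src
  /-- the map on targets -/
  right : M.tgt ⟶ N.tgt
  /-- the transformation -/
  nat : M.hor.functor ⋙ Over.map right ⟶ Over.map left ⋙ N.hor.functor
  nat_cart : NatTrans.Equifibered nat
  comm : ∀ X : Over M.src,
    (nat.app X).left ≫ N.hor.toP.app ((Over.map left).obj X) = M.hor.toP.app X

namespace CartOverSq

variable {P : C ⥤ C}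

theorem valueAt_comm {M N : HorTotal (CartOver P)} (α : CartOverSq M N) {X : Over M.src}
    {Y : Over N.src} (g : X.left ⟶ Y.left) (h : g ≫ Y.hom = X.hom ≫ α.left) :
    valueAt α.nat g h ≫ N.hor.str Y = M.hor.str X ≫ P.map g := by
  have e : (N.hor.functor.map (Over.homMk g h : (Over.map α.left).obj X ⟶ Y)).left ≫ N.hor.str Y =
    N.hor.str ((Over.map α.left).obj X) ≫ P.map g := N.hor.toP.naturality _
  have e' : (α.nat.app X).left ≫ N.hor.str ((Over.map α.left).obj X) = M.hor.str X := α.comm X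
  rw [valueAt, Category.assoc, e, ← e', Category.assoc]

theorem comm_of_valueAt {M N : HorTotal (CartOver P)} {l : M.src ⟶ N.src} {r : M.tgt ⟶ N.tgt}
    {n : M.hor.functor ⋙ Over.map r ⟶ Over.map l ⋙ N.hor.functor}
    (h : ∀ (X : Over M.src) (Y : Over N.src) (g : X.left ⟶ Y.left) (h : g ≫ Y.hom = X.hom ≫ l),
      valueAt n g h ≫ N.hor.str Y = M.hor.str X ≫ P.map g) (X : Over M.src) :
    (n.app X).left ≫ N.hor.toP.app ((Over.map l).obj X) = M.hor.toP.app X := by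
  rw [app_left_eq]
  refine (h X ((Over.map l).obj X) (𝟙 X.left) (Category.id_comp _)).trans ?_
  have e : P.map (𝟙 X.left) = 𝟙 _ := P.map_id _
  exact (congrArg (M.hor.str X ≫ ·) e).trans (Category.comp_id _)

theorem ext_valueAt {M N : HorTotal (CartOver P)} {α β : CartOverSq M N} (h₁ : α.left = β.left)
    (h₂ : α.right = β.right)
    (h₃ : ∀ (X : Over M.src) (Y : Over N.src) (g : X.left ⟶ Y.left)
      (h : g ≫ Y.hom = X.hom ≫ α.left) (h' : g ≫ Y.hom = X.hom ≫ β.left),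
      valueAt α.nat g h = valueAt β.nat g h') : α = β := by
  obtain ⟨l, r, n, _, _⟩ := α
  obtain ⟨l', r', n', _, _⟩ := β
  obtain rfl : l = l' := h₁
  obtain rfl : r = r' := h₂
  obtain rfl : n = n' := mate_ext fun X Y g h => h₃ X Y g h h
  rfl

/-- The identity square. -/
def id (M : HorTotal (CartOver P)) : CartOverSq M M where
  left := 𝟙 _
  right := 𝟙 _
  nat := mateId _
  nat_cart := mateId_equifibered _
  comm := comm_of_valueAt fun X Y g h => by
    rw [valueAt_mateId]
    exact M.hor.str_naturality _

/-- Vertical composition of squares. -/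
def comp {M N K : HorTotal (CartOver P)} (α : CartOverSq M N) (β : CartOverSq N K) :
    CartOverSq M K where
  left := α.left ≫ β.left
  right := α.right ≫ β.right
  nat := mateVComp α.nat β.nat
  nat_cart := mateVComp_equifibered α.nat_cart β.nat_cart
  comm := comm_of_valueAt fun X Y g h => by
    have h₁ := α.valueAt_comm (X := X) (Y := Over.mk (X.hom ≫ α.left)) (𝟙 _) (Category.id_comp _)
    have h₂ := β.valueAt_comm (X := Over.mk (X.hom ≫ α.left)) (Y := Y) g (by simpa using h)
    rw [valueAt_mateVComp' α.nat β.nat g h, Category.assoc, h₂, ← Category.assoc, h₁, P.map_id,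
      Category.comp_id]

end CartOverSq

/-- The category of cartesian functors over `P`. -/
instance cartOverCategory (P : C ⥤ C) : Category (HorTotal (CartOver P)) where
  Hom M N := CartOverSq M N
  id M := CartOverSq.id M
  comp α β := CartOverSq.comp α β
  id_comp α := CartOverSq.ext_valueAt (Category.id_comp _) (Category.id_comp _)
    fun _ _ g h h' => valueAt_id_comp α.nat g h h'
  comp_id α := CartOverSq.ext_valueAt (Category.comp_id _) (Category.comp_id _)
    fun _ _ g h h' => valueAt_comp_id α.nat g h h'
  assoc α β γ := CartOverSq.ext_valueAt (Category.assoc _ _ _) (Category.assoc _ _ _)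
    fun _ _ g h h' => valueAt_assoc α.nat β.nat γ.nat g h h'

/-! ### Extension of spans -/

section Ext

variable [HasPullbacks C] {P : C ⥤ C}

/-- The extension `c_! d^* P_{/A} : C/A ⥤ C/PA ⥤ C/N ⥤ C/B` of a span `P A ⟵ N ⟶ B`. -/
noncomputable def extFunctor {A B : C} (M : PSpan P A B) : Over A ⥤ Over B :=
  Over.post P ⋙ Over.pullback M.dom ⋙ Over.map M.cod

/-- The projection of the extension to `P`. -/
noncomputable def extFst {A B : C} (M : PSpan P A B) (X : Over A) :
    ((extFunctor M).obj X).left ⟶ P.obj X.left :=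
  pullback.fst (P.map X.hom) M.dom

/-- The projection of the extension to the apex of the span. -/
noncomputable def extSnd {A B : C} (M : PSpan P A B) (X : Over A) :
    ((extFunctor M).obj X).left ⟶ M.apex :=
  pullback.snd (P.map X.hom) M.dom

theorem ext_isPullback {A B : C} (M : PSpan P A B) (X : Over A) :
    IsPullback (extFst M X) (extSnd M X) (P.map X.hom) M.dom :=
  IsPullback.of_hasPullback _ _

theorem ext_obj_hom {A B : C} (M : PSpan P A B) (X : Over A) :
    ((extFunctor M).obj X).hom = extSnd M X ≫ M.cod := rfl

theorem ext_map_fst {A B : C} (M : PSpan P A B) {X Y : Over A} (f : X ⟶ Y) :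
    ((extFunctor M).map f).left ≫ extFst M Y = extFst M X ≫ P.map f.left :=
  pullback.lift_fst _ _ _

theorem ext_map_snd {A B : C} (M : PSpan P A B) {X Y : Over A} (f : X ⟶ Y) :
    ((extFunctor M).map f).left ≫ extSnd M Y = extSnd M X :=
  pullback.lift_snd _ _ _

theorem ext_map_isPullback {A B : C} (M : PSpan P A B) {X Y : Over A} (f : X ⟶ Y) :
    IsPullback ((extFunctor M).map f).left (extFst M X) (extFst M Y) (P.map f.left) := by
  have h := (ext_isPullback M X).flip
  rw [← ext_map_snd M f, ← Over.w f, P.map_comp] at h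
  exact (h.of_right (ext_map_fst M f) (ext_isPullback M Y).flip)

/-- The structure map of the extension of a span, given by the counit of `d_! ⊣ d^*`. -/
noncomputable def extToP {A B : C} (M : PSpan P A B) :
    extFunctor M ⋙ Over.forget B ⟶ Over.forget A ⋙ P where
  app X := extFst M X
  naturality _ _ f := ext_map_fst M f

theorem extToP_cart {A B : C} (M : PSpan P A B) : NatTrans.Equifibered (extToP M) :=
  fun _ _ f => ext_map_isPullback M f

/-- The extension of a span, as a cartesian functor over `P`. -/
noncomputable def extObj (hP : PreservesLimitsOfShape WalkingCospan P) {A B : C}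
    (M : PSpan P A B) : CartOver P A B where
  functor := extFunctor M
  preserves := preserves_of_equifibered (extToP M) (extToP_cart M)
    (have := hP; inferInstance)
  toP := extToP M
  toP_cart := extToP_cart M

section Square

variable {A B A' B' : C} {M : PSpan P A B} {N : PSpan P A' B'} (α : tot M ⟶ tot N)

theorem extNat_w {X : Over A} {Y : Over A'} (g : X.left ⟶ Y.left)
    (h : g ≫ Y.hom = X.hom ≫ PSpanSq.left α) :
    (extFst M X ≫ P.map g) ≫ P.map Y.hom = (extSnd M X ≫ PSpanSq.mid α) ≫ N.dom := by
  rw [Category.assoc, ← P.map_comp, h, P.map_comp, ← Category.assoc, (ext_isPullback M X).w,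
    Category.assoc, Category.assoc, PSpanSq.dom_comm α]

/-- The map between extensions induced by a morphism of spans, on underlying objects: it is given
by functoriality of `P` and by the map on apices. -/
noncomputable def extMap {X : Over A} {Y : Over A'} (g : X.left ⟶ Y.left)
    (h : g ≫ Y.hom = X.hom ≫ PSpanSq.left α) :
    ((extFunctor M).obj X).left ⟶ ((extFunctor N).obj Y).left :=
  (ext_isPullback N Y).lift (extFst M X ≫ P.map g) (extSnd M X ≫ PSpanSq.mid α) (extNat_w α g h)

theorem extMap_fst {X : Over A} {Y : Over A'} (g : X.left ⟶ Y.left)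
    (h : g ≫ Y.hom = X.hom ≫ PSpanSq.left α) :
    extMap α g h ≫ extFst N Y = extFst M X ≫ P.map g := IsPullback.lift_fst _ _ _ _

theorem extMap_snd {X : Over A} {Y : Over A'} (g : X.left ⟶ Y.left)
    (h : g ≫ Y.hom = X.hom ≫ PSpanSq.left α) :
    extMap α g h ≫ extSnd N Y = extSnd M X ≫ PSpanSq.mid α := IsPullback.lift_snd _ _ _ _

theorem extMap_w {X : Over A} {Y : Over A'} (g : X.left ⟶ Y.left)
    (h : g ≫ Y.hom = X.hom ≫ PSpanSq.left α) :
    extMap α g h ≫ ((extFunctor N).obj Y).hom =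
      ((extFunctor M).obj X).hom ≫ PSpanSq.right α := by
  rw [ext_obj_hom, ext_obj_hom, ← Category.assoc, extMap_snd, Category.assoc, Category.assoc,
    PSpanSq.cod_comm α]

theorem comp_extMap {W X : Over A} {Y : Over A'} (k : W ⟶ X) (g : X.left ⟶ Y.left)
    (h : g ≫ Y.hom = X.hom ≫ PSpanSq.left α) (h' : (k.left ≫ g) ≫ Y.hom = W.hom ≫ PSpanSq.left α) :
    ((extFunctor M).map k).left ≫ extMap α g h = extMap α (k.left ≫ g) h' := by
  refine (ext_isPullback N Y).hom_ext ?_ ?_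
  · rw [Category.assoc, extMap_fst, extMap_fst, ← Category.assoc, ext_map_fst, P.map_comp,
      Category.assoc]
  · rw [Category.assoc, extMap_snd, extMap_snd, ← Category.assoc, ext_map_snd]

theorem extMap_comp {X : Over A} {Y Z : Over A'} (g : X.left ⟶ Y.left)
    (h : g ≫ Y.hom = X.hom ≫ PSpanSq.left α) (k : Y ⟶ Z)
    (h' : (g ≫ k.left) ≫ Z.hom = X.hom ≫ PSpanSq.left α) :
    extMap α g h ≫ ((extFunctor N).map k).left = extMap α (g ≫ k.left) h' := by
  refine (ext_isPullback N Z).hom_ext ?_ ?_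
  · rw [Category.assoc, ext_map_fst, extMap_fst, ← Category.assoc, extMap_fst, P.map_comp,
      Category.assoc]
  · rw [Category.assoc, ext_map_snd, extMap_snd, extMap_snd]

/-- The transformation between extensions induced by a morphism of spans. -/
noncomputable def extNat : extFunctor M ⋙ Over.map (PSpanSq.right α) ⟶
    Over.map (PSpanSq.left α) ⋙ extFunctor N where
  app X := Over.homMk (extMap α (Y := (Over.map (PSpanSq.left α)).obj X) (𝟙 X.left)
    (Category.id_comp _)) (extMap_w α _ _)
  naturality X Y f := by
    ext
    refine (comp_extMap α f (Y := (Over.map (PSpanSq.left α)).obj Y) (𝟙 Y.left)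
      (Category.id_comp _)
      (by simp)).trans (Eq.symm ?_)
    refine (extMap_comp α (Y := (Over.map (PSpanSq.left α)).obj X) (𝟙 X.left)
      (Category.id_comp _) ((Over.map (PSpanSq.left α)).map f) (by simp)).trans ?_
    congr 1
    exact (Category.id_comp _).trans (Category.comp_id _).symm

theorem valueAt_extNat {X : Over A} {Y : Over A'} (g : X.left ⟶ Y.left)
    (h : g ≫ Y.hom = X.hom ≫ PSpanSq.left α) : valueAt (extNat α) g h = extMap α g h := by
  refine (extMap_comp α (Y := (Over.map (PSpanSq.left α)).obj X) (𝟙 X.left)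
    (Category.id_comp _) (Over.homMk g h) (by simpa using h)).trans ?_
  congr 1
  exact Category.id_comp _

theorem extNat_cart : NatTrans.Equifibered (extNat α) :=
  equifibered_of_comp (H := Over.forget A ⋙ P) (extNat α) (extToP M)
    (Functor.whiskerLeft (Over.map (PSpanSq.left α)) (extToP N)) (extToP_cart M)
    ((extToP_cart N).whiskerLeft _)
    (fun _ => (extMap_fst α _ (Category.id_comp _)).trans ((congrArg _ (P.map_id _)).trans (Category.comp_id _)))

end Square

theorem extMap_id {A B : C} (M : PSpan P A B) {X Y : Over A} (g : X.left ⟶ Y.left)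
    (h : g ≫ Y.hom = X.hom ≫ 𝟙 A) :
    extMap (𝟙 (tot M)) g h =
      ((extFunctor M).map (Over.homMk g (by rw [h, Category.comp_id]) : X ⟶ Y)).left := by
  refine (ext_isPullback M Y).hom_ext ?_ ?_
  · rw [ext_map_fst]
    exact extMap_fst (𝟙 (tot M)) g h
  · rw [ext_map_snd]
    exact (extMap_snd (𝟙 (tot M)) g h).trans (Category.comp_id _)

theorem extMap_vcomp {A B A' B' A'' B'' : C} {M : PSpan P A B} {N : PSpan P A' B'}
    {K : PSpan P A'' B''} (α : tot M ⟶ tot N) (β : tot N ⟶ tot K)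
    {X : Over A} {Y : Over A'} {Z : Over A''} (g : X.left ⟶ Y.left) (k : Y.left ⟶ Z.left)
    (h : g ≫ Y.hom = X.hom ≫ PSpanSq.left α) (h' : k ≫ Z.hom = Y.hom ≫ PSpanSq.left β)
    (h'' : (g ≫ k) ≫ Z.hom = X.hom ≫ PSpanSq.left (α ≫ β)) :
    extMap (α ≫ β) (g ≫ k) h'' = extMap α g h ≫ extMap β k h' := by
  refine (ext_isPullback K Z).hom_ext ?_ ?_
  · rw [Category.assoc, extMap_fst, extMap_fst, ← Category.assoc, extMap_fst, P.map_comp,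
      Category.assoc]
  · rw [Category.assoc, extMap_snd, extMap_snd, ← Category.assoc, extMap_snd, Category.assoc]
    rfl

/-- The extension functor, from spans relative to `P` to cartesian functors over `P`. -/
noncomputable def spanExt (hP : PreservesLimitsOfShape WalkingCospan P) :
    HorTotal (PSpan P) ⥤ HorTotal (CartOver P) where
  obj M := tot (extObj hP M.hor)
  map {M N} α := CartOverSq.mk (M := tot (extObj hP M.hor)) (N := tot (extObj hP N.hor))
    (PSpanSq.left α) (PSpanSq.right α) (extNat (M := M.hor) (N := N.hor) α)
    (extNat_cart (M := M.hor) (N := N.hor) α)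
      (CartOverSq.comm_of_valueAt (M := tot (extObj hP M.hor)) (N := tot (extObj hP N.hor))
        fun X Y g h =>
        (congrArg (· ≫ extFst N.hor Y) (valueAt_extNat (M := M.hor) (N := N.hor) α g h)).trans
          (extMap_fst (M := M.hor) (N := N.hor) α g h))
  map_id M := CartOverSq.ext_valueAt rfl rfl fun X Y g h h' =>
    ((valueAt_extNat (𝟙 (tot M.hor)) g h).trans (extMap_id M.hor g h)).trans
      (valueAt_mateId _ g h').symm
  map_comp {M N K} α β := CartOverSq.ext_valueAt rfl rfl fun X Z g h h' => by
    refine Eq.trans ?_ (valueAt_mateVComp' _ _ g h').symm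
    refine Eq.trans ?_ (congrArg₂ (· ≫ ·)
      (valueAt_extNat (M := M.hor) (N := N.hor) α _ _).symm
      (valueAt_extNat (M := N.hor) (N := K.hor) β _ _).symm)
    refine Eq.trans ?_ (extMap_vcomp (M := M.hor) (N := N.hor) (K := K.hor) α β _ _ _ _
      ((congrArg (· ≫ Z.hom) (Category.id_comp g)).trans h))
    refine (valueAt_extNat (M := M.hor) (N := K.hor) (α ≫ β) g h).trans ?_
    congr 1
    exact (Category.id_comp _).symm

end Ext

end Cart

/-! ## Polynomial functors -/

section Poly

/-- A category with pullbacks is locally cartesian closed if every pullback functor between slices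
has a right adjoint. -/
class LocallyCartesianClosed (E : Type u) [Category.{v} E] [HasPullbacks E] : Prop where
  isLeftAdjoint : ∀ {X Y : E} (f : X ⟶ Y), (Over.pullback f).IsLeftAdjoint

attribute [instance] LocallyCartesianClosed.isLeftAdjoint

variable {E : Type u} [Category.{v} E]

/-- A polynomial `I ⟵ B ⟶ A ⟶ J`. -/
structure Poly (I J : E) where
  /-- the domain of the middle map -/
  dom : E
  /-- the codomain of the middle map -/
  cod : E
  /-- the left leg -/
  s : dom ⟶ I
  /-- the middle map -/
  f : dom ⟶ cod
  /-- the right leg -/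
  t : cod ⟶ J

theorem overMap_preserves {X Y : E} (f : X ⟶ Y) :
    PreservesLimitsOfShape WalkingCospan (Over.map f) :=
  preserves_of_equifibered (Over.mapForget f).hom (.of_isIso _) inferInstance

variable [HasPullbacks E] [LocallyCartesianClosed E]

/-- Dependent product along `f`: the right adjoint of pullback along `f`. -/
noncomputable def depProd {X Y : E} (f : X ⟶ Y) : Over X ⥤ Over Y :=
  Functor.rightAdjoint (Over.pullback f)

/-- The adjunction between pullback and dependent product. -/
noncomputable def depProdAdj {X Y : E} (f : X ⟶ Y) : Over.pullback f ⊣ depProd f :=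
  Adjunction.ofIsLeftAdjoint (Over.pullback f)

namespace Poly

variable {I J : E} (p : Poly I J)

/-- The functor `Π_f s^*`. -/
noncomputable abbrev core : Over I ⥤ Over p.cod := Over.pullback p.s ⋙ depProd p.f

/-- The left adjoint `s_! f^*` of `Π_f s^*`. -/
noncomputable abbrev coreL : Over p.cod ⥤ Over I := Over.pullback p.f ⋙ Over.map p.s

/-- The adjunction between `s_! f^*` and `Π_f s^*`. -/
noncomputable def coreAdj : p.coreL ⊣ p.core :=
  (depProdAdj p.f).comp (Over.mapPullbackAdj p.s)

/-- The extension `t_! Π_f s^*` of a polynomial. -/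
noncomputable def ext : Over I ⥤ Over J := p.core ⋙ Over.map p.t

end Poly

/-- A functor between slices is polynomial if it is isomorphic to the extension of a polynomial. -/
def IsPolynomialFunctor {I J : E} (F : Over I ⥤ Over J) : Prop :=
  ∃ p : Poly I J, Nonempty (F ≅ p.ext)

theorem IsPolynomialFunctor.preserves {I J : E} {F : Over I ⥤ Over J}
    (hF : IsPolynomialFunctor F) : PreservesLimitsOfShape WalkingCospan F := by
  obtain ⟨p, ⟨e⟩⟩ := hF
  have h₁ : PreservesLimitsOfShape WalkingCospan p.core := p.coreAdj.rightAdjoint_preservesLimits.1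
  have h₂ := overMap_preserves p.t
  have h₃ : PreservesLimitsOfShape WalkingCospan p.ext :=
    inferInstanceAs (PreservesLimitsOfShape WalkingCospan (p.core ⋙ Over.map p.t))
  exact preservesLimitsOfShape_of_natIso e.symm

section CartToPoly

variable {I J D C : E} (p : Poly I J) {u : D ⟶ I} {v : C ⟶ J} {Q : Over D ⥤ Over C}
  (φ : Q ⋙ Over.map v ⟶ Over.map u ⋙ p.ext)

/-- The object `D` over itself. -/
abbrev overOne (D : E) : Over D := Over.mk (𝟙 D)

/-- The map to the terminal object of a slice. -/
abbrev overBang {D : E} (X : Over D) : X ⟶ overOne D := Over.homMk X.hom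

/-- The components of a transformation to a polynomial functor. -/
noncomputable def ctpApp (X : Over D) :
    (Q.obj X).left ⟶ (p.core.obj ((Over.map u).obj X)).left := (φ.app X).left

theorem ctpApp_naturality {X Y : Over D} (f : X ⟶ Y) :
    (Q.map f).left ≫ ctpApp p φ Y = ctpApp p φ X ≫ (p.core.map ((Over.map u).map f)).left :=
  congrArg (fun t => t.left) (φ.naturality f)

/-- The map to `A`. -/
noncomputable def ctpA : (Q.obj (overOne D)).left ⟶ p.cod :=
  ctpApp p φ (overOne D) ≫ (p.core.obj ((Over.map u).obj (overOne D))).hom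

/-- The map `N ⟶ P D`, in the slice over `A`. -/
noncomputable def ctpD : Over.mk (ctpA p φ) ⟶ p.core.obj (Over.mk u) :=
  Over.homMk (ctpApp p φ (overOne D)) rfl ≫
    p.core.map (Over.homMk (𝟙 D) : (Over.map u).obj (overOne D) ⟶ Over.mk u)

/-- The functor to the slice over `N`. -/
noncomputable def ctpK : Over D ⥤ Over (Q.obj (overOne D)).left :=
  Over.iteratedSliceBackward (Over.mk u) ⋙ Over.post p.core ⋙ Over.pullback (ctpD p φ) ⋙
    Over.iteratedSliceForward (Over.mk (ctpA p φ))

/-- The left adjoint. -/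
noncomputable def ctpL : Over (Q.obj (overOne D)).left ⥤ Over D :=
  Over.iteratedSliceBackward (Over.mk (ctpA p φ)) ⋙ Over.map (ctpD p φ) ⋙
    (Over.post p.coreL ⋙ Over.map (p.coreAdj.counit.app (Over.mk u))) ⋙
    Over.iteratedSliceForward (Over.mk u)

/-- The adjunction. -/
noncomputable def ctpAdj : ctpL p φ ⊣ ctpK p φ :=
  (((Over.iteratedSliceEquiv (Over.mk (ctpA p φ))).symm.toAdjunction.comp
    (Over.mapPullbackAdj (ctpD p φ))).comp (Over.postAdjunctionRight p.coreAdj)).comp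
    (Over.iteratedSliceEquiv (Over.mk u)).toAdjunction

/-- The left leg of the representing polynomial. -/
noncomputable def ctpS : pullback (ctpA p φ) p.f ⟶ D :=
  (p.coreL.map (ctpD p φ) ≫ p.coreAdj.counit.app (Over.mk u)).left

/-- Transitivity of pullback. -/
noncomputable def ctpPbIso (W : Over (Q.obj (overOne D)).left) :
    pullback W.hom (pullback.fst (ctpA p φ) p.f) ≅ pullback (W.hom ≫ ctpA p φ) p.f :=
  pullbackRightPullbackFstIso (ctpA p φ) p.f W.hom

theorem ctpPbIso_inv_snd (W : Over (Q.obj (overOne D)).left) :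
    (ctpPbIso p φ W).inv ≫ pullback.snd W.hom (pullback.fst (ctpA p φ) p.f) =
      (p.coreL.map (Over.homMk W.hom : Over.mk (W.hom ≫ ctpA p φ) ⟶ Over.mk (ctpA p φ))).left := by
  refine pullback.hom_ext ?_ ?_
  · rw [Category.assoc]
    refine (pullbackRightPullbackFstIso_inv_snd_fst (ctpA p φ) p.f W.hom).trans ?_
    exact (pullback.lift_fst _ _ _).symm
  · rw [Category.assoc]
    refine (pullbackRightPullbackFstIso_inv_snd_snd (ctpA p φ) p.f W.hom).trans ?_
    exact (pullback.lift_snd _ _ _).symm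

theorem ctpPbIso_w (W : Over (Q.obj (overOne D)).left) :
    (ctpPbIso p φ W).inv ≫ pullback.snd W.hom (pullback.fst (ctpA p φ) p.f) ≫ ctpS p φ =
      ((ctpL p φ).obj W).hom := by
  rw [← Category.assoc, ctpPbIso_inv_snd, ctpS, ← Over.comp_left, ← Category.assoc,
    ← p.coreL.map_comp]
  rfl

theorem ctpPbIso_natural {W W' : Over (Q.obj (overOne D)).left} (k : W ⟶ W')
    {l : pullback (W.hom ≫ ctpA p φ) p.f ⟶ pullback (W'.hom ≫ ctpA p φ) p.f}
    {r : pullback W.hom (pullback.fst (ctpA p φ) p.f) ⟶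
      pullback W'.hom (pullback.fst (ctpA p φ) p.f)}
    (h₁ : l ≫ pullback.fst _ _ = pullback.fst _ _ ≫ k.left)
    (h₂ : l ≫ pullback.snd _ _ = pullback.snd _ _)
    (h₃ : r ≫ pullback.fst _ _ = pullback.fst _ _ ≫ k.left)
    (h₄ : r ≫ pullback.snd _ _ = pullback.snd _ _) :
    l ≫ (ctpPbIso p φ W').inv = (ctpPbIso p φ W).inv ≫ r := by
  have i₁ (W : Over (Q.obj (overOne D)).left) : (ctpPbIso p φ W).inv ≫ pullback.fst _ _ =
    pullback.fst _ _ := pullbackRightPullbackFstIso_inv_fst _ _ _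
  have i₂ (W : Over (Q.obj (overOne D)).left) : (ctpPbIso p φ W).inv ≫ pullback.snd _ _ ≫
    pullback.snd _ _ = pullback.snd _ _ := pullbackRightPullbackFstIso_inv_snd_snd _ _ _
  have i₃ (W : Over (Q.obj (overOne D)).left) : (ctpPbIso p φ W).inv ≫ pullback.snd _ _ ≫
    pullback.fst _ _ = pullback.fst _ _ ≫ W.hom := pullbackRightPullbackFstIso_inv_snd_fst _ _ _
  refine pullback.hom_ext ?_ (pullback.hom_ext ?_ ?_)
  · rw [Category.assoc, Category.assoc, h₃, i₁, h₁, ← Category.assoc, i₁]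
  · rw [Category.assoc, Category.assoc, Category.assoc, Category.assoc, i₃, ← Category.assoc, h₁,
      ← Category.assoc r, h₄, i₃, Category.assoc, Over.w]
  · rw [Category.assoc, Category.assoc, Category.assoc, Category.assoc, i₂,
      ← Category.assoc r, h₄, i₂, h₂]

theorem ctpPbIso_naturality {W W' : Over (Q.obj (overOne D)).left} (k : W ⟶ W') :
    ((ctpL p φ).map k).left ≫ (ctpPbIso p φ W').inv =
      (ctpPbIso p φ W).inv ≫ ((Over.pullback (pullback.fst (ctpA p φ) p.f)).map k).left :=
  ctpPbIso_natural p φ k (pullback.lift_fst _ _ _) (pullback.lift_snd _ _ _)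
    (pullback.lift_fst _ _ _) (pullback.lift_snd _ _ _)

/-- The left adjoint, as pullback followed by composition. -/
noncomputable def ctpLIso :
    ctpL p φ ≅ Over.pullback (pullback.fst (ctpA p φ) p.f) ⋙ Over.map (ctpS p φ) :=
  NatIso.ofComponents (fun W => Over.isoMk (ctpPbIso p φ W).symm (ctpPbIso_w p φ W))
    (fun k => Over.OverMorphism.ext (ctpPbIso_naturality p φ k))

/-- The functor to the slice over `N` is given by a polynomial. -/
noncomputable def ctpKIso :
    ctpK p φ ≅ Over.pullback (ctpS p φ) ⋙ depProd (pullback.fst (ctpA p φ) p.f) :=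
  Adjunction.rightAdjointUniq ((ctpAdj p φ).ofNatIsoLeft (ctpLIso p φ))
    ((depProdAdj (pullback.fst (ctpA p φ) p.f)).comp (Over.mapPullbackAdj (ctpS p φ)))

theorem ctp_isPullback (hφ : NatTrans.Equifibered φ) (X : Over D) :
    IsPullback (ctpApp p φ X) (Q.map (overBang X)).left
      (p.core.map (Over.homMk X.hom : (Over.map u).obj X ⟶ Over.mk u)).left
      (ctpD p φ).left := by
  have h : IsPullback (ctpApp p φ X) (Q.map (overBang X)).left
      (p.core.map ((Over.map u).map (overBang X))).left (ctpApp p φ (overOne D)) :=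
    ((hφ (overBang X)).map (Over.forget J)).flip
  have e : IsIso (p.core.map (Over.homMk (𝟙 D) : (Over.map u).obj (overOne D) ⟶ Over.mk u)).left :=
    have : IsIso (Over.homMk (𝟙 D) : (Over.map u).obj (overOne D) ⟶ Over.mk u) :=
      (Over.isoMk (Iso.refl D) : (Over.map u).obj (overOne D) ≅ Over.mk u).isIso_hom
    inferInstanceAs (IsIso ((Over.forget _).map (p.core.map
      (Over.homMk (𝟙 D) : (Over.map u).obj (overOne D) ⟶ Over.mk u))))
  have w : (p.core.map ((Over.map u).map (overBang X))).left ≫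
      (p.core.map (Over.homMk (𝟙 D) : (Over.map u).obj (overOne D) ⟶ Over.mk u)).left =
      𝟙 _ ≫ (p.core.map (Over.homMk X.hom : (Over.map u).obj X ⟶ Over.mk u)).left := by
    rw [Category.id_comp, ← Over.comp_left, ← p.core.map_comp]
    congr 2
    ext
    exact Category.comp_id _
  have h' := h.flip.paste_vert (IsPullback.of_vert_isIso ⟨w⟩)
  rw [Category.comp_id] at h'
  exact h'.flip

/-- The object of the slice over `A` underlying `Q X`. -/
noncomputable abbrev ctpObj (X : Over D) : Over p.cod := Over.mk ((Q.map (overBang X)).left ≫ ctpA p φ)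

theorem ctpApp_w (X : Over D) : ctpApp p φ X ≫ (p.core.obj ((Over.map u).obj X)).hom =
    (Q.map (overBang X)).left ≫ ctpA p φ := by
  rw [ctpA, ← Category.assoc, ctpApp_naturality, Category.assoc, Over.w]

theorem ctp_isPullback' (hφ : NatTrans.Equifibered φ) (X : Over D) :
    IsPullback
      (Over.homMk (ctpApp p φ X) (ctpApp_w p φ X) :
        ctpObj p φ X ⟶ p.core.obj ((Over.map u).obj X))
      (Over.homMk (Q.map (overBang X)).left : ctpObj p φ X ⟶ Over.mk (ctpA p φ))
      (p.core.map (Over.homMk X.hom : (Over.map u).obj X ⟶ Over.mk u))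
      (ctpD p φ) :=
  IsPullback.of_map (Over.forget _) (Over.OverMorphism.ext (ctp_isPullback p φ hφ X).w)
    (ctp_isPullback p φ hφ X)

/-- The first projection of the pullback defining `ctpK`. -/
noncomputable def ctpFst (X : Over D) :
    ((ctpK p φ).obj X).left ⟶ (p.core.obj ((Over.map u).obj X)).left :=
  (pullback.fst (p.core.map (Over.homMk X.hom : (Over.map u).obj X ⟶ Over.mk u)) (ctpD p φ)).left

theorem ctpK_isPullback (X : Over D) :
    IsPullback (ctpFst p φ X) ((ctpK p φ).obj X).hom
      (p.core.map (Over.homMk X.hom : (Over.map u).obj X ⟶ Over.mk u)).left (ctpD p φ).left :=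
  (IsPullback.of_hasPullback (p.core.map (Over.homMk X.hom : (Over.map u).obj X ⟶ Over.mk u))
    (ctpD p φ)).map (Over.forget _)

theorem ctpFst_naturality {X Y : Over D} (f : X ⟶ Y) :
    ((ctpK p φ).map f).left ≫ ctpFst p φ Y =
      ctpFst p φ X ≫ (p.core.map ((Over.map u).map f)).left := by
  have h : ((Over.pullback (ctpD p φ)).map ((Over.post p.core).map
    ((Over.iteratedSliceBackward (Over.mk u)).map f))).left ≫ pullback.fst _ _ =
      pullback.fst _ _ ≫ p.core.map ((Over.map u).map f) := pullback.lift_fst _ _ _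
  exact congrArg (fun t => t.left) h

/-- The comparison of underlying objects. -/
noncomputable def ctpIso (hφ : NatTrans.Equifibered φ) (X : Over D) :
    (Q.obj X).left ≅ ((ctpK p φ).obj X).left :=
  (ctp_isPullback p φ hφ X).isoIsPullback _ _ (ctpK_isPullback p φ X)

theorem ctpIso_fst (hφ : NatTrans.Equifibered φ) (X : Over D) :
    (ctpIso p φ hφ X).hom ≫ ctpFst p φ X = ctpApp p φ X :=
  IsPullback.isoIsPullback_hom_fst _ _ _ _

theorem ctpIso_snd (hφ : NatTrans.Equifibered φ) (X : Over D) :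
    (ctpIso p φ hφ X).hom ≫ ((ctpK p φ).obj X).hom = (Q.map (overBang X)).left :=
  IsPullback.isoIsPullback_hom_snd _ _ _ _

/-- A cartesian functor over a polynomial functor is recovered from the functor to the slice over
`N`. -/
noncomputable def ctpQIso (hφ : NatTrans.Equifibered φ) :
    Q ≅ ctpK p φ ⋙ Over.map (Q.obj (overOne D)).hom :=
  NatIso.ofComponents
    (fun X => Over.isoMk (ctpIso p φ hφ X) (by
      refine (Category.assoc _ _ _).symm.trans ?_
      refine (congrArg (· ≫ _) (ctpIso_snd p φ hφ X)).trans ?_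
      exact Over.w _))
    (fun {X Y} f => by
      refine Over.OverMorphism.ext ?_
      change (Q.map f).left ≫ (ctpIso p φ hφ Y).hom =
        (ctpIso p φ hφ X).hom ≫ ((ctpK p φ).map f).left
      refine (ctpK_isPullback p φ Y).hom_ext ?_ ?_
      · rw [Category.assoc, Category.assoc, ctpIso_fst, ctpFst_naturality, ctpApp_naturality,
          ← Category.assoc, ctpIso_fst]
      · rw [Category.assoc, Category.assoc, ctpIso_snd, Over.w, ctpIso_snd, ← Over.comp_left,
          ← Q.map_comp]
        congr 2
        ext
        exact Over.w f)

/-- A functor which is cartesian over a polynomial functor is polynomial. -/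
theorem isPolynomialFunctor_of_equifibered {P : Over I ⥤ Over J} (hP : IsPolynomialFunctor P)
    (φ : Q ⋙ Over.map v ⟶ Over.map u ⋙ P) (hφ : NatTrans.Equifibered φ) :
    IsPolynomialFunctor Q := by
  obtain ⟨p, ⟨e⟩⟩ := hP
  have h : NatTrans.Equifibered (φ ≫ Functor.whiskerLeft (Over.map u) e.hom) :=
    hφ.comp (.of_isIso _)
  exact ⟨⟨_, _, ctpS p (φ ≫ Functor.whiskerLeft (Over.map u) e.hom), pullback.fst _ p.f,
    (Q.obj (overOne D)).hom⟩, ⟨ctpQIso p _ h ≪≫ Functor.isoWhiskerRight (ctpKIso p _) _⟩⟩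

end CartToPoly

/-- A polynomial monad on `E/I`: a monad whose functor is polynomial, and whose unit and
multiplication are cartesian. -/
structure IsPolynomialMonad {I : E} (T : Monad (Over I)) : Prop where
  poly : IsPolynomialFunctor T.toFunctor
  unit : NatTrans.Equifibered T.η
  mult : NatTrans.Equifibered T.μ

theorem IsPolynomialMonad.isCartesianMonad {I : E} {T : Monad (Over I)}
    (hT : IsPolynomialMonad T) : IsCartesianMonad T where
  preserves := hT.poly.preserves
  unit := hT.unit
  mult := hT.mult

end Poly

/-! ## Polynomials cartesian over a polynomial monad -/

section MateGlob

variable {C : Type u} [Category.{v} C]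

/-- A transformation, as a transformation along identities. -/
def mateOfNat {A B : C} {F G : Over A ⥤ Over B} (e : F ⟶ G) :
    F ⋙ Over.map (𝟙 B) ⟶ Over.map (𝟙 A) ⋙ G :=
  Functor.whiskerLeft F (Over.mapId _).hom ≫ e ≫ Functor.whiskerRight (Over.mapId _).inv G

theorem valueAt_mateOfNat {A B : C} {F G : Over A ⥤ Over B} (e : F ⟶ G) {X Y : Over A}
    (g : X.left ⟶ Y.left) (h : g ≫ Y.hom = X.hom ≫ 𝟙 A) :
    valueAt (mateOfNat e) g h =
      (e.app X).left ≫ (G.map (Over.homMk g (by rw [h, Category.comp_id]) : X ⟶ Y)).left := by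
  have : (Over.homMk g (by rw [h, Category.comp_id]) : X ⟶ Y) =
    (Over.mapId _).inv.app X ≫ Over.homMk g h := by ext; simp
  rw [valueAt, this, G.map_comp]
  simp [mateOfNat]

theorem valueAt_mateOfNat_id {A B : C} {F G : Over A ⥤ Over B} (e : F ⟶ G) (X : Over A)
    (h : 𝟙 X.left ≫ X.hom = X.hom ≫ 𝟙 A) :
    valueAt (mateOfNat e) (𝟙 X.left) h = (e.app X).left := by
  have : (Over.homMk (𝟙 X.left) (by rw [h, Category.comp_id]) : X ⟶ X) = 𝟙 X := rfl
  rw [valueAt_mateOfNat, this, G.map_id]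
  exact Category.comp_id _

theorem valueAt_mateId_id {A B : C} (F : Over A ⥤ Over B) (X : Over A)
    (h : 𝟙 X.left ≫ X.hom = X.hom ≫ 𝟙 A) : valueAt (mateId F) (𝟙 X.left) h = 𝟙 _ := by
  have : (Over.homMk (𝟙 X.left) (by rw [h, Category.comp_id]) : X ⟶ X) = 𝟙 X := rfl
  rw [valueAt_mateId, this, F.map_id]
  rfl

theorem valueAt_glob_comp {A B A' B' : C} {F G : Over A ⥤ Over B} {F' : Over A' ⥤ Over B'}
    {l : A ⟶ A'} {r : B ⟶ B'} (m : F ⋙ Over.map (𝟙 B) ⟶ Over.map (𝟙 A) ⋙ G)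
    (n : G ⋙ Over.map r ⟶ Over.map l ⋙ F')
    {X : Over A} {Z : Over A'} (g : X.left ⟶ Z.left) (h : g ≫ Z.hom = X.hom ≫ 𝟙 A ≫ l)
    (h' : g ≫ Z.hom = X.hom ≫ l) :
    valueAt (mateVComp m n) g h =
      valueAt m (X := X) (Y := X) (𝟙 X.left) ((Category.id_comp _).trans (Category.comp_id _).symm) ≫
        valueAt n g h' := by
  have e : valueAt (mateVComp m n) g h = valueAt (mateVComp m n) (𝟙 X.left ≫ g)
    ((congrArg (· ≫ Z.hom) (Category.id_comp g)).trans h) := by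
    congr 1
    exact (Category.id_comp g).symm
  rw [e]
  exact valueAt_mateVComp _ _ _ _ _ _ _

theorem valueAt_comp_glob {A B A' B' : C} {F : Over A ⥤ Over B} {F' G : Over A' ⥤ Over B'}
    {l : A ⟶ A'} {r : B ⟶ B'} (n : F ⋙ Over.map r ⟶ Over.map l ⋙ F')
    (m : F' ⋙ Over.map (𝟙 B') ⟶ Over.map (𝟙 A') ⋙ G)
    {X : Over A} {Z : Over A'} (g : X.left ⟶ Z.left) (h : g ≫ Z.hom = X.hom ≫ l ≫ 𝟙 A')
    (h' : g ≫ Z.hom = X.hom ≫ l) :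
    valueAt (mateVComp n m) g h = valueAt n g h' ≫
      valueAt m (X := Z) (Y := Z) (𝟙 Z.left)
        ((Category.id_comp _).trans (Category.comp_id _).symm) := by
  have e : valueAt (mateVComp n m) g h = valueAt (mateVComp n m) (g ≫ 𝟙 Z.left)
    ((congrArg (· ≫ Z.hom) (Category.comp_id g)).trans h) := by
    congr 1
    exact (Category.comp_id g).symm
  rw [e]
  exact valueAt_mateVComp _ _ _ _ _ _ _

theorem mateOfNat_equifibered {A B : C} {F G : Over A ⥤ Over B} (e : F ≅ G) :
    NatTrans.Equifibered (mateOfNat e.hom) :=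
  NatTrans.Equifibered.comp (.of_isIso _) (.comp (.of_isIso _) (.of_isIso _))

theorem mateHComp_equifibered {A B D A' B' D' : C} {F : Over A ⥤ Over B} {F' : Over A' ⥤ Over B'}
    {l : A ⟶ A'} {r : B ⟶ B'} {n : F ⋙ Over.map r ⟶ Over.map l ⋙ F'} {G : Over B ⥤ Over D}
    {G' : Over B' ⥤ Over D'} {r' : B ⟶ B'} {s : D ⟶ D'} {m : G ⋙ Over.map s ⟶ Over.map r' ⋙ G'}
    (h : r = r') (hn : NatTrans.Equifibered n) (hm : NatTrans.Equifibered m)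
    (hG : PreservesLimitsOfShape WalkingCospan G') : NatTrans.Equifibered (mateHComp n m h) :=
  NatTrans.Equifibered.comp (hm.whiskerLeft F)
    ((NatTrans.Equifibered.comp (.of_isIso _) hn).whiskerRight G')

/-- The identity transformation of `l_!`. -/
def hidNat {A B : C} (l : A ⟶ B) : 𝟭 (Over A) ⋙ Over.map l ⟶ Over.map l ⋙ 𝟭 (Over B) :=
  (Functor.leftUnitor _).hom ≫ (Functor.rightUnitor _).inv

theorem valueAt_hidNat {A B : C} (l : A ⟶ B) {X : Over A} {Y : Over B} (g : X.left ⟶ Y.left)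
    (h : g ≫ Y.hom = X.hom ≫ l) : valueAt (hidNat l) g h = g := by
  refine (congrArg (· ≫ _) (Category.comp_id _)).trans ?_
  exact Category.id_comp _

theorem hidNat_equifibered {A B : C} (l : A ⟶ B) : NatTrans.Equifibered (hidNat l) :=
  NatTrans.Equifibered.comp (.of_isIso _) (.of_isIso _)

end MateGlob

section PolyOver

theorem PolyOver.glob_w {E : Type u} [Category.{v} E] {I : E} {A : Over I} (X : Over A.left) :
    𝟙 X.left ≫ X.hom = X.hom ≫ (𝟙 A : A ⟶ A).left :=
  (Category.id_comp _).trans (Category.comp_id _).symm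

theorem PolyOver.comp_w' {E : Type u} [Category.{v} E] {I : E} {A : Over I} {X Y : Over A.left} {Z : Over I} (g : X.left ⟶ Y.left)
    (h : g ≫ Y.hom = X.hom ≫ 𝟙 A.left) (k : Y.left ⟶ Z.left)
    (h' : k ≫ Z.hom = Y.hom ≫ A.hom) : (g ≫ k) ≫ Z.hom = X.hom ≫ A.hom := by
  rw [Category.assoc, h', ← Category.assoc, h, Category.comp_id]

variable {E : Type u} [Category.{v} E] [HasPullbacks E] [LocallyCartesianClosed E] {I : E}

/-- A polynomial functor `E/D ⥤ E/C`, for objects `D` and `C` of `E/I`, together with a cartesian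
transformation to `T`, along `D ⟶ I` and `C ⟶ I`. -/
structure PolyOver (T : Monad (Over I)) (D C : Over I) where
  /-- the functor -/
  functor : Over D.left ⥤ Over C.left
  poly : IsPolynomialFunctor functor
  /-- the transformation to `T` -/
  toP : functor ⋙ Over.map C.hom ⟶ Over.map D.hom ⋙ T.toFunctor
  toP_cart : NatTrans.Equifibered toP

/-- A square of polynomials over `T`: a cartesian transformation, compatible with the
transformations to `T`. -/
structure PolyOverSq {T : Monad (Over I)} (M N : HorTotal (PolyOver T)) where
  /-- the map on sources -/
  left : M.src ⟶ N.src
  /-- the map on targets -/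
  right : M.tgt ⟶ N.tgt
  /-- the transformation -/
  nat : M.hor.functor ⋙ Over.map right.left ⟶ Over.map left.left ⋙ N.hor.functor
  nat_cart : NatTrans.Equifibered nat
  comm : ∀ X : Over M.src.left,
    (nat.app X).left ≫ (N.hor.toP.app ((Over.map left.left).obj X)).left =
      (M.hor.toP.app X).left ≫ (T.map (Over.homMk (𝟙 X.left) (by simp) :
        (Over.map M.src.hom).obj X ⟶ (Over.map N.src.hom).obj ((Over.map left.left).obj X))).left

namespace PolyOverSq

variable {T : Monad (Over I)}

theorem comp_w {M N : HorTotal (PolyOver T)} (l : M.src ⟶ N.src) {X : Over M.src.left}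
    {Y : Over N.src.left} {Z : Over I} (g : X.left ⟶ Y.left) (h : g ≫ Y.hom = X.hom ≫ l.left)
    (k : Y.left ⟶ Z.left) (h' : k ≫ Z.hom = Y.hom ≫ N.src.hom) :
    (g ≫ k) ≫ Z.hom = X.hom ≫ M.src.hom := by
  rw [Category.assoc, h', ← Category.assoc, h, Category.assoc, Over.w]

theorem valueAt_comm {M N : HorTotal (PolyOver T)} (α : PolyOverSq M N) {X : Over M.src.left}
    {Y : Over N.src.left} {Z : Over I} (g : X.left ⟶ Y.left)
    (h : g ≫ Y.hom = X.hom ≫ α.left.left) (k : Y.left ⟶ Z.left)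
    (h' : k ≫ Z.hom = Y.hom ≫ N.src.hom) :
    valueAt α.nat g h ≫ valueAt N.hor.toP k h' =
      valueAt M.hor.toP (g ≫ k) (comp_w α.left g h k h') := by
  have h₀ : (g ≫ k) ≫ Z.hom = ((Over.map α.left.left).obj X).hom ≫ N.src.hom := by
    rw [Category.assoc, h', ← Category.assoc, h]
    rfl
  have e₁ := comp_valueAt N.hor.toP (W := (Over.map α.left.left).obj X) (Over.homMk g h) k h' h₀
  have e₂ : valueAt N.hor.toP (X := (Over.map α.left.left).obj X) (g ≫ k) h₀ =
    (N.hor.toP.app ((Over.map α.left.left).obj X)).left ≫ (T.map (Over.homMk (g ≫ k) h₀ :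
      (Over.map N.src.hom).obj ((Over.map α.left.left).obj X) ⟶ Z)).left := rfl
  have e₃ : (Over.homMk (𝟙 X.left) (by simp) : (Over.map M.src.hom).obj X ⟶
      (Over.map N.src.hom).obj ((Over.map α.left.left).obj X)) ≫ Over.homMk (g ≫ k) h₀ =
      (Over.homMk (g ≫ k) (comp_w α.left g h k h') : (Over.map M.src.hom).obj X ⟶ Z) := by
    ext
    exact Category.id_comp _
  have e₄ := congrArg (fun t => t ≫ (T.map (Over.homMk (g ≫ k) h₀ :
    (Over.map N.src.hom).obj ((Over.map α.left.left).obj X) ⟶ Z)).left) (α.comm X)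
  have e₅ : ((M.hor.toP.app X).left ≫ (T.map (Over.homMk (𝟙 X.left) (by simp) :
        (Over.map M.src.hom).obj X ⟶
          (Over.map N.src.hom).obj ((Over.map α.left.left).obj X))).left) ≫
      (T.map (Over.homMk (g ≫ k) h₀ :
        (Over.map N.src.hom).obj ((Over.map α.left.left).obj X) ⟶ Z)).left =
      valueAt M.hor.toP (g ≫ k) (comp_w α.left g h k h') := by
    rw [Category.assoc, ← Over.comp_left, ← T.map_comp, e₃]
    rfl
  rw [valueAt, Category.assoc]
  refine (congrArg _ (e₁.trans e₂)).trans ?_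
  exact ((Category.assoc _ _ _).symm.trans e₄).trans e₅

theorem comm_of_valueAt {M N : HorTotal (PolyOver T)} {l : M.src ⟶ N.src} {r : M.tgt ⟶ N.tgt}
    {n : M.hor.functor ⋙ Over.map r.left ⟶ Over.map l.left ⋙ N.hor.functor}
    (H : ∀ (X : Over M.src.left) (Y : Over N.src.left) (Z : Over I) (g : X.left ⟶ Y.left)
      (h : g ≫ Y.hom = X.hom ≫ l.left) (k : Y.left ⟶ Z.left)
      (h' : k ≫ Z.hom = Y.hom ≫ N.src.hom),
      valueAt n g h ≫ valueAt N.hor.toP k h' =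
        valueAt M.hor.toP (g ≫ k) (comp_w l g h k h')) (X : Over M.src.left) :
    (n.app X).left ≫ (N.hor.toP.app ((Over.map l.left).obj X)).left =
      (M.hor.toP.app X).left ≫ (T.map (Over.homMk (𝟙 X.left) (by simp) :
        (Over.map M.src.hom).obj X ⟶ (Over.map N.src.hom).obj ((Over.map l.left).obj X))).left := by
  have e := H X ((Over.map l.left).obj X)
    ((Over.map N.src.hom).obj ((Over.map l.left).obj X)) (𝟙 X.left) (Category.id_comp _)
    (𝟙 X.left) (Category.id_comp _)
  rw [app_left_eq n]
  refine (congrArg _ (app_left_eq N.hor.toP _)).trans (e.trans ?_)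
  have e' : (T.map (Over.homMk (𝟙 X.left ≫ 𝟙 X.left) (by simp) : (Over.map M.src.hom).obj X ⟶
      (Over.map N.src.hom).obj ((Over.map l.left).obj X))).left =
      (T.map (Over.homMk (𝟙 X.left) (by simp) : (Over.map M.src.hom).obj X ⟶
        (Over.map N.src.hom).obj ((Over.map l.left).obj X))).left := by
    congr 3
    exact Category.id_comp _
  exact congrArg (fun t => (M.hor.toP.app X).left ≫ t) e'

theorem ext_valueAt {M N : HorTotal (PolyOver T)} {α β : PolyOverSq M N} (h₁ : α.left = β.left)
    (h₂ : α.right = β.right)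
    (h₃ : ∀ (X : Over M.src.left) (Y : Over N.src.left) (g : X.left ⟶ Y.left)
      (h : g ≫ Y.hom = X.hom ≫ α.left.left) (h' : g ≫ Y.hom = X.hom ≫ β.left.left),
      valueAt α.nat g h = valueAt β.nat g h') : α = β := by
  obtain ⟨l, r, n, _, _⟩ := α
  obtain ⟨l', r', n', _, _⟩ := β
  obtain rfl : l = l' := h₁
  obtain rfl : r = r' := h₂
  obtain rfl : n = n' := mate_ext fun X Y g h => h₃ X Y g h h
  rfl

/-- The identity square. -/
def id (M : HorTotal (PolyOver T)) : PolyOverSq M M where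
  left := 𝟙 _
  right := 𝟙 _
  nat := mateId _
  nat_cart := mateId_equifibered _
  comm := comm_of_valueAt (l := 𝟙 M.src) (r := 𝟙 M.tgt) fun X Y Z g h k h' => by
    refine (congrArg (· ≫ _) (valueAt_mateId M.hor.functor g h)).trans ?_
    exact comp_valueAt M.hor.toP _ k h' _

/-- Vertical composition of squares. -/
def comp {M N K : HorTotal (PolyOver T)} (α : PolyOverSq M N) (β : PolyOverSq N K) :
    PolyOverSq M K where
  left := α.left ≫ β.left
  right := α.right ≫ β.right
  nat := mateVComp α.nat β.nat
  nat_cart := mateVComp_equifibered α.nat_cart β.nat_cart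
  comm := comm_of_valueAt (l := α.left ≫ β.left) (r := α.right ≫ β.right) fun X Y Z g h k h' => by
    have e := valueAt_mateVComp' α.nat β.nat g h
    have h₂ := β.valueAt_comm (X := Over.mk (X.hom ≫ α.left.left)) (Y := Y) g (by simpa using h)
      k h'
    have h₁ := α.valueAt_comm (X := X) (Y := Over.mk (X.hom ≫ α.left.left)) (𝟙 _)
      (Category.id_comp _) (g ≫ k) (comp_w β.left (X := Over.mk (X.hom ≫ α.left.left)) (Y := Y) g
        (by simpa using h) k h')
    refine (congrArg (· ≫ _) e).trans ?_
    rw [Category.assoc, h₂, h₁]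
    congr 1
    exact Category.id_comp _

end PolyOverSq

theorem PolyOverSq.id_comp {T : Monad (Over I)} {M N : HorTotal (PolyOver T)}
    (α : PolyOverSq M N) : (PolyOverSq.id M).comp α = α :=
  PolyOverSq.ext_valueAt (Category.id_comp α.left) (Category.id_comp α.right)
    fun _ _ g h h' => valueAt_id_comp α.nat g h h'

theorem PolyOverSq.comp_id {T : Monad (Over I)} {M N : HorTotal (PolyOver T)}
    (α : PolyOverSq M N) : α.comp (PolyOverSq.id N) = α :=
  PolyOverSq.ext_valueAt (Category.comp_id α.left) (Category.comp_id α.right)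
    fun _ _ g h h' => valueAt_comp_id α.nat g h h'

theorem PolyOverSq.assoc {T : Monad (Over I)} {M N K L : HorTotal (PolyOver T)}
    (α : PolyOverSq M N) (β : PolyOverSq N K) (γ : PolyOverSq K L) :
    (α.comp β).comp γ = α.comp (β.comp γ) :=
  PolyOverSq.ext_valueAt (Category.assoc α.left β.left γ.left)
    (Category.assoc α.right β.right γ.right)
    fun _ _ g h h' => valueAt_assoc α.nat β.nat γ.nat g h h'

/-- The category of polynomials over `T`. -/
instance polyOverCategory (T : Monad (Over I)) : Category (HorTotal (PolyOver T)) where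
  Hom M N := PolyOverSq M N
  id M := PolyOverSq.id M
  comp α β := PolyOverSq.comp α β
  id_comp α := PolyOverSq.id_comp α
  comp_id α := PolyOverSq.comp_id α
  assoc α β γ := PolyOverSq.assoc α β γ

namespace PolyOver

variable {T : Monad (Over I)}

/-- The horizontal identity: the identity functor, over `T` by the unit. -/
def hid (hT : IsPolynomialMonad T) (D : Over I) : PolyOver T D D where
  functor := 𝟭 _
  toP := (Functor.whiskerLeft (Over.map D.hom) T.η :)
  toP_cart := hT.unit.whiskerLeft (Over.map D.hom)
  poly := isPolynomialFunctor_of_equifibered hT.poly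
    (u := D.hom) (v := D.hom) (Q := 𝟭 _) (Functor.whiskerLeft (Over.map D.hom) T.η :)
    (hT.unit.whiskerLeft (Over.map D.hom))

theorem valueAt_hid (hT : IsPolynomialMonad T) (D : Over I) {X : Over D.left} {Y : Over I}
    (g : X.left ⟶ Y.left) (h : g ≫ Y.hom = X.hom ≫ D.hom) :
    valueAt (hid hT D).toP g h = g ≫ (T.η.app Y).left :=
  (congrArg (fun t => t.left) (T.η.naturality (Over.homMk g h : (Over.map D.hom).obj X ⟶ Y))).symm

/-- The structure map of a composite: the horizontal composite of the structure maps, followed by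
the multiplication. -/
def hcompToP {A B C : Over I} (M : PolyOver T A B) (N : PolyOver T B C) :
    (M.functor ⋙ N.functor) ⋙ Over.map C.hom ⟶ Over.map A.hom ⋙ T.toFunctor :=
  mateHComp M.toP N.toP rfl ≫ Functor.whiskerLeft (Over.map A.hom) T.μ

theorem hcompToP_cart (hT : IsPolynomialMonad T) {A B C : Over I} (M : PolyOver T A B)
    (N : PolyOver T B C) : NatTrans.Equifibered (hcompToP M N) :=
  NatTrans.Equifibered.comp
    (mateHComp_equifibered _ M.toP_cart N.toP_cart hT.poly.preserves)
    (hT.mult.whiskerLeft _)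

/-- The composite of polynomials over `T`. -/
def hcomp (hT : IsPolynomialMonad T) {A B C : Over I} (M : PolyOver T A B) (N : PolyOver T B C) :
    PolyOver T A C where
  functor := M.functor ⋙ N.functor
  poly := isPolynomialFunctor_of_equifibered hT.poly (hcompToP M N) (hcompToP_cart hT M N)
  toP := hcompToP M N
  toP_cart := hcompToP_cart hT M N

theorem valueAt_hcomp (hT : IsPolynomialMonad T) {A B C : Over I} (M : PolyOver T A B)
    (N : PolyOver T B C) {X : Over A.left} {Y : Over I}
    (g : X.left ⟶ Y.left) (h : g ≫ Y.hom = X.hom ≫ A.hom) :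
    valueAt (hcomp hT M N).toP g h =
      valueAt N.toP (valueAt M.toP g h) (valueAt_w M.toP g h) ≫ (T.μ.app Y).left := by
  have e : (T.map (T.map (Over.homMk g h : (Over.map A.hom).obj X ⟶ Y))).left ≫
      (T.μ.app Y).left = (T.μ.app ((Over.map A.hom).obj X)).left ≫
        (T.map (Over.homMk g h : (Over.map A.hom).obj X ⟶ Y)).left :=
    congrArg (fun t => t.left) (T.μ.naturality (Over.homMk g h : (Over.map A.hom).obj X ⟶ Y))
  rw [← valueAt_mateHComp M.toP N.toP rfl g h, valueAt, valueAt, Category.assoc]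
  exact (Category.assoc _ _ _).trans (congrArg _ e.symm)

/-- The horizontal identity square. -/
def hidSq (hT : IsPolynomialMonad T) {A B : Over I} (f : A ⟶ B) :
    tot (hid hT A) ⟶ tot (hid hT B) :=
  PolyOverSq.mk (M := tot (hid hT A)) (N := tot (hid hT B)) f f (hidNat f.left)
    (hidNat_equifibered f.left)
    (PolyOverSq.comm_of_valueAt (M := tot (hid hT A)) (N := tot (hid hT B)) (n := hidNat f.left)
      fun X Y Z g h k h' => by
        refine (congrArg₂ (· ≫ ·) (valueAt_hidNat f.left g h) (valueAt_hid hT B k h')).trans ?_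
        refine Eq.trans ?_ (valueAt_hid hT A (g ≫ k) _).symm
        exact (Category.assoc _ _ _).symm)

/-- Horizontal composition of squares. -/
def hcompSq (hT : IsPolynomialMonad T) {A B C A' B' C' : Over I} {M : PolyOver T A B}
    {N : PolyOver T B C} {M' : PolyOver T A' B'} {N' : PolyOver T B' C'}
    (α : tot M ⟶ tot M') (β : tot N ⟶ tot N') (h : PolyOverSq.right α = PolyOverSq.left β) :
    tot (hcomp hT M N) ⟶ tot (hcomp hT M' N') :=
  PolyOverSq.mk (M := tot (hcomp hT M N)) (N := tot (hcomp hT M' N'))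
    (PolyOverSq.left (M := tot M) (N := tot M') α) (PolyOverSq.right (M := tot N) (N := tot N') β)
    (mateHComp (PolyOverSq.nat α) (PolyOverSq.nat β) (congrArg (fun t => t.left) h))
    (mateHComp_equifibered _ (PolyOverSq.nat_cart α) (PolyOverSq.nat_cart β) N'.poly.preserves)
    (PolyOverSq.comm_of_valueAt (M := tot (hcomp hT M N)) (N := tot (hcomp hT M' N'))
      fun X Y Z g h₁ k h₂ => by
        refine (congrArg₂ (· ≫ ·) (valueAt_mateHComp _ _ _ g h₁)
          (valueAt_hcomp hT M' N' k h₂)).trans ?_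
        refine Eq.trans ?_ (valueAt_hcomp hT M N (g ≫ k) _).symm
        refine (Category.assoc _ _ _).symm.trans ?_
        refine congrArg (· ≫ _) ?_
        refine (PolyOverSq.valueAt_comm (M := tot N) (N := tot N') β _ _ _ _).trans ?_
        congr 1
        exact PolyOverSq.valueAt_comm (M := tot M) (N := tot M') α g h₁ k h₂)

/-- An isomorphism of polynomials over `T`, with identity endpoints. -/
def globIso {A B : Over I} {M N : PolyOver T A B} (e : M.functor ≅ N.functor)
    (h : ∀ (X : Over A.left) (Z : Over I) (k : X.left ⟶ Z.left) (h : k ≫ Z.hom = X.hom ≫ A.hom),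
      (e.hom.app X).left ≫ valueAt N.toP k h = valueAt M.toP k h) : tot M ≅ tot N where
  hom := PolyOverSq.mk (M := tot M) (N := tot N) (𝟙 A) (𝟙 B) (mateOfNat e.hom)
    (mateOfNat_equifibered e)
    (PolyOverSq.comm_of_valueAt (M := tot M) (N := tot N) (l := 𝟙 A) (r := 𝟙 B)
      fun X Y Z g h₁ k h₂ => by
        refine (congrArg (· ≫ _) (valueAt_mateOfNat e.hom g h₁)).trans ?_
        refine (Category.assoc _ _ _).trans ?_
        refine (congrArg _ (comp_valueAt N.toP _ k h₂ (comp_w' g h₁ k h₂))).trans ?_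
        exact h X Z (g ≫ k) _)
  inv := PolyOverSq.mk (M := tot N) (N := tot M) (𝟙 A) (𝟙 B) (mateOfNat e.inv)
    (mateOfNat_equifibered e.symm)
    (PolyOverSq.comm_of_valueAt (M := tot N) (N := tot M) (l := 𝟙 A) (r := 𝟙 B)
      fun X Y Z g h₁ k h₂ => by
        refine (congrArg (· ≫ _) (valueAt_mateOfNat e.inv g h₁)).trans ?_
        refine (Category.assoc _ _ _).trans ?_
        refine (congrArg _ (comp_valueAt M.toP _ k h₂ (comp_w' g h₁ k h₂))).trans ?_
        refine (congrArg _ (h X Z (g ≫ k) (comp_w' g h₁ k h₂)).symm).trans ?_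
        refine (Category.assoc _ _ _).symm.trans ?_
        refine (congrArg (· ≫ _) (congrArg (fun t => t.left) (e.inv_hom_id_app X))).trans ?_
        exact Category.id_comp _)
  hom_inv_id := PolyOverSq.ext_valueAt (Category.id_comp (𝟙 A)) (Category.id_comp (𝟙 B))
    fun X Y g h₁ h₂ => by
      refine (valueAt_comp_glob (mateOfNat e.hom) (mateOfNat e.inv) g h₁ h₂).trans ?_
      refine (congrArg₂ (· ≫ ·) (valueAt_mateOfNat _ g h₂) (valueAt_mateOfNat_id _ _ _)).trans ?_
      refine Eq.trans ?_ (valueAt_mateId _ g h₂).symm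
      have n := congrArg (fun t => t.left) (e.inv.naturality
        (Over.homMk g (by rw [h₂]; exact Category.comp_id _) : X ⟶ Y))
      refine (Category.assoc _ _ _).trans ((congrArg _ n).trans ?_)
      refine (Category.assoc _ _ _).symm.trans ?_
      refine (congrArg (· ≫ _) (congrArg (fun t => t.left) (e.hom_inv_id_app X))).trans ?_
      exact Category.id_comp _
  inv_hom_id := PolyOverSq.ext_valueAt (Category.id_comp (𝟙 A)) (Category.id_comp (𝟙 B))
    fun X Y g h₁ h₂ => by
      refine (valueAt_comp_glob (mateOfNat e.inv) (mateOfNat e.hom) g h₁ h₂).trans ?_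
      refine (congrArg₂ (· ≫ ·) (valueAt_mateOfNat _ g h₂) (valueAt_mateOfNat_id _ _ _)).trans ?_
      refine Eq.trans ?_ (valueAt_mateId _ g h₂).symm
      have n := congrArg (fun t => t.left) (e.hom.naturality
        (Over.homMk g (by rw [h₂]; exact Category.comp_id _) : X ⟶ Y))
      refine (Category.assoc _ _ _).trans ((congrArg _ n).trans ?_)
      refine (Category.assoc _ _ _).symm.trans ?_
      refine (congrArg (· ≫ _) (congrArg (fun t => t.left) (e.inv_hom_id_app X))).trans ?_
      exact Category.id_comp _

/-- The associativity constraint. -/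
def assocIso (hT : IsPolynomialMonad T) {A B C D : Over I} (M : PolyOver T A B)
    (N : PolyOver T B C) (K : PolyOver T C D) :
    tot (hcomp hT (hcomp hT M N) K) ≅ tot (hcomp hT M (hcomp hT N K)) :=
  globIso (M := hcomp hT (hcomp hT M N) K) (N := hcomp hT M (hcomp hT N K))
    (Functor.associator M.functor N.functor K.functor) fun X Z k h => by
      have e₁ := valueAt_hcomp hT M (hcomp hT N K) k h
      have e₂ := valueAt_hcomp hT N K (valueAt M.toP k h) (valueAt_w M.toP k h)
      have e₃ := valueAt_hcomp hT (hcomp hT M N) K k h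
      have e₄ := valueAt_hcomp hT M N k h
      have e₅ : valueAt K.toP (valueAt (hcomp hT M N).toP k h) (valueAt_w _ k h) =
          valueAt K.toP (valueAt N.toP (valueAt M.toP k h) (valueAt_w _ _ _)) (valueAt_w _ _ _) ≫
            (T.map (T.μ.app Z)).left := by
        refine Eq.trans ?_ (valueAt_comp K.toP _ _ (T.μ.app Z)
          ((Category.assoc _ _ _).trans ((congrArg _ (Over.w (T.μ.app Z))).trans
            (valueAt_w N.toP _ _)))).symm
        congr 1
      have e₆ : (T.map (T.μ.app Z)).left ≫ (T.μ.app Z).left =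
          (T.μ.app (T.obj Z)).left ≫ (T.μ.app Z).left := congrArg (fun t => t.left) (T.assoc Z)
      refine (Category.id_comp _).trans (e₁.trans ((congrArg (· ≫ _) e₂).trans ?_))
      refine (Category.assoc _ _ _).trans ((congrArg _ e₆.symm).trans ?_)
      exact (Category.assoc _ _ _).symm.trans ((congrArg (· ≫ _) e₅.symm).trans e₃.symm)

/-- The left unit constraint. -/
def lunitIso (hT : IsPolynomialMonad T) {A B : Over I} (M : PolyOver T A B) :
    tot (hcomp hT (hid hT A) M) ≅ tot M :=
  globIso (M := hcomp hT (hid hT A) M) (N := M)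
    (Functor.leftUnitor M.functor) fun X Z k h => by
      have e₁ := valueAt_hcomp hT (hid hT A) M k h
      have e₂ := valueAt_hid hT A k h
      have e₃ : valueAt M.toP (valueAt (hid hT A).toP k h) (valueAt_w _ k h) =
          valueAt M.toP k h ≫ (T.map (T.η.app Z)).left := by
        refine Eq.trans ?_ (valueAt_comp M.toP k h (T.η.app Z)
          ((Category.assoc _ _ _).trans ((congrArg _ (Over.w (T.η.app Z))).trans h))).symm
        congr 1
      have e₄ : (T.map (T.η.app Z)).left ≫ (T.μ.app Z).left = 𝟙 _ :=
        congrArg (fun t => t.left) (T.right_unit Z)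
      refine (Category.id_comp _).trans (Eq.symm (e₁.trans ((congrArg (· ≫ _) e₃).trans ?_)))
      exact (Category.assoc _ _ _).trans ((congrArg _ e₄).trans (Category.comp_id _))

/-- The right unit constraint. -/
def runitIso (hT : IsPolynomialMonad T) {A B : Over I} (M : PolyOver T A B) :
    tot (hcomp hT M (hid hT B)) ≅ tot M :=
  globIso (M := hcomp hT M (hid hT B)) (N := M)
    (Functor.rightUnitor M.functor) fun X Z k h => by
      have e₁ := valueAt_hcomp hT M (hid hT B) k h
      have e₂ := valueAt_hid hT B (valueAt M.toP k h) (valueAt_w _ k h)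
      have e₄ : (T.η.app (T.obj Z)).left ≫ (T.μ.app Z).left = 𝟙 _ :=
        congrArg (fun t => t.left) (T.left_unit Z)
      refine (Category.id_comp _).trans (Eq.symm (e₁.trans ((congrArg (· ≫ _) e₂).trans ?_)))
      exact (Category.assoc _ _ _).trans ((congrArg _ e₄).trans (Category.comp_id _))

section Values

/-- The value of a square at a map. -/
def val {A B A' B' : Over I} {M : PolyOver T A B} {M' : PolyOver T A' B'} (α : tot M ⟶ tot M')
    {X : Over A.left} {Y : Over A'.left} (g : X.left ⟶ Y.left)
    (h : g ≫ Y.hom = X.hom ≫ (PolyOverSq.left (M := tot M) (N := tot M') α).left) :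
    (M.functor.obj X).left ⟶ (M'.functor.obj Y).left :=
  valueAt (PolyOverSq.nat α) g h

theorem val_ext {A B A' B' : Over I} {M : PolyOver T A B} {M' : PolyOver T A' B'}
    {α β : tot M ⟶ tot M'} (h₁ : PolyOverSq.left α = PolyOverSq.left β)
    (h₂ : PolyOverSq.right α = PolyOverSq.right β)
    (h₃ : ∀ (X : Over A.left) (Y : Over A'.left) (g : X.left ⟶ Y.left)
      (h : g ≫ Y.hom = X.hom ≫ (PolyOverSq.left (M := tot M) (N := tot M') α).left)
      (h' : g ≫ Y.hom = X.hom ≫ (PolyOverSq.left (M := tot M) (N := tot M') β).left),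
      val α g h = val β g h') : α = β :=
  PolyOverSq.ext_valueAt h₁ h₂ h₃

theorem val_w {A B C A' B' C' : Over I} {M : PolyOver T A B}
    {N : PolyOver T B C} {M' : PolyOver T A' B'} {N' : PolyOver T B' C'}
    (α : tot M ⟶ tot M') {X : Over A.left} {Y : Over A'.left} (g : X.left ⟶ Y.left)
    (h' : g ≫ Y.hom = X.hom ≫ (PolyOverSq.left (M := tot M) (N := tot M') α).left)
    (β : tot N ⟶ tot N') (h : PolyOverSq.right α = PolyOverSq.left β) :
    val α g h' ≫ (M'.functor.obj Y).hom =
      (M.functor.obj X).hom ≫ (PolyOverSq.left (M := tot N) (N := tot N') β).left := by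
  refine (valueAt_w (PolyOverSq.nat α) g h').trans ?_
  exact congrArg (fun t : B ⟶ B' => (M.functor.obj X).hom ≫ t.left) h

theorem val_comp_w {A B C A' B' C' A'' B'' C'' : Over I} {M : PolyOver T A B}
    {N : PolyOver T B C} {M' : PolyOver T A' B'} {N' : PolyOver T B' C'} {M'' : PolyOver T A'' B''}
    {N'' : PolyOver T B'' C''} (α : tot M ⟶ tot M') (α' : tot M' ⟶ tot M'')
    {X : Over A.left} {Y : Over A'.left} {Z : Over A''.left} (g : X.left ⟶ Y.left)
    (k : Y.left ⟶ Z.left)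
    (w : g ≫ Y.hom = X.hom ≫ (PolyOverSq.left (M := tot M) (N := tot M') α).left)
    (w' : k ≫ Z.hom = Y.hom ≫ (PolyOverSq.left (M := tot M') (N := tot M'') α').left)
    (β : tot N ⟶ tot N') (β' : tot N' ⟶ tot N'')
    (h : PolyOverSq.right α = PolyOverSq.left β) (h' : PolyOverSq.right α' = PolyOverSq.left β') :
    (val α g w ≫ val α' k w') ≫ (M''.functor.obj Z).hom =
      (M.functor.obj X).hom ≫ (PolyOverSq.left (M := tot N) (N := tot N'') (β ≫ β')).left := by
  rw [Category.assoc, val_w α' k w' β' h', ← Category.assoc, val_w α g w β h]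
  exact Category.assoc _ _ _

theorem val_hcompSq (hT : IsPolynomialMonad T) {A B C A' B' C' : Over I} {M : PolyOver T A B}
    {N : PolyOver T B C} {M' : PolyOver T A' B'} {N' : PolyOver T B' C'}
    (α : tot M ⟶ tot M') (β : tot N ⟶ tot N') (h : PolyOverSq.right α = PolyOverSq.left β)
    {X : Over A.left} {Y : Over A'.left} (g : X.left ⟶ Y.left)
    (h' : g ≫ Y.hom = X.hom ≫ (PolyOverSq.left (M := tot M) (N := tot M') α).left) :
    val (hcompSq hT α β h) g h' = val β (val α g h') (val_w α g h' β h) :=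
  valueAt_mateHComp (PolyOverSq.nat α) (PolyOverSq.nat β) (congrArg (fun t => t.left) h) g h'

theorem val_comp {A B A' B' A'' B'' : Over I} {M : PolyOver T A B} {M' : PolyOver T A' B'}
    {M'' : PolyOver T A'' B''} (α : tot M ⟶ tot M') (β : tot M' ⟶ tot M'')
    {X : Over A.left} {Y : Over A'.left} {Z : Over A''.left} (g : X.left ⟶ Y.left)
    (k : Y.left ⟶ Z.left)
    (h : g ≫ Y.hom = X.hom ≫ (PolyOverSq.left (M := tot M) (N := tot M') α).left)
    (h' : k ≫ Z.hom = Y.hom ≫ (PolyOverSq.left (M := tot M') (N := tot M'') β).left)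
    (h'' : (g ≫ k) ≫ Z.hom = X.hom ≫ (PolyOverSq.left (M := tot M) (N := tot M'') (α ≫ β)).left) :
    val (α ≫ β) (g ≫ k) h'' = val α g h ≫ val β k h' :=
  valueAt_mateVComp _ _ _ _ _ _ _

theorem val_comp_glob {A B A' B' : Over I} {M : PolyOver T A B} {M' M'' : PolyOver T A' B'}
    (α : tot M ⟶ tot M') (β : tot M' ⟶ tot M'')
    {X : Over A.left} {Z : Over A'.left} (g : X.left ⟶ Z.left)
    (h : g ≫ Z.hom = X.hom ≫ (PolyOverSq.left (M := tot M) (N := tot M') α).left)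
    (h' : 𝟙 Z.left ≫ Z.hom = Z.hom ≫ (PolyOverSq.left (M := tot M') (N := tot M'') β).left)
    (h'' : g ≫ Z.hom = X.hom ≫ (PolyOverSq.left (M := tot M) (N := tot M'') (α ≫ β)).left) :
    val (α ≫ β) g h'' = val α g h ≫ val β (𝟙 Z.left) h' := by
  refine Eq.trans ?_ (val_comp α β g (𝟙 Z.left) h h'
    ((congrArg (· ≫ Z.hom) (Category.comp_id g)).trans h''))
  congr 1
  exact (Category.comp_id g).symm

theorem val_glob_comp {A B A' B' : Over I} {M M' : PolyOver T A B} {M'' : PolyOver T A' B'}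
    (α : tot M ⟶ tot M') (β : tot M' ⟶ tot M'')
    {X : Over A.left} {Z : Over A'.left} (g : X.left ⟶ Z.left)
    (h : 𝟙 X.left ≫ X.hom = X.hom ≫ (PolyOverSq.left (M := tot M) (N := tot M') α).left)
    (h' : g ≫ Z.hom = X.hom ≫ (PolyOverSq.left (M := tot M') (N := tot M'') β).left)
    (h'' : g ≫ Z.hom = X.hom ≫ (PolyOverSq.left (M := tot M) (N := tot M'') (α ≫ β)).left) :
    val (α ≫ β) g h'' = val α (𝟙 X.left) h ≫ val β g h' := by
  refine Eq.trans ?_ (val_comp α β (𝟙 X.left) g h h'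
    ((congrArg (· ≫ Z.hom) (Category.id_comp g)).trans h''))
  congr 1
  exact (Category.id_comp g).symm

theorem val_id {A B : Over I} (M : PolyOver T A B) (X : Over A.left)
    (h : 𝟙 X.left ≫ X.hom = X.hom ≫ (𝟙 A : A ⟶ A).left) :
    val (𝟙 (tot M)) (𝟙 X.left) h = 𝟙 _ :=
  valueAt_mateId_id M.functor X h

theorem val_globIso {A B : Over I} {M N : PolyOver T A B} (e : M.functor ≅ N.functor)
    (H : ∀ (X : Over A.left) (Z : Over I) (k : X.left ⟶ Z.left) (h : k ≫ Z.hom = X.hom ≫ A.hom),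
      (e.hom.app X).left ≫ valueAt N.toP k h = valueAt M.toP k h) (X : Over A.left)
    (h : 𝟙 X.left ≫ X.hom = X.hom ≫ (𝟙 A : A ⟶ A).left) :
    val (globIso e H).hom (𝟙 X.left) h = (e.hom.app X).left :=
  valueAt_mateOfNat_id e.hom X h

theorem val_hidSq (hT : IsPolynomialMonad T) {A B : Over I} (f : A ⟶ B) {X : Over A.left}
    {Y : Over B.left} (g : X.left ⟶ Y.left) (h : g ≫ Y.hom = X.hom ≫ f.left) :
    val (hidSq hT f) g h = g :=
  valueAt_hidNat f.left g h

theorem val_congr {A B A' B' : Over I} {M : PolyOver T A B} {M' : PolyOver T A' B'}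
    (α : tot M ⟶ tot M') {X : Over A.left} {Y : Over A'.left} {g g' : X.left ⟶ Y.left}
    (e : g = g')
    (h : g ≫ Y.hom = X.hom ≫ (PolyOverSq.left (M := tot M) (N := tot M') α).left)
    (h' : g' ≫ Y.hom = X.hom ≫ (PolyOverSq.left (M := tot M) (N := tot M') α).left) :
    val α g h = val α g' h' := by
  subst e
  rfl

theorem val_id_eq {A B : Over I} (M : PolyOver T A B) {X Y : Over A.left} (f : X ⟶ Y)
    (h : f.left ≫ Y.hom = X.hom ≫ (𝟙 A : A ⟶ A).left) :
    val (𝟙 (tot M)) f.left h = (M.functor.map f).left :=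
  valueAt_mateId M.functor f.left h

theorem val_id' {A B : Over I} (M : PolyOver T A B) (X : Over A.left) {g : X.left ⟶ X.left}
    (e : g = 𝟙 _) (h : g ≫ X.hom = X.hom ≫ (𝟙 A : A ⟶ A).left) :
    val (𝟙 (tot M)) g h = 𝟙 _ := by
  subst e
  exact val_id M X h

/-- Two squares with identity source are equal as soon as their values at identities are. -/
theorem glob_ext {A B C : Over I} {M : PolyOver T A B} {N : PolyOver T A C} {α β : tot M ⟶ tot N}
    (h₁ : PolyOverSq.left α = 𝟙 A) (h₁' : PolyOverSq.left β = 𝟙 A)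
    (h₂ : PolyOverSq.right α = PolyOverSq.right β)
    (h₃ : ∀ (X : Over A.left)
      (h : 𝟙 X.left ≫ X.hom = X.hom ≫ (PolyOverSq.left (M := tot M) (N := tot N) α).left)
      (h' : 𝟙 X.left ≫ X.hom = X.hom ≫ (PolyOverSq.left (M := tot M) (N := tot N) β).left),
      val α (𝟙 X.left) h = val β (𝟙 X.left) h') : α = β := by
  refine val_ext (h₁.trans h₁'.symm) h₂ fun X Y g h h' => ?_
  have w₁ : 𝟙 X.left ≫ X.hom = X.hom ≫ (PolyOverSq.left (M := tot M) (N := tot N) α).left := by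
    rw [h₁]
    exact (Category.id_comp _).trans (Category.comp_id _).symm
  have w₂ : 𝟙 X.left ≫ X.hom = X.hom ≫ (PolyOverSq.left (M := tot M) (N := tot N) β).left := by
    rw [h₁']
    exact (Category.id_comp _).trans (Category.comp_id _).symm
  have w₃ : g ≫ Y.hom = X.hom := by
    rw [h, h₁]
    exact Category.comp_id _
  have e₁ := valueAt_comp (PolyOverSq.nat α) (𝟙 X.left) w₁ (Over.homMk g w₃)
    ((congrArg (· ≫ Y.hom) (Category.id_comp g)).trans h)
  have e₂ := valueAt_comp (PolyOverSq.nat β) (𝟙 X.left) w₂ (Over.homMk g w₃)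
    ((congrArg (· ≫ Y.hom) (Category.id_comp g)).trans h')
  have e₃ := h₃ X w₁ w₂
  refine (val_congr α (Category.id_comp g).symm h _).trans (e₁.symm.trans ?_)
  refine Eq.trans ?_ (e₂.trans (val_congr β (Category.id_comp g) _ h'))
  exact congrArg (fun t => t ≫ _) e₃

end Values

section Laws

variable (hT : IsPolynomialMonad T)

theorem hidSq_id (A : Over I) : hidSq hT (𝟙 A) = 𝟙 (tot (hid hT A)) :=
  val_ext rfl rfl fun _ _ g h h' =>
    (val_hidSq hT (𝟙 A) g h).trans (valueAt_mateId (𝟭 (Over A.left)) g h').symm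

theorem hidSq_comp {A B C : Over I} (f : A ⟶ B) (f' : B ⟶ C) :
    hidSq hT (f ≫ f') = hidSq hT f ≫ hidSq hT f' :=
  val_ext rfl rfl fun X Y g h h' => by
    refine (val_hidSq hT (f ≫ f') g h).trans ?_
    refine Eq.trans ?_ (valueAt_mateVComp' (hidNat f.left) (hidNat f'.left) g h').symm
    refine Eq.trans ?_ (congrArg₂ (· ≫ ·) (valueAt_hidNat _ _ _) (valueAt_hidNat _ _ _)).symm
    exact (Category.id_comp g).symm

theorem hcompSq_id {A B C : Over I} (M : PolyOver T A B) (N : PolyOver T B C)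
    (h : PolyOverSq.right (𝟙 (tot M)) = PolyOverSq.left (𝟙 (tot N))) :
    hcompSq hT (𝟙 (tot M)) (𝟙 (tot N)) h = 𝟙 (tot (hcomp hT M N)) :=
  glob_ext rfl rfl rfl fun X h₁ h₂ =>
    (val_hcompSq hT _ _ h (𝟙 X.left) h₁).trans
      ((val_id' N (M.functor.obj X) (val_id M X h₁) _).trans (val_id (hcomp hT M N) X h₂).symm)

theorem hcompSq_comp {A B C A' B' C' A'' B'' C'' : Over I} {M : PolyOver T A B}
    {N : PolyOver T B C} {M' : PolyOver T A' B'} {N' : PolyOver T B' C'} {M'' : PolyOver T A'' B''}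
    {N'' : PolyOver T B'' C''}
    (α : tot M ⟶ tot M') (β : tot N ⟶ tot N') (h : PolyOverSq.right α = PolyOverSq.left β)
    (α' : tot M' ⟶ tot M'') (β' : tot N' ⟶ tot N'')
    (h' : PolyOverSq.right α' = PolyOverSq.left β')
    (h'' : PolyOverSq.right (α ≫ α') = PolyOverSq.left (β ≫ β')) :
    hcompSq hT (α ≫ α') (β ≫ β') h'' = hcompSq hT α β h ≫ hcompSq hT α' β' h' :=
  val_ext rfl rfl fun X Y g k k' => by
    have w : 𝟙 X.left ≫ (Over.mk (X.hom ≫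
        (PolyOverSq.left (M := tot M) (N := tot M') α).left)).hom =
        X.hom ≫ (PolyOverSq.left (M := tot M) (N := tot M') α).left := Category.id_comp _
    have w' : g ≫ Y.hom = (Over.mk (X.hom ≫
        (PolyOverSq.left (M := tot M) (N := tot M') α).left)).hom ≫
        (PolyOverSq.left (M := tot M') (N := tot M'') α').left :=
      k.trans (Category.assoc _ _ _).symm
    have w'' : (𝟙 X.left ≫ g) ≫ Y.hom = X.hom ≫
        (PolyOverSq.left (M := tot M) (N := tot M'') (α ≫ α')).left :=
      (congrArg (· ≫ Y.hom) (Category.id_comp g)).trans k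
    refine (val_hcompSq hT _ _ h'' g k).trans ?_
    refine (val_congr (β ≫ β') ((val_congr (α ≫ α') (Category.id_comp g).symm k w'').trans
      (val_comp α α' (Y := Over.mk (X.hom ≫
        (PolyOverSq.left (M := tot M) (N := tot M') α).left)) (𝟙 X.left) g w w' w'')) _
        (val_comp_w α α' _ _ w w' β β' h h')).trans ?_
    refine (val_comp β β' _ _ (val_w α _ w β h) (val_w α' _ w' β' h') _).trans ?_
    refine (congrArg₂ (· ≫ ·) (val_hcompSq hT α β h (𝟙 X.left) w).symm
      (val_hcompSq hT α' β' h' (X := Over.mk (X.hom ≫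
        (PolyOverSq.left (M := tot M) (N := tot M') α).left)) g w').symm).trans ?_
    refine (val_comp (hcompSq hT α β h) (hcompSq hT α' β' h') (Y := Over.mk (X.hom ≫
        (PolyOverSq.left (M := tot M) (N := tot M') α).left)) (𝟙 X.left) g w w' w'').symm.trans ?_
    exact val_congr (hcompSq hT α β h ≫ hcompSq hT α' β' h') (Category.id_comp g) w'' k'

theorem val_assoc {A B C D : Over I} (M : PolyOver T A B) (N : PolyOver T B C)
    (K : PolyOver T C D) (X : Over A.left)
    (h : 𝟙 X.left ≫ X.hom = X.hom ≫ (𝟙 A : A ⟶ A).left) :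
    val (assocIso hT M N K).hom (𝟙 X.left) h = 𝟙 _ :=
  val_globIso (M := hcomp hT (hcomp hT M N) K) (N := hcomp hT M (hcomp hT N K)) _ _ X h

theorem val_lunit {A B : Over I} (M : PolyOver T A B) (X : Over A.left)
    (h : 𝟙 X.left ≫ X.hom = X.hom ≫ (𝟙 A : A ⟶ A).left) :
    val (lunitIso hT M).hom (𝟙 X.left) h = 𝟙 _ :=
  val_globIso (M := hcomp hT (hid hT A) M) (N := M) _ _ X h

theorem val_runit {A B : Over I} (M : PolyOver T A B) (X : Over A.left)
    (h : 𝟙 X.left ≫ X.hom = X.hom ≫ (𝟙 A : A ⟶ A).left) :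
    val (runitIso hT M).hom (𝟙 X.left) h = 𝟙 _ :=
  val_globIso (M := hcomp hT M (hid hT B)) (N := M) _ _ X h

theorem assoc_naturality {A B C D A' B' C' D' : Over I} {M : PolyOver T A B} {N : PolyOver T B C}
    {K : PolyOver T C D} {M' : PolyOver T A' B'} {N' : PolyOver T B' C'} {K' : PolyOver T C' D'}
    (α : tot M ⟶ tot M') (β : tot N ⟶ tot N') (γ : tot K ⟶ tot K')
    (h₁ : PolyOverSq.right α = PolyOverSq.left β) (h₂ : PolyOverSq.right β = PolyOverSq.left γ)
    (h₃ : PolyOverSq.right (hcompSq hT α β h₁) = PolyOverSq.left γ)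
    (h₄ : PolyOverSq.right α = PolyOverSq.left (hcompSq hT β γ h₂)) :
    hcompSq hT (hcompSq hT α β h₁) γ h₃ ≫ (assocIso hT M' N' K').hom =
      (assocIso hT M N K).hom ≫ hcompSq hT α (hcompSq hT β γ h₂) h₄ :=
  val_ext ((Category.comp_id (PolyOverSq.left (M := tot M) (N := tot M') α)).trans
      (Category.id_comp _).symm)
    ((Category.comp_id (PolyOverSq.right (M := tot K) (N := tot K') γ)).trans
      (Category.id_comp _).symm) fun X Y g k k' => by
    have w : g ≫ Y.hom = X.hom ≫ (PolyOverSq.left (M := tot M) (N := tot M') α).left :=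
      k.trans (congrArg (fun t : A ⟶ A' => X.hom ≫ t.left) (Category.comp_id _))
    refine (val_comp_glob (hcompSq hT (hcompSq hT α β h₁) γ h₃) (assocIso hT M' N' K').hom
      g w (glob_w Y) k).trans ?_
    refine Eq.trans ?_ (val_glob_comp (assocIso hT M N K).hom
      (hcompSq hT α (hcompSq hT β γ h₂) h₄) g (glob_w X) w k').symm
    refine (congrArg (_ ≫ ·) (val_assoc hT M' N' K' Y (glob_w Y))).trans ((Category.comp_id _).trans ?_)
    refine Eq.trans ?_ ((congrArg (· ≫ _) (val_assoc hT M N K X (glob_w X))).trans (Category.id_comp _)).symm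
    refine (val_hcompSq hT (hcompSq hT α β h₁) γ h₃ g w).trans ?_
    refine Eq.trans ?_ (val_hcompSq hT α (hcompSq hT β γ h₂) h₄ g w).symm
    refine Eq.trans ?_ (val_hcompSq hT β γ h₂ (val α g w) (val_w α g w β h₁)).symm
    exact val_congr γ (val_hcompSq hT α β h₁ g w) _ _

theorem lunit_naturality {A B A' B' : Over I} {M : PolyOver T A B} {M' : PolyOver T A' B'}
    (α : tot M ⟶ tot M')
    (h : PolyOverSq.right (hidSq hT (PolyOverSq.left (M := tot M) (N := tot M') α)) =
      PolyOverSq.left (M := tot M) (N := tot M') α) :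
    hcompSq hT (hidSq hT (PolyOverSq.left (M := tot M) (N := tot M') α)) α h ≫
      (lunitIso hT M').hom = (lunitIso hT M).hom ≫ α :=
  val_ext ((Category.comp_id (PolyOverSq.left (M := tot M) (N := tot M') α)).trans
      (Category.id_comp _).symm)
    ((Category.comp_id (PolyOverSq.right (M := tot M) (N := tot M') α)).trans
      (Category.id_comp _).symm) fun X Y g k k' => by
    have w : g ≫ Y.hom = X.hom ≫ (PolyOverSq.left (M := tot M) (N := tot M') α).left :=
      k.trans (congrArg (fun t : A ⟶ A' => X.hom ≫ t.left) (Category.comp_id _))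
    refine (val_comp_glob (hcompSq hT _ α h) (lunitIso hT M').hom g w (glob_w Y) k).trans ?_
    refine Eq.trans ?_ (val_glob_comp (lunitIso hT M).hom α g (glob_w X) w k').symm
    refine (congrArg (_ ≫ ·) (val_lunit hT M' Y (glob_w Y))).trans ((Category.comp_id _).trans ?_)
    refine Eq.trans ?_ ((congrArg (· ≫ _) (val_lunit hT M X (glob_w X))).trans
      (Category.id_comp _)).symm
    refine (val_hcompSq hT _ α h g w).trans ?_
    exact val_congr α (val_hidSq hT _ g w) _ _

theorem runit_naturality {A B A' B' : Over I} {M : PolyOver T A B} {M' : PolyOver T A' B'}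
    (α : tot M ⟶ tot M')
    (h : PolyOverSq.right (M := tot M) (N := tot M') α =
      PolyOverSq.left (hidSq hT (PolyOverSq.right (M := tot M) (N := tot M') α))) :
    hcompSq hT α (hidSq hT (PolyOverSq.right (M := tot M) (N := tot M') α)) h ≫
      (runitIso hT M').hom = (runitIso hT M).hom ≫ α :=
  val_ext ((Category.comp_id (PolyOverSq.left (M := tot M) (N := tot M') α)).trans
      (Category.id_comp _).symm)
    ((Category.comp_id (PolyOverSq.right (M := tot M) (N := tot M') α)).trans
      (Category.id_comp _).symm) fun X Y g k k' => by
    have w : g ≫ Y.hom = X.hom ≫ (PolyOverSq.left (M := tot M) (N := tot M') α).left :=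
      k.trans (congrArg (fun t : A ⟶ A' => X.hom ≫ t.left) (Category.comp_id _))
    refine (val_comp_glob (hcompSq hT α _ h) (runitIso hT M').hom g w (glob_w Y) k).trans ?_
    refine Eq.trans ?_ (val_glob_comp (runitIso hT M).hom α g (glob_w X) w k').symm
    refine (congrArg (_ ≫ ·) (val_runit hT M' Y (glob_w Y))).trans ((Category.comp_id _).trans ?_)
    refine Eq.trans ?_ ((congrArg (· ≫ _) (val_runit hT M X (glob_w X))).trans
      (Category.id_comp _)).symm
    exact (val_hcompSq hT α _ h g w).trans (val_hidSq hT _ _ _)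

theorem pentagon {A B C D F : Over I} (M : PolyOver T A B) (N : PolyOver T B C)
    (K : PolyOver T C D) (L : PolyOver T D F)
    (h₁ : PolyOverSq.right (assocIso hT M N K).hom = PolyOverSq.left (𝟙 (tot L)))
    (h₂ : PolyOverSq.right (𝟙 (tot M)) = PolyOverSq.left (assocIso hT N K L).hom) :
    hcompSq hT (assocIso hT M N K).hom (𝟙 (tot L)) h₁ ≫ (assocIso hT M (hcomp hT N K) L).hom ≫
        hcompSq hT (𝟙 (tot M)) (assocIso hT N K L).hom h₂ =
      (assocIso hT (hcomp hT M N) K L).hom ≫ (assocIso hT M N (hcomp hT K L)).hom := by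
  have w₂ : PolyOverSq.left ((assocIso hT M (hcomp hT N K) L).hom ≫
        hcompSq hT (𝟙 (tot M)) (assocIso hT N K L).hom h₂) = 𝟙 A := Category.id_comp (𝟙 A)
  have w₁ : PolyOverSq.left (hcompSq hT (assocIso hT M N K).hom (𝟙 (tot L)) h₁ ≫
      (assocIso hT M (hcomp hT N K) L).hom ≫
        hcompSq hT (𝟙 (tot M)) (assocIso hT N K L).hom h₂) = 𝟙 A :=
    (Category.id_comp (𝟙 A ≫ 𝟙 A)).trans (Category.id_comp (𝟙 A))
  refine glob_ext w₁ (Category.id_comp (𝟙 A)) (Category.id_comp (𝟙 F ≫ 𝟙 F)) fun X k k' => ?_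
  have g := glob_w X
  have k'' : 𝟙 X.left ≫ X.hom = X.hom ≫ (𝟙 A ≫ 𝟙 A : A ⟶ A).left :=
    k'
  refine (val_glob_comp (hcompSq hT (assocIso hT M N K).hom (𝟙 (tot L)) h₁) _ _ g k'' k).trans ?_
  refine Eq.trans ?_ (val_glob_comp (assocIso hT (hcomp hT M N) K L).hom _ _ g g k').symm
  have e₁ : val (hcompSq hT (assocIso hT M N K).hom (𝟙 (tot L)) h₁) (𝟙 X.left) g = 𝟙 _ :=
    (val_hcompSq hT _ _ h₁ _ g).trans (val_id' L _ (val_assoc hT M N K X g) _)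
  have e₂ : val (hcompSq hT (𝟙 (tot M)) (assocIso hT N K L).hom h₂) (𝟙 X.left) g = 𝟙 _ :=
    (val_hcompSq hT _ _ h₂ _ g).trans ((val_congr (assocIso hT N K L).hom (val_id M X g) _
      (glob_w _)).trans (val_assoc hT N K L (M.functor.obj X) (glob_w _)))
  have e₃ := (val_glob_comp (assocIso hT M (hcomp hT N K) L).hom
    (hcompSq hT (𝟙 (tot M)) (assocIso hT N K L).hom h₂) (𝟙 X.left) g g k'')
  refine (congrArg₂ (· ≫ ·) e₁ (e₃.trans (congrArg₂ (· ≫ ·)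
    (val_assoc hT M (hcomp hT N K) L X g) e₂))).trans ?_
  refine Eq.trans ?_ (congrArg₂ (· ≫ ·) (val_assoc hT (hcomp hT M N) K L X g)
    (val_assoc hT M N (hcomp hT K L) X g)).symm
  exact Category.id_comp _

theorem triangle {A B C : Over I} (M : PolyOver T A B) (N : PolyOver T B C)
    (h₁ : PolyOverSq.right (runitIso hT M).hom = PolyOverSq.left (𝟙 (tot N)))
    (h₂ : PolyOverSq.right (𝟙 (tot M)) = PolyOverSq.left (lunitIso hT N).hom) :
    (assocIso hT M (hid hT B) N).hom ≫ hcompSq hT (𝟙 (tot M)) (lunitIso hT N).hom h₂ =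
      hcompSq hT (runitIso hT M).hom (𝟙 (tot N)) h₁ := by
  refine glob_ext (Category.id_comp (𝟙 A)) rfl (Category.id_comp (𝟙 C)) fun X k k' => ?_
  have g := glob_w X
  refine (val_glob_comp (assocIso hT M (hid hT B) N).hom _ _ g g k).trans ?_
  have e₂ : val (hcompSq hT (𝟙 (tot M)) (lunitIso hT N).hom h₂) (𝟙 X.left) g = 𝟙 _ :=
    (val_hcompSq hT _ _ h₂ _ g).trans ((val_congr (lunitIso hT N).hom (val_id M X g) _
      (glob_w _)).trans (val_lunit hT N (M.functor.obj X) (glob_w _)))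
  have e₁ : val (hcompSq hT (runitIso hT M).hom (𝟙 (tot N)) h₁) (𝟙 X.left) g = 𝟙 _ :=
    (val_hcompSq hT _ _ h₁ _ g).trans (val_id' N _ (val_runit hT M X g) _)
  refine (congrArg₂ (· ≫ ·) (val_assoc hT M (hid hT B) N X g) e₂).trans ?_
  exact (Category.id_comp _).trans e₁.symm

end Laws

end PolyOver

/-- The double category of polynomials cartesian over a polynomial monad `T` on `E/I`: objects and
vertical arrows are those of `E/I`, horizontal arrows from `D` to `C` are polynomial functors
`E/D ⥤ E/C` with a cartesian transformation to `T`, squares are cartesian transformations over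
`T`. Horizontal composition is composition of functors, with the structure transformation composed
with the multiplication of `T`. -/
def polyDouble {T : Monad (Over I)} (hT : IsPolynomialMonad T) : DoubleCat where
  Obj := Over I
  Hor := PolyOver T
  left α := PolyOverSq.left α
  right α := PolyOverSq.right α
  left_id _ := rfl
  right_id _ := rfl
  left_comp _ _ := rfl
  right_comp _ _ := rfl
  hid A := PolyOver.hid hT A
  hidSq f := PolyOver.hidSq hT f
  left_hidSq _ := rfl
  right_hidSq _ := rfl
  hidSq_id A := PolyOver.hidSq_id hT A
  hidSq_comp f f' := PolyOver.hidSq_comp hT f f'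
  hcomp M N := PolyOver.hcomp hT M N
  hcompSq α β h := PolyOver.hcompSq hT α β h
  left_hcompSq _ _ _ := rfl
  right_hcompSq _ _ _ := rfl
  hcompSq_id M N h := PolyOver.hcompSq_id hT M N h
  hcompSq_comp α β h α' β' h' h'' := PolyOver.hcompSq_comp hT α β h α' β' h' h''
  assoc M N K := PolyOver.assocIso hT M N K
  lunit M := PolyOver.lunitIso hT M
  runit M := PolyOver.runitIso hT M
  left_assoc _ _ _ := rfl
  right_assoc _ _ _ := rfl
  left_lunit _ := rfl
  right_lunit _ := rfl
  left_runit _ := rfl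
  right_runit _ := rfl
  assoc_naturality α β γ h₁ h₂ h₃ h₄ := PolyOver.assoc_naturality hT α β γ h₁ h₂ h₃ h₄
  lunit_naturality α h := PolyOver.lunit_naturality hT α h
  runit_naturality α h := PolyOver.runit_naturality hT α h
  pentagon M N K L h₁ h₂ := PolyOver.pentagon hT M N K L h₁ h₂
  triangle M N h₁ h₂ := PolyOver.triangle hT M N h₁ h₂

end PolyOver

/-! ## Extension of spans to polynomials over a polynomial monad -/

section PolyExt

variable {E : Type u} [Category.{v} E] {I : E}

/-- The identification of `(E/I)/C ⥤ E/C ⥤ E/I` with the forgetful functor. -/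
def forwardMapIso (C : Over I) :
    Over.iteratedSliceForward C ⋙ Over.map C.hom ≅ Over.forget C :=
  NatIso.ofComponents (fun X => Over.isoMk (Iso.refl X.left.left)
    ((Category.id_comp _).trans (Over.w X.hom).symm))
    (fun _ => Over.OverMorphism.ext ((Category.comp_id _).trans (Category.id_comp _).symm))

/-- The comparison of composites of dependent sums. -/
def mapMapIso {D D' : Over I} (l : D ⟶ D') :
    Over.map D.hom ≅ Over.map l.left ⋙ Over.map D'.hom :=
  NatIso.ofComponents (fun X => Over.isoMk (Iso.refl _))

variable [HasPullbacks E] {T : Monad (Over I)}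

/-- The extension of a `T`-span from `D` to `C`, as a functor `E/D ⥤ E/C`: it is the composite
`c_! d^* T_{/D}`, under the identifications of the slices of `E/I` with slices of `E`. -/
noncomputable def polyExtFunctor {D C : Over I} (M : PSpan T.toFunctor D C) :
    Over D.left ⥤ Over C.left :=
  Over.iteratedSliceBackward D ⋙ extFunctor M ⋙ Over.iteratedSliceForward C

/-- The structure map of the extension. -/
noncomputable def polyExtToP {D C : Over I} (M : PSpan T.toFunctor D C) :
    polyExtFunctor M ⋙ Over.map C.hom ⟶ Over.map D.hom ⋙ T.toFunctor :=
  Functor.whiskerLeft (Over.iteratedSliceBackward D ⋙ extFunctor M) (forwardMapIso C).hom ≫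
    Functor.whiskerLeft (Over.iteratedSliceBackward D) (extToP M)

theorem polyExtToP_cart {D C : Over I} (M : PSpan T.toFunctor D C) :
    NatTrans.Equifibered (polyExtToP M) :=
  have h : NatTrans.Equifibered
    (Functor.whiskerLeft (Over.iteratedSliceBackward D ⋙ extFunctor M) (forwardMapIso C).hom) :=
    .of_isIso _
  NatTrans.Equifibered.comp h ((extToP_cart M).whiskerLeft _)

theorem valueAt_polyExtToP {D C : Over I} (M : PSpan T.toFunctor D C) {X : Over D.left}
    {Y : Over I} (g : X.left ⟶ Y.left) (h : g ≫ Y.hom = X.hom ≫ D.hom) :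
    valueAt (polyExtToP M) g h =
      (extFst M ((Over.iteratedSliceBackward D).obj X)).left ≫
        (T.map (Over.homMk g h : (Over.map D.hom).obj X ⟶ Y)).left := by
  refine congrArg (· ≫ _) ?_
  exact Category.id_comp _

section Square

variable {D C D' C' : Over I} {M : PSpan T.toFunctor D C} {N : PSpan T.toFunctor D' C'}
  (α : tot M ⟶ tot N)

/-- A map over `l : D ⟶ D'` in `E/I`, as a map in `E/I`. -/
abbrev sliceMap {l : D ⟶ D'} {X : Over D.left} {Y : Over D'.left} (g : X.left ⟶ Y.left)
    (h : g ≫ Y.hom = X.hom ≫ l.left) :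
    ((Over.iteratedSliceBackward D).obj X).left ⟶ ((Over.iteratedSliceBackward D').obj Y).left :=
  Over.homMk g (by
    have e := Over.w l
    change g ≫ Y.hom ≫ D'.hom = X.hom ≫ D.hom
    rw [← e, ← Category.assoc, h, Category.assoc])

theorem sliceMap_w {l : D ⟶ D'} {X : Over D.left} {Y : Over D'.left} (g : X.left ⟶ Y.left)
    (h : g ≫ Y.hom = X.hom ≫ l.left) :
    sliceMap g h ≫ ((Over.iteratedSliceBackward D').obj Y).hom =
      ((Over.iteratedSliceBackward D).obj X).hom ≫ l :=
  Over.OverMorphism.ext h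

/-- The map between extensions induced by a morphism of spans. -/
noncomputable def polyExtMap {X : Over D.left} {Y : Over D'.left} (g : X.left ⟶ Y.left)
    (h : g ≫ Y.hom = X.hom ≫ (PSpanSq.left (M := tot M) (N := tot N) α).left) :
    ((polyExtFunctor M).obj X).left ⟶ ((polyExtFunctor N).obj Y).left :=
  (extMap α (sliceMap g h) (sliceMap_w g h)).left

theorem polyExtMap_w {X : Over D.left} {Y : Over D'.left} (g : X.left ⟶ Y.left)
    (h : g ≫ Y.hom = X.hom ≫ (PSpanSq.left (M := tot M) (N := tot N) α).left) :
    polyExtMap α g h ≫ ((polyExtFunctor N).obj Y).hom =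
      ((polyExtFunctor M).obj X).hom ≫ (PSpanSq.right (M := tot M) (N := tot N) α).left :=
  congrArg (fun t => t.left) (extMap_w α (sliceMap g h) (sliceMap_w g h))

theorem comp_polyExtMap {W X : Over D.left} {Y : Over D'.left} (k : W ⟶ X)
    (g : X.left ⟶ Y.left)
    (h : g ≫ Y.hom = X.hom ≫ (PSpanSq.left (M := tot M) (N := tot N) α).left)
    (h' : (k.left ≫ g) ≫ Y.hom = W.hom ≫ (PSpanSq.left (M := tot M) (N := tot N) α).left) :
    ((polyExtFunctor M).map k).left ≫ polyExtMap α g h = polyExtMap α (k.left ≫ g) h' :=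
  congrArg (fun t => t.left) (comp_extMap α ((Over.iteratedSliceBackward D).map k) (sliceMap g h)
    (sliceMap_w g h) (sliceMap_w (k.left ≫ g) h'))

theorem polyExtMap_comp {X : Over D.left} {Y Z : Over D'.left} (g : X.left ⟶ Y.left)
    (h : g ≫ Y.hom = X.hom ≫ (PSpanSq.left (M := tot M) (N := tot N) α).left) (k : Y ⟶ Z)
    (h' : (g ≫ k.left) ≫ Z.hom = X.hom ≫ (PSpanSq.left (M := tot M) (N := tot N) α).left) :
    polyExtMap α g h ≫ ((polyExtFunctor N).map k).left = polyExtMap α (g ≫ k.left) h' :=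
  congrArg (fun t => t.left) (extMap_comp α (sliceMap g h) (sliceMap_w g h)
    ((Over.iteratedSliceBackward D').map k) (sliceMap_w (g ≫ k.left) h'))

/-- The transformation between extensions induced by a morphism of spans. -/
noncomputable def polyExtNat :
    polyExtFunctor M ⋙ Over.map (PSpanSq.right (M := tot M) (N := tot N) α).left ⟶
      Over.map (PSpanSq.left (M := tot M) (N := tot N) α).left ⋙ polyExtFunctor N where
  app X := Over.homMk (polyExtMap α
    (Y := (Over.map (PSpanSq.left (M := tot M) (N := tot N) α).left).obj X) (𝟙 X.left)
    (Category.id_comp _)) (polyExtMap_w α _ _)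
  naturality X Y f := by
    ext
    refine (comp_polyExtMap α f
      (Y := (Over.map (PSpanSq.left (M := tot M) (N := tot N) α).left).obj Y) (𝟙 Y.left)
      (Category.id_comp _) (by simp)).trans (Eq.symm ?_)
    refine (polyExtMap_comp α
      (Y := (Over.map (PSpanSq.left (M := tot M) (N := tot N) α).left).obj X) (𝟙 X.left)
      (Category.id_comp _) ((Over.map (PSpanSq.left (M := tot M) (N := tot N) α).left).map f)
      (by simp)).trans ?_
    congr 1
    exact (Category.id_comp _).trans (Category.comp_id _).symm

theorem valueAt_polyExtNat {X : Over D.left} {Y : Over D'.left} (g : X.left ⟶ Y.left)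
    (h : g ≫ Y.hom = X.hom ≫ (PSpanSq.left (M := tot M) (N := tot N) α).left) :
    valueAt (polyExtNat α) g h = polyExtMap α g h := by
  refine (polyExtMap_comp α
    (Y := (Over.map (PSpanSq.left (M := tot M) (N := tot N) α).left).obj X) (𝟙 X.left)
    (Category.id_comp _) (Over.homMk g h) (by simpa using h)).trans ?_
  congr 1
  exact Category.id_comp _

theorem polyExtMap_fst {X : Over D.left} {Y : Over D'.left} (g : X.left ⟶ Y.left)
    (h : g ≫ Y.hom = X.hom ≫ (PSpanSq.left (M := tot M) (N := tot N) α).left) :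
    polyExtMap α g h ≫ (extFst N ((Over.iteratedSliceBackward D').obj Y)).left =
      (extFst M ((Over.iteratedSliceBackward D).obj X)).left ≫ (T.map (sliceMap g h)).left :=
  congrArg (fun t => t.left) (extMap_fst α (sliceMap g h) (sliceMap_w g h))

theorem polyExtNat_comm {X : Over D.left} {Y : Over D'.left} {Z : Over I} (g : X.left ⟶ Y.left)
    (h : g ≫ Y.hom = X.hom ≫ (PSpanSq.left (M := tot M) (N := tot N) α).left)
    (k : Y.left ⟶ Z.left) (h' : k ≫ Z.hom = Y.hom ≫ D'.hom)
    (h'' : (g ≫ k) ≫ Z.hom = X.hom ≫ D.hom) :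
    valueAt (polyExtNat α) g h ≫ valueAt (polyExtToP N) k h' =
      valueAt (polyExtToP M) (g ≫ k) h'' := by
  have e : sliceMap g h ≫ (Over.homMk k h' : (Over.map D'.hom).obj Y ⟶ Z) =
    (Over.homMk (g ≫ k) h'' : (Over.map D.hom).obj X ⟶ Z) := Over.OverMorphism.ext rfl
  have e' := congrArg (fun t => (T.map t).left) e
  have e'' : (T.map (sliceMap g h)).left ≫
      (T.map (Over.homMk k h' : (Over.map D'.hom).obj Y ⟶ Z)).left =
      (T.map (Over.homMk (g ≫ k) h'' : (Over.map D.hom).obj X ⟶ Z)).left :=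
    (congrArg (fun t : T.obj _ ⟶ T.obj Z => t.left) (T.map_comp (sliceMap g h)
      (Over.homMk k h' : (Over.map D'.hom).obj Y ⟶ Z))).symm.trans e'
  refine (congrArg₂ (· ≫ ·) (valueAt_polyExtNat α g h) (valueAt_polyExtToP N k h')).trans ?_
  refine Eq.trans ?_ (valueAt_polyExtToP M (g ≫ k) h'').symm
  refine (Category.assoc _ _ _).symm.trans ((congrArg (· ≫ _) (polyExtMap_fst α g h)).trans ?_)
  exact (Category.assoc _ _ _).trans (congrArg _ e'')

end Square

theorem polyExtMap_id {D C : Over I} (M : PSpan T.toFunctor D C) {X Y : Over D.left}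
    (g : X.left ⟶ Y.left) (h : g ≫ Y.hom = X.hom ≫ 𝟙 D.left) :
    polyExtMap (𝟙 (tot M)) g h =
      ((polyExtFunctor M).map (Over.homMk g (by rw [h, Category.comp_id]) : X ⟶ Y)).left :=
  congrArg (fun t => t.left) (extMap_id M (sliceMap (l := 𝟙 D) g h) (sliceMap_w (l := 𝟙 D) g h))

theorem polyExtMap_vcomp {D C D' C' D'' C'' : Over I} {M : PSpan T.toFunctor D C}
    {N : PSpan T.toFunctor D' C'} {K : PSpan T.toFunctor D'' C''} (α : tot M ⟶ tot N)
    (β : tot N ⟶ tot K) {X : Over D.left} {Y : Over D'.left} {Z : Over D''.left}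
    (g : X.left ⟶ Y.left) (k : Y.left ⟶ Z.left)
    (h : g ≫ Y.hom = X.hom ≫ (PSpanSq.left (M := tot M) (N := tot N) α).left)
    (h' : k ≫ Z.hom = Y.hom ≫ (PSpanSq.left (M := tot N) (N := tot K) β).left)
    (h'' : (g ≫ k) ≫ Z.hom = X.hom ≫ (PSpanSq.left (M := tot M) (N := tot K) (α ≫ β)).left) :
    polyExtMap (α ≫ β) (g ≫ k) h'' = polyExtMap α g h ≫ polyExtMap β k h' :=
  congrArg (fun t => t.left) (extMap_vcomp α β (sliceMap g h) (sliceMap k h') (sliceMap_w g h)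
    (sliceMap_w k h') (sliceMap_w (g ≫ k) h''))

end PolyExt

section PolyExtDouble

variable {E : Type u} [Category.{v} E] {I : E} [HasPullbacks E] [LocallyCartesianClosed E] {T : Monad (Over I)}

/-- A transformation compatible with the structure transformations to `T` is cartesian. -/
theorem nat_cart_of_comm {M N : HorTotal (PolyOver T)} {l : M.src ⟶ N.src} {r : M.tgt ⟶ N.tgt}
    {n : M.hor.functor ⋙ Over.map r.left ⟶ Over.map l.left ⋙ N.hor.functor}
    (H : ∀ X : Over M.src.left,
    (n.app X).left ≫ (N.hor.toP.app ((Over.map l.left).obj X)).left =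
      (M.hor.toP.app X).left ≫ (T.map (Over.homMk (𝟙 X.left) (by simp) :
        (Over.map M.src.hom).obj X ⟶
          (Over.map N.src.hom).obj ((Over.map l.left).obj X))).left) :
    NatTrans.Equifibered n := by
  have h₁ : NatTrans.Equifibered (M.hor.toP ≫ Functor.whiskerRight (mapMapIso l).hom T.toFunctor) :=
    M.hor.toP_cart.comp (.of_isIso _)
  have h₂ := N.hor.toP_cart.whiskerLeft (Over.map l.left)
  refine equifibered_of_comp n (H := Over.map l.left ⋙ Over.map N.src.hom ⋙ T.toFunctor ⋙ Over.forget I)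
    (Functor.whiskerRight (M.hor.toP ≫ Functor.whiskerRight (mapMapIso l).hom T.toFunctor)
      (Over.forget I))
    (Functor.whiskerRight (Functor.whiskerLeft (Over.map l.left) N.hor.toP) (Over.forget I))
    (h₁.whiskerRight (Over.forget I)) (h₂.whiskerRight (Over.forget I)) H

/-- The extension of a `T`-span, as a polynomial cartesian over `T`. -/
noncomputable def polyExtObj (hT : IsPolynomialMonad T) {D C : Over I}
    (M : PSpan T.toFunctor D C) : PolyOver T D C where
  functor := polyExtFunctor M
  poly := isPolynomialFunctor_of_equifibered hT.poly (polyExtToP M) (polyExtToP_cart M)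
  toP := polyExtToP M
  toP_cart := polyExtToP_cart M

/-- The extension of a morphism of `T`-spans. -/
noncomputable def polyExtSq (hT : IsPolynomialMonad T) {D C D' C' : Over I}
    {M : PSpan T.toFunctor D C} {N : PSpan T.toFunctor D' C'} (α : tot M ⟶ tot N) :
    tot (polyExtObj hT M) ⟶ tot (polyExtObj hT N) :=
  have H := PolyOverSq.comm_of_valueAt (M := tot (polyExtObj hT M)) (N := tot (polyExtObj hT N))
      (r := PSpanSq.right (M := tot M) (N := tot N) α)
      (n := polyExtNat α) fun _ _ _ g h k h' => polyExtNat_comm α g h k h' _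
  PolyOverSq.mk (M := tot (polyExtObj hT M)) (N := tot (polyExtObj hT N))
    (PSpanSq.left (M := tot M) (N := tot N) α) (PSpanSq.right (M := tot M) (N := tot N) α)
    (polyExtNat α) (nat_cart_of_comm H) H

theorem polyExtSq_id (hT : IsPolynomialMonad T) {D C : Over I} (M : PSpan T.toFunctor D C) :
    polyExtSq hT (𝟙 (tot M)) = 𝟙 (tot (polyExtObj hT M)) :=
  PolyOver.val_ext rfl rfl fun _ _ g h h' =>
    ((valueAt_polyExtNat (𝟙 (tot M)) g h).trans (polyExtMap_id M g h)).trans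
      (valueAt_mateId _ g h').symm

theorem polyExtSq_comp (hT : IsPolynomialMonad T) {D C D' C' D'' C'' : Over I}
    {M : PSpan T.toFunctor D C} {N : PSpan T.toFunctor D' C'} {K : PSpan T.toFunctor D'' C''}
    (α : tot M ⟶ tot N) (β : tot N ⟶ tot K) :
    polyExtSq hT (α ≫ β) = polyExtSq hT α ≫ polyExtSq hT β :=
  PolyOver.val_ext rfl rfl fun X Z g h h' => by
    refine Eq.trans ?_ (valueAt_mateVComp' (polyExtNat α) (polyExtNat β) g h').symm
    refine Eq.trans ?_ (congrArg₂ (· ≫ ·) (valueAt_polyExtNat α _ _).symm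
      (valueAt_polyExtNat β _ _).symm)
    refine Eq.trans ?_ (polyExtMap_vcomp α β _ _ _ _
      ((congrArg (· ≫ Z.hom) (Category.id_comp g)).trans h))
    refine (valueAt_polyExtNat (α ≫ β) g h).trans ?_
    congr 1
    exact (Category.id_comp _).symm

/-- Extension, as a map from the double category of `T`-spans to the double category of
polynomials cartesian over `T`. -/
noncomputable def polyExt (hT : IsPolynomialMonad T) :
    DoubleMap (pspanDouble T hT.isCartesianMonad) (polyDouble hT) where
  vert := 𝟭 (Over I)
  hor M := polyExtObj hT M
  sq α := polyExtSq hT α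
  left_sq _ := rfl
  right_sq _ := rfl
  sq_id M := polyExtSq_id hT M
  sq_comp α β := polyExtSq_comp hT α β

end PolyExtDouble

section BeckChevalley

variable {E : Type u} [Category.{v} E] {I : E} [HasPullbacks E] {T : Monad (Over I)}

/-- The projection of the value of an extension to the apex of the span. -/
noncomputable def polyExtSnd {D C : Over I} (M : PSpan T.toFunctor D C) (X : Over D.left) :
    ((polyExtFunctor M).obj X).left ⟶ M.apex.left :=
  (extSnd M ((Over.iteratedSliceBackward D).obj X)).left

/-- The projection of the value of an extension to the value of the monad. -/
noncomputable def polyExtFst {D C : Over I} (M : PSpan T.toFunctor D C) (X : Over D.left) :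
    ((polyExtFunctor M).obj X).left ⟶ (T.obj ((Over.map D.hom).obj X)).left :=
  (extFst M ((Over.iteratedSliceBackward D).obj X)).left

/-- The projection of the value of an extension to the apex, as a map over `I`. -/
noncomputable def polyExtSndOver {D C : Over I} (M : PSpan T.toFunctor D C) (X : Over D.left) :
    (Over.map C.hom).obj ((polyExtFunctor M).obj X) ⟶ M.apex :=
  Over.homMk (polyExtSnd M X)
    (Over.w (extSnd M ((Over.iteratedSliceBackward D).obj X)) |>.trans (Over.w
      (((extFunctor M).obj ((Over.iteratedSliceBackward D).obj X)).hom)).symm)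

variable [LocallyCartesianClosed E]

/-- The comparison of the extension of a composite span with the composite of the extensions is the
Beck-Chevalley isomorphism: the extension of `(M, N)` at `X` sits over the pullback of
`T M ⟶ T C ⟵ N`, and both projections of the comparison are the canonical ones. -/
def IsBeckChevalley {hT : IsPolynomialMonad T} (S : PseudoStructure (polyExt hT)) : Prop :=
  ∀ {D C B : Over I} (M : PSpan T.toFunctor D C) (N : PSpan T.toFunctor C B) (X : Over D.left),
    let α : PolyOverSq (tot (PolyOver.hcomp hT (polyExtObj hT M) (polyExtObj hT N)))
      (tot (polyExtObj hT (PSpan.hcomp M N))) := (S.comp M N).hom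
    let v : ((polyExtFunctor N).obj ((polyExtFunctor M).obj X)).left ⟶
        ((polyExtFunctor (PSpan.hcomp M N)).obj ((Over.map α.left.left).obj X)).left :=
      (α.nat.app X).left
    v ≫ polyExtSnd (PSpan.hcomp M N) ((Over.map α.left.left).obj X) ≫ (PSpan.snd M N).left =
        polyExtSnd N ((polyExtFunctor M).obj X) ∧
      v ≫ polyExtSnd (PSpan.hcomp M N) ((Over.map α.left.left).obj X) ≫ (PSpan.fst M N).left =
        polyExtFst N ((polyExtFunctor M).obj X) ≫ (T.map (polyExtSndOver M X)).left

end BeckChevalley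

/-! ## Direct comparison of polynomials over a polynomial with spans -/

section Direct

/-- The category of `P`-spans with fixed endpoints. -/
instance pspanHomCategory {C : Type u} [Category.{v} C] (P : C ⥤ C) (A B : C) :
    Category (PSpan P A B) where
  Hom M N := { g : M.apex ⟶ N.apex // g ≫ N.dom = M.dom ∧ g ≫ N.cod = M.cod }
  id M := ⟨𝟙 _, Category.id_comp _, Category.id_comp _⟩
  comp g h := ⟨g.1 ≫ h.1, by rw [Category.assoc, h.2.1, g.2.1], by rw [Category.assoc, h.2.2, g.2.2]⟩

variable {E : Type u} [Category.{v} E] {I : E}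

/-- A polynomial from `D` to `C` over a polynomial `p` on `I`: a commutative diagram with rows
`D ⟵ M ⟶ N ⟶ C` and `I ⟵ B ⟶ A ⟶ I`, whose outer vertical maps are the structure maps of `D` and
`C`, and whose middle square is a pullback. -/
structure PolyDiagOver (p : Poly I I) (D C : Over I) where
  /-- the top row -/
  row : Poly D.left C.left
  /-- the vertical map `M ⟶ B` -/
  β : row.dom ⟶ p.dom
  /-- the vertical map `N ⟶ A` -/
  α : row.cod ⟶ p.cod
  s_comm : row.s ≫ D.hom = β ≫ p.s
  isPullback : IsPullback row.f β α p.f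
  t_comm : row.t ≫ C.hom = α ≫ p.t

/-- A morphism of polynomials over `p` with fixed endpoints: a cartesian morphism of diagrams
compatible with the vertical maps to `p`. -/
@[ext]
structure PolyDiagHom {p : Poly I I} {D C : Over I} (Q Q' : PolyDiagOver p D C) where
  /-- the map on domains of the middle maps -/
  dom : Q.row.dom ⟶ Q'.row.dom
  /-- the map on codomains of the middle maps -/
  cod : Q.row.cod ⟶ Q'.row.cod
  s_comm : dom ≫ Q'.row.s = Q.row.s
  isPullback : IsPullback Q.row.f dom cod Q'.row.f
  t_comm : cod ≫ Q'.row.t = Q.row.t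
  β_comm : dom ≫ Q'.β = Q.β
  α_comm : cod ≫ Q'.α = Q.α

/-- The hom category of polynomials from `D` to `C` over `p`. -/
instance polyDiagCategory (p : Poly I I) (D C : Over I) : Category (PolyDiagOver p D C) where
  Hom Q Q' := PolyDiagHom Q Q'
  id Q := ⟨𝟙 _, 𝟙 _, Category.id_comp _, IsPullback.of_vert_isIso ⟨by simp⟩, Category.id_comp _,
    Category.id_comp _, Category.id_comp _⟩
  comp φ ψ :=
    { dom := φ.dom ≫ ψ.dom
      cod := φ.cod ≫ ψ.cod
      s_comm := by rw [Category.assoc, ψ.s_comm, φ.s_comm]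
      isPullback := φ.isPullback.paste_vert ψ.isPullback
      t_comm := by rw [Category.assoc, ψ.t_comm, φ.t_comm]
      β_comm := by rw [Category.assoc, ψ.β_comm, φ.β_comm]
      α_comm := by rw [Category.assoc, ψ.α_comm, φ.α_comm] }
  id_comp φ := PolyDiagHom.ext (Category.id_comp _) (Category.id_comp _)
  comp_id φ := PolyDiagHom.ext (Category.comp_id _) (Category.comp_id _)
  assoc φ ψ χ := PolyDiagHom.ext (Category.assoc _ _ _) (Category.assoc _ _ _)

/-- A polynomial from `D` to `C` over `p`, regarded as a polynomial from `D` to `I` over `p`. -/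
def PolyDiagOver.toBase {p : Poly I I} {D C : Over I} (Q : PolyDiagOver p D C) :
    PolyDiagOver p D (Over.mk (𝟙 I)) where
  row := ⟨Q.row.dom, Q.row.cod, Q.row.s, Q.row.f, Q.row.t ≫ C.hom⟩
  β := Q.β
  α := Q.α
  s_comm := Q.s_comm
  isPullback := Q.isPullback
  t_comm := (Category.comp_id _).trans Q.t_comm

variable [HasPullbacks E] [LocallyCartesianClosed E] (p : Poly I I)

/-- The source lift of `p` along `D ⟶ I`, as a polynomial from `D` to `I` over `p`. The codomain of
its middle map is `Π_f s^* D`, its middle map is the pullback of `f`, and its left leg is the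
evaluation, given by the counit of `s_! f^* ⊣ Π_f s^*`. -/
noncomputable def sourceLift (D : Over I) : PolyDiagOver p D (Over.mk (𝟙 I)) where
  row :=
    { dom := pullback (p.core.obj D).hom p.f
      cod := (p.core.obj D).left
      s := (p.coreAdj.counit.app D).left
      f := pullback.fst _ _
      t := (p.core.obj D).hom ≫ p.t }
  β := pullback.snd _ _
  α := (p.core.obj D).hom
  s_comm := Over.w (p.coreAdj.counit.app D)
  isPullback := IsPullback.of_hasPullback _ _
  t_comm := Category.comp_id _

variable {p} {D C : Over I}

/-- The left leg of a polynomial over `p`, as a map out of `s_! f^* N`. -/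
noncomputable def PolyDiagOver.legMap (Q : PolyDiagOver p D C) : p.coreL.obj (Over.mk Q.α) ⟶ D :=
  Over.homMk (Q.isPullback.isoPullback.inv ≫ Q.row.s) (by
    rw [Category.assoc, Q.s_comm, ← Category.assoc, Q.isPullback.isoPullback_inv_snd]
    rfl)

/-- The map from `N` to `Π_f s^* D` corresponding to the left leg by adjunction. -/
noncomputable def PolyDiagOver.lift (Q : PolyDiagOver p D C) : Over.mk Q.α ⟶ p.core.obj D :=
  p.coreAdj.homEquiv (Over.mk Q.α) D Q.legMap

theorem PolyDiagHom.legMap_comm {Q Q' : PolyDiagOver p D C} (φ : PolyDiagHom Q Q') :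
    p.coreL.map (Over.homMk φ.cod φ.α_comm : Over.mk Q.α ⟶ Over.mk Q'.α) ≫ Q'.legMap =
      Q.legMap := by
  refine Over.OverMorphism.ext ?_
  have e : (p.coreL.map (Over.homMk φ.cod φ.α_comm : Over.mk Q.α ⟶ Over.mk Q'.α)).left ≫
      Q'.isPullback.isoPullback.inv = Q.isPullback.isoPullback.inv ≫ φ.dom := by
    refine Q'.isPullback.hom_ext ?_ ?_
    · refine (Category.assoc _ _ _).trans ((congrArg (_ ≫ ·)
        Q'.isPullback.isoPullback_inv_fst).trans ((pullback.lift_fst _ _ _).trans ?_))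
      rw [Category.assoc, ← φ.isPullback.w, ← Category.assoc, Q.isPullback.isoPullback_inv_fst]
      rfl
    · refine (Category.assoc _ _ _).trans ((congrArg (_ ≫ ·)
        Q'.isPullback.isoPullback_inv_snd).trans ((pullback.lift_snd _ _ _).trans ?_))
      rw [Category.assoc, φ.β_comm, Q.isPullback.isoPullback_inv_snd]
      rfl
  refine (Category.assoc _ _ _).symm.trans ((congrArg (· ≫ Q'.row.s) e).trans ?_)
  rw [Category.assoc, φ.s_comm]
  rfl

theorem PolyDiagHom.lift_comm {Q Q' : PolyDiagOver p D C} (φ : PolyDiagHom Q Q') :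
    φ.cod ≫ Q'.lift.left = Q.lift.left := by
  have h := p.coreAdj.homEquiv_naturality_left
    (Over.homMk φ.cod φ.α_comm : Over.mk Q.α ⟶ Over.mk Q'.α) Q'.legMap
  rw [φ.legMap_comm] at h
  exact (congrArg (fun t => t.left) h).symm

variable (p) {P : Over I ⥤ Over I} (e : P ≅ p.ext)

/-- The `P`-span read off from a polynomial over `p`, where `P` is represented by `p`: its apex is
`N`, its leg to `P D` is obtained from the lift of `N` to the source lift, and its leg to `C` is the
right leg. -/
noncomputable def readOffObj (Q : PolyDiagOver p D C) : PSpan P D C where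
  apex := Over.mk (Q.row.t ≫ C.hom)
  dom := (Over.homMk Q.lift.left (by
    refine Eq.trans ?_ Q.t_comm.symm
    exact (Category.assoc _ _ _).symm.trans (congrArg (· ≫ p.t) (Over.w Q.lift))) :
      Over.mk (Q.row.t ≫ C.hom) ⟶ p.ext.obj D) ≫ e.inv.app D
  cod := Over.homMk Q.row.t

variable (D C)

/-- Reading off spans from polynomials over `p`, as a functor between hom categories. -/
noncomputable def readOff : PolyDiagOver p D C ⥤ PSpan P D C where
  obj Q := readOffObj p e Q
  map φ := ⟨Over.homMk (PolyDiagHom.cod φ)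
      ((Category.assoc _ _ _).symm.trans (congrArg (· ≫ C.hom) (PolyDiagHom.t_comm φ))),
    (Category.assoc _ _ _).symm.trans (congrArg (· ≫ e.inv.app D)
      (Over.OverMorphism.ext (PolyDiagHom.lift_comm φ))),
    Over.OverMorphism.ext (PolyDiagHom.t_comm φ)⟩
  map_id _ := rfl
  map_comp _ _ := rfl

end Direct

end PolySpan

/-!
Everything rests on one observation: a cartesian transformation is determined by its component at
the terminal object of a slice. For a functor `Q` on `𝒞/D` with a cartesian transformation to `P`,
the value at `X` is the pullback of `Q 1 ⟶ P D ⟵ P X`, so `Q` is recovered from the span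
`P D ⟵ Q 1 ⟶ C`, and a morphism of such functors from its value at `1`. Conversely the extension of
a span has value at `1` the apex. This is `spanExt_isEquivalence`, and it is repeated relative to a
base `I` in `polyExtSq_injective`, `polyExtSq_surjective` and `PolyOver.spanIso`.

For a polynomial monad `T` on `E/I`, an `ExtPresentation` of a polynomial `Q` over `T` by a span `M`
consists of natural maps from the values of `Q` to the apex of `M`, exhibiting the structure
transformation of `Q` as a pullback of the left leg of `M`; it yields an invertible square from `Q`
to the extension of `M`. There are three of them. A composite of extensions is presented by the
composite span, by pasting the Beck-Chevalley square, the image under `T` of the pullback defining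
the first extension, and a naturality square of the multiplication
(`polyExtCompPresentation`). The identity polynomial is presented by the identity span since the
unit is cartesian (`polyExtHidPresentation`). Every polynomial is presented by its own span
(`PolyOver.toSpanPresentation`). The coherence laws of the comparisons are equalities of squares
into an extension. Such a square is determined by the projections of its values to the apex, as the
other projection is forced by compatibility with the transformations to `T`
(`ext_value_snd`, `ext_value_snd_glob`); each law thereby becomes an identity between maps
into the apex of a span.

The double category of spans is framed because spans restrict by pullback and extend by composition
(`pspanDouble_isFramed`). As extension is fully faithful on squares and essentially surjective on
horizontal arrows, the cartesian and opcartesian lifts transfer to polynomials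
(`polyDouble_isFramed`), and a quasi-inverse double functor is built by conjugation
(`InverseData.isFramedEquivalence`).

For the direct comparison, the middle map of a polynomial over `p` is a pullback of the middle map
of `p`, so the polynomial is given by the codomain `N` of its middle map, with its map to `A`, and
by its two legs. By the adjunction `s_! f^* ⊣ Π_f s^*` the left leg amounts to a map over `A` from
`N` to `Π_f s^* D`, the codomain of the middle map of the source lift. Hence the source lift is
terminal (`sourceLiftIsTerminal`), and what remains is exactly a span (`readOff_isEquivalence`).
-/

namespace PolySpan

universe u v w x u' v' w' x' u'' v'' w'' x''

/-! ### Inverting a double functor which is fully faithful on squares -/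

namespace DoubleCat

variable (D : DoubleCat.{u, v, w, x})

theorem left_inv_of_left_hom {M N : HorTotal D.Hor} (e : M ≅ N) (i : M.src ≅ N.src)
    (h : D.left e.hom = i.hom) : D.left e.inv = i.inv := by
  rw [← cancel_epi i.hom, ← h, ← D.left_comp, e.hom_inv_id, D.left_id, h, i.hom_inv_id]

theorem right_inv_of_right_hom {M N : HorTotal D.Hor} (e : M ≅ N) (i : M.tgt ≅ N.tgt)
    (h : D.right e.hom = i.hom) : D.right e.inv = i.inv := by
  rw [← cancel_epi i.hom, ← h, ← D.right_comp, e.hom_inv_id, D.right_id, h, i.hom_inv_id]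

variable {D}

theorem hcompSq_merge {A B C A' B' C' A'' B'' C'' : D.Obj} {M : D.Hor A B} {N : D.Hor B C}
    {M' : D.Hor A' B'} {N' : D.Hor B' C'} {M'' : D.Hor A'' B''} {N'' : D.Hor B'' C''}
    (α : tot M ⟶ tot M') (β : tot N ⟶ tot N') (h : D.right α = D.left β)
    (α' : tot M' ⟶ tot M'') (β' : tot N' ⟶ tot N'') (h' : D.right α' = D.left β') :
    D.hcompSq α β h ≫ D.hcompSq α' β' h' = D.hcompSq (α ≫ α') (β ≫ β')
      ((D.right_comp α α').trans ((congrArg₂ (· ≫ ·) h h').trans (D.left_comp β β').symm)) :=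
  (D.hcompSq_comp α β h α' β' h' _).symm

theorem hcompSq_merge_assoc {A B C A' B' C' A'' B'' C'' : D.Obj} {M : D.Hor A B} {N : D.Hor B C}
    {M' : D.Hor A' B'} {N' : D.Hor B' C'} {M'' : D.Hor A'' B''} {N'' : D.Hor B'' C''}
    (α : tot M ⟶ tot M') (β : tot N ⟶ tot N') (h : D.right α = D.left β)
    (α' : tot M' ⟶ tot M'') (β' : tot N' ⟶ tot N'') (h' : D.right α' = D.left β')
    {K : HorTotal D.Hor} (γ : tot (D.hcomp M'' N'') ⟶ K) :
    D.hcompSq α β h ≫ D.hcompSq α' β' h' ≫ γ = D.hcompSq (α ≫ α') (β ≫ β')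
      ((D.right_comp α α').trans ((congrArg₂ (· ≫ ·) h h').trans (D.left_comp β β').symm)) ≫ γ := by
  rw [← Category.assoc, hcompSq_merge]

theorem hcompSq_eq_id {A B C : D.Obj} {M : D.Hor A B} {N : D.Hor B C} {α : tot M ⟶ tot M}
    {β : tot N ⟶ tot N} (hα : α = 𝟙 _) (hβ : β = 𝟙 _) (h : D.right α = D.left β) :
    D.hcompSq α β h = 𝟙 _ := by
  subst hα hβ
  exact D.hcompSq_id M N h

/-- The horizontal composite of invertible squares. -/
def hcompIso {A B C A' B' C' : D.Obj} {M : D.Hor A B} {N : D.Hor B C} {M' : D.Hor A' B'}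
    {N' : D.Hor B' C'} (e : tot M ≅ tot M') (f : tot N ≅ tot N') (i : B ≅ B')
    (he : D.right e.hom = i.hom) (hf : D.left f.hom = i.hom) :
    tot (D.hcomp M N) ≅ tot (D.hcomp M' N') where
  hom := D.hcompSq e.hom f.hom (he.trans hf.symm)
  inv := D.hcompSq e.inv f.inv ((D.right_inv_of_right_hom e i he).trans
    (D.left_inv_of_left_hom f i hf).symm)
  hom_inv_id := (hcompSq_merge _ _ _ _ _ _).trans
    (hcompSq_eq_id e.hom_inv_id f.hom_inv_id _)
  inv_hom_id := (hcompSq_merge _ _ _ _ _ _).trans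
    (hcompSq_eq_id e.inv_hom_id f.inv_hom_id _)

/-- The horizontal identity square of an invertible vertical arrow is invertible. -/
def hidIso {A B : D.Obj} (i : A ≅ B) : tot (D.hid A) ≅ tot (D.hid B) where
  hom := D.hidSq i.hom
  inv := D.hidSq i.inv
  hom_inv_id := by rw [← D.hidSq_comp, i.hom_inv_id, D.hidSq_id]
  inv_hom_id := by rw [← D.hidSq_comp, i.inv_hom_id, D.hidSq_id]

end DoubleCat

open DoubleCat

/-- The data from which a quasi-inverse of a double functor `F` is built: `F` is fully faithful on
vertical arrows and on squares, and every object and every horizontal arrow of the target is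
isomorphic to one in the image of `F`, functorially on vertical arrows. -/
structure InverseData {C : DoubleCat.{u, v, w, x}} {D : DoubleCat.{u', v', w', x'}}
    (F : DoubleFunctor C D) where
  /-- the inverse on objects and vertical arrows -/
  vert : D.Obj ⥤ C.Obj
  /-- the comparison of objects -/
  counit : vert ⋙ F.toMap.vert ≅ 𝟭 D.Obj
  full : F.toMap.vert.Full
  faithful : F.toMap.vert.Faithful
  bijective : ∀ {A B A' B' : C.Obj} {M : C.Hor A B} {M' : C.Hor A' B'},
    Function.Bijective (fun α : tot M ⟶ tot M' => F.toMap.sq α)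
  /-- the inverse on horizontal arrows -/
  hor : ∀ {A B : D.Obj}, D.Hor A B → C.Hor (vert.obj A) (vert.obj B)
  /-- the comparison of horizontal arrows -/
  sq : ∀ {A B : D.Obj} (M : D.Hor A B), tot (F.toMap.hor (hor M)) ≅ tot M
  left_sq : ∀ {A B : D.Obj} (M : D.Hor A B), D.left (sq M).hom = counit.hom.app A
  right_sq : ∀ {A B : D.Obj} (M : D.Hor A B), D.right (sq M).hom = counit.hom.app B

namespace InverseData

variable {C : DoubleCat.{u, v, w, x}} {D : DoubleCat.{u', v', w', x'}} {F : DoubleFunctor C D}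
  (d : InverseData F)

theorem left_sq_inv {A B : D.Obj} (M : D.Hor A B) : D.left (d.sq M).inv = d.counit.inv.app A :=
  D.left_inv_of_left_hom (d.sq M) (d.counit.app A) (d.left_sq M)

theorem right_sq_inv {A B : D.Obj} (M : D.Hor A B) : D.right (d.sq M).inv = d.counit.inv.app B :=
  D.right_inv_of_right_hom (d.sq M) (d.counit.app B) (d.right_sq M)

theorem vert_injective (d : InverseData F) {X Y : C.Obj} {f g : X ⟶ Y}
    (h : F.toMap.vert.map f = F.toMap.vert.map g) : f = g :=
  have := d.faithful
  F.toMap.vert.map_injective h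

section Preimage

variable {A B A' B' A'' B'' : C.Obj} {M : C.Hor A B} {M' : C.Hor A' B'} {M'' : C.Hor A'' B''}

theorem sq_injective (d : InverseData F) {α β : tot M ⟶ tot M'}
    (h : F.toMap.sq α = F.toMap.sq β) : α = β :=
  d.bijective.1 h

/-- The square mapped by `F` to a given square. -/
noncomputable def preimage (β : tot (F.toMap.hor M) ⟶ tot (F.toMap.hor M')) : tot M ⟶ tot M' :=
  (d.bijective.2 β).choose

theorem sq_preimage (β : tot (F.toMap.hor M) ⟶ tot (F.toMap.hor M')) :
    F.toMap.sq (d.preimage β) = β :=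
  (d.bijective.2 β).choose_spec

theorem preimage_comp_eq_id (β : tot (F.toMap.hor M) ⟶ tot (F.toMap.hor M'))
    (γ : tot (F.toMap.hor M') ⟶ tot (F.toMap.hor M)) (h : β ≫ γ = 𝟙 _) :
    d.preimage β ≫ d.preimage γ = 𝟙 _ :=
  d.sq_injective (by rw [F.toMap.sq_comp, d.sq_preimage, d.sq_preimage, h, F.toMap.sq_id])

/-- The invertible square mapped by `F` to a given invertible square. -/
noncomputable def preimageIso (e : tot (F.toMap.hor M) ≅ tot (F.toMap.hor M')) :
    tot M ≅ tot M' where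
  hom := d.preimage e.hom
  inv := d.preimage e.inv
  hom_inv_id := d.preimage_comp_eq_id _ _ e.hom_inv_id
  inv_hom_id := d.preimage_comp_eq_id _ _ e.inv_hom_id

theorem sq_preimageIso (e : tot (F.toMap.hor M) ≅ tot (F.toMap.hor M')) :
    F.toMap.sq (d.preimageIso e).hom = e.hom := d.sq_preimage e.hom

theorem left_preimage (β : tot (F.toMap.hor M) ⟶ tot (F.toMap.hor M')) :
    F.toMap.vert.map (C.left (d.preimage β)) = D.left β := by
  rw [← F.toMap.left_sq, d.sq_preimage]

theorem right_preimage (β : tot (F.toMap.hor M) ⟶ tot (F.toMap.hor M')) :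
    F.toMap.vert.map (C.right (d.preimage β)) = D.right β := by
  rw [← F.toMap.right_sq, d.sq_preimage]

theorem left_preimageIso (e : tot (F.toMap.hor M) ≅ tot (F.toMap.hor M')) :
    F.toMap.vert.map (C.left (d.preimageIso e).hom) = D.left e.hom := d.left_preimage e.hom

theorem right_preimageIso (e : tot (F.toMap.hor M) ≅ tot (F.toMap.hor M')) :
    F.toMap.vert.map (C.right (d.preimageIso e).hom) = D.right e.hom := d.right_preimage e.hom

end Preimage

/-- The action of the quasi-inverse on squares: conjugation by the comparisons of horizontal
arrows. -/
noncomputable def mapSq {A B A' B' : D.Obj} {M : D.Hor A B} {M' : D.Hor A' B'}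
    (α : tot M ⟶ tot M') : tot (d.hor M) ⟶ tot (d.hor M') :=
  d.preimage ((d.sq M).hom ≫ α ≫ (d.sq M').inv)

theorem sq_mapSq {A B A' B' : D.Obj} {M : D.Hor A B} {M' : D.Hor A' B'} (α : tot M ⟶ tot M') :
    F.toMap.sq (d.mapSq α) = (d.sq M).hom ≫ α ≫ (d.sq M').inv := d.sq_preimage _

theorem sq_mapSq_comp {A B A' B' : D.Obj} {M : D.Hor A B} {M' : D.Hor A' B'}
    (α : tot M ⟶ tot M') : F.toMap.sq (d.mapSq α) ≫ (d.sq M').hom = (d.sq M).hom ≫ α := by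
  rw [sq_mapSq, Category.assoc, Category.assoc, Iso.inv_hom_id, Category.comp_id]

/-- The underlying data of the quasi-inverse. -/
noncomputable def toMap : DoubleMap D C where
  vert := d.vert
  hor M := d.hor M
  sq α := d.mapSq α
  left_sq {A B A' B' M M'} α := d.vert_injective (by
    have h := d.counit.hom.naturality (D.left α)
    rw [← F.toMap.left_sq, sq_mapSq, D.left_comp, D.left_comp, d.left_sq, d.left_sq_inv,
      ← Category.assoc]
    exact (congrArg (· ≫ _) h.symm).trans ((Category.assoc _ _ _).trans
      ((congrArg _ (d.counit.hom_inv_id_app A')).trans (Category.comp_id _))))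
  right_sq {A B A' B' M M'} α := d.vert_injective (by
    have h := d.counit.hom.naturality (D.right α)
    rw [← F.toMap.right_sq, sq_mapSq, D.right_comp, D.right_comp, d.right_sq, d.right_sq_inv,
      ← Category.assoc]
    exact (congrArg (· ≫ _) h.symm).trans ((Category.assoc _ _ _).trans
      ((congrArg _ (d.counit.hom_inv_id_app B')).trans (Category.comp_id _))))
  sq_id M := d.sq_injective (by rw [sq_mapSq, F.toMap.sq_id, Category.id_comp, Iso.hom_inv_id])
  sq_comp α β := d.sq_injective (by
    rw [F.toMap.sq_comp, sq_mapSq, sq_mapSq, sq_mapSq]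
    simp only [Category.assoc, Iso.inv_hom_id_assoc])

/-- The comparison of the quasi-inverse for horizontal composition. -/
noncomputable def comp {X Y Z : D.Obj} (M : D.Hor X Y) (N : D.Hor Y Z) :
    tot (C.hcomp (d.hor M) (d.hor N)) ≅ tot (d.hor (D.hcomp M N)) :=
  d.preimageIso ((F.str.comp (d.hor M) (d.hor N)).symm ≪≫
    hcompIso (d.sq M) (d.sq N) (d.counit.app Y) (d.right_sq M) (d.left_sq N) ≪≫
      (d.sq (D.hcomp M N)).symm)

/-- The comparison of the quasi-inverse for horizontal identities. -/
noncomputable def unit (X : D.Obj) : tot (C.hid (d.vert.obj X)) ≅ tot (d.hor (D.hid X)) :=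
  d.preimageIso ((F.str.unit (d.vert.obj X)).symm ≪≫ hidIso (d.counit.app X) ≪≫
    (d.sq (D.hid X)).symm)

theorem right_left_sq {X Y Z : D.Obj} (M : D.Hor X Y) (N : D.Hor Y Z) :
    D.right (d.sq M).hom = D.left (d.sq N).hom := (d.right_sq M).trans (d.left_sq N).symm

/-- The comparison of the quasi-inverse for composition is characterized by its image under `F`: it
makes the comparisons of horizontal arrows compatible with composition. The laws of the
quasi-inverse are deduced from this by cancelling the invertible comparisons on both sides. -/
theorem sq_comp {X Y Z : D.Obj} (M : D.Hor X Y) (N : D.Hor Y Z) :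
    (F.str.comp (d.hor M) (d.hor N)).hom ≫ F.toMap.sq (d.comp M N).hom ≫
      (d.sq (D.hcomp M N)).hom = D.hcompSq (d.sq M).hom (d.sq N).hom (d.right_left_sq M N) := by
  rw [comp, sq_preimageIso]
  simp only [Iso.trans_hom, Iso.symm_hom, Category.assoc, Iso.hom_inv_id_assoc, Iso.inv_hom_id,
    Category.comp_id]
  rfl

theorem sq_unit (X : D.Obj) :
    (F.str.unit (d.vert.obj X)).hom ≫ F.toMap.sq (d.unit X).hom ≫ (d.sq (D.hid X)).hom =
      D.hidSq (d.counit.hom.app X) := by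
  rw [unit, sq_preimageIso]
  simp only [Iso.trans_hom, Iso.symm_hom, Category.assoc, Iso.hom_inv_id_assoc, Iso.inv_hom_id,
    Category.comp_id]
  rfl

theorem left_comp {X Y Z : D.Obj} (M : D.Hor X Y) (N : D.Hor Y Z) :
    C.left (d.comp M N).hom = 𝟙 _ := d.vert_injective (by
  have h := congrArg D.left (d.sq_comp M N)
  rw [D.left_comp, D.left_comp, F.str.left_comp, D.left_hcompSq, d.left_sq, d.left_sq,
    F.toMap.left_sq] at h
  rw [← cancel_mono (d.counit.hom.app X), F.toMap.vert.map_id]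
  exact ((Category.id_comp _).symm.trans h).trans (Category.id_comp _).symm)

theorem right_comp {X Y Z : D.Obj} (M : D.Hor X Y) (N : D.Hor Y Z) :
    C.right (d.comp M N).hom = 𝟙 _ := d.vert_injective (by
  have h := congrArg D.right (d.sq_comp M N)
  rw [D.right_comp, D.right_comp, F.str.right_comp, D.right_hcompSq, d.right_sq, d.right_sq,
    F.toMap.right_sq] at h
  rw [← cancel_mono (d.counit.hom.app Z), F.toMap.vert.map_id]
  exact ((Category.id_comp _).symm.trans h).trans (Category.id_comp _).symm)

theorem left_unit (X : D.Obj) : C.left (d.unit X).hom = 𝟙 _ := d.vert_injective (by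
  have h := congrArg D.left (d.sq_unit X)
  rw [D.left_comp, D.left_comp, F.str.left_unit, D.left_hidSq, d.left_sq, F.toMap.left_sq] at h
  rw [← cancel_mono (d.counit.hom.app X), F.toMap.vert.map_id]
  exact ((Category.id_comp _).symm.trans h).trans (Category.id_comp _).symm)

theorem right_unit (X : D.Obj) : C.right (d.unit X).hom = 𝟙 _ := d.vert_injective (by
  have h := congrArg D.right (d.sq_unit X)
  rw [D.right_comp, D.right_comp, F.str.right_unit, D.right_hidSq, d.right_sq,
    F.toMap.right_sq] at h
  rw [← cancel_mono (d.counit.hom.app X), F.toMap.vert.map_id]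
  exact ((Category.id_comp _).symm.trans h).trans (Category.id_comp _).symm)

/-- Naturality of the comparison of `F` for horizontal composition, in the form used to move
squares of the source out of a horizontal composite. -/
theorem comp_sq_hcompSq {X Y Z X' Y' Z' : C.Obj} {M : C.Hor X Y} {N : C.Hor Y Z}
    {M' : C.Hor X' Y'} {N' : C.Hor Y' Z'} (α : tot M ⟶ tot M') (β : tot N ⟶ tot N')
    (h : C.right α = C.left β) {K : HorTotal D.Hor} (γ : tot (F.toMap.hor (C.hcomp M' N')) ⟶ K) :
    (F.str.comp M N).hom ≫ F.toMap.sq (C.hcompSq α β h) ≫ γ =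
      D.hcompSq (F.toMap.sq α) (F.toMap.sq β)
        (by rw [F.toMap.right_sq, F.toMap.left_sq, h]) ≫ (F.str.comp M' N').hom ≫ γ := by
  rw [← Category.assoc, ← F.str.comp_naturality α β h, Category.assoc]

theorem comp_naturality {X Y Z X' Y' Z' : D.Obj} {M : D.Hor X Y} {N : D.Hor Y Z}
    {M' : D.Hor X' Y'} {N' : D.Hor Y' Z'} (α : tot M ⟶ tot M') (β : tot N ⟶ tot N')
    (h : D.right α = D.left β) (h' : C.right (d.mapSq α) = C.left (d.mapSq β)) :
    C.hcompSq (d.mapSq α) (d.mapSq β) h' ≫ (d.comp M' N').hom =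
      (d.comp M N).hom ≫ d.mapSq (D.hcompSq α β h) := d.sq_injective (by
  rw [← cancel_epi (F.str.comp (d.hor M) (d.hor N)).hom, ← cancel_mono (d.sq (D.hcomp M' N')).hom]
  rw [F.toMap.sq_comp, F.toMap.sq_comp]
  simp only [Category.assoc]
  rw [comp_sq_hcompSq, sq_comp, sq_mapSq_comp, hcompSq_merge]
  have e := d.sq_comp M N
  simp only [← Category.assoc] at e ⊢
  rw [e, hcompSq_merge]
  exact hcompSq_congr (d.sq_mapSq_comp α) (d.sq_mapSq_comp β) _ _)

theorem unit_naturality {X Y : D.Obj} (f : X ⟶ Y) :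
    C.hidSq (d.vert.map f) ≫ (d.unit Y).hom = (d.unit X).hom ≫ d.mapSq (D.hidSq f) :=
  d.sq_injective (by
  rw [← cancel_epi (F.str.unit (d.vert.obj X)).hom, ← cancel_mono (d.sq (D.hid Y)).hom]
  rw [F.toMap.sq_comp, F.toMap.sq_comp]
  have e := d.sq_unit X
  have n := F.str.unit_naturality (d.vert.map f)
  simp only [Category.assoc]
  rw [sq_mapSq_comp]
  simp only [← Category.assoc] at e ⊢
  rw [e, ← n, Category.assoc, Category.assoc, d.sq_unit, ← D.hidSq_comp, ← D.hidSq_comp]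
  exact congrArg _ (d.counit.hom.naturality f))

theorem comp_assoc {X Y Z W : D.Obj} (M : D.Hor X Y) (N : D.Hor Y Z) (K : D.Hor Z W)
    (h₁ : C.right (d.comp M N).hom = C.left (𝟙 (tot (d.hor K))))
    (h₂ : C.right (𝟙 (tot (d.hor M))) = C.left (d.comp N K).hom) :
    C.hcompSq (d.comp M N).hom (𝟙 (tot (d.hor K))) h₁ ≫ (d.comp (D.hcomp M N) K).hom ≫
        d.mapSq (D.assoc M N K).hom =
      (C.assoc (d.hor M) (d.hor N) (d.hor K)).hom ≫
        C.hcompSq (𝟙 (tot (d.hor M))) (d.comp N K).hom h₂ ≫ (d.comp M (D.hcomp N K)).hom :=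
  d.sq_injective (by
  have k₁ : D.right (F.str.comp (d.hor M) (d.hor N)).hom =
      D.left (𝟙 (tot (F.toMap.hor (d.hor K)))) := by
    rw [F.str.right_comp, D.left_id]
  have k₂ : D.right (𝟙 (tot (F.toMap.hor (d.hor M)))) =
      D.left (F.str.comp (d.hor N) (d.hor K)).hom := by
    rw [F.str.left_comp, D.right_id]
  have : IsIso (D.hcompSq (F.str.comp (d.hor M) (d.hor N)).hom
      (𝟙 (tot (F.toMap.hor (d.hor K)))) k₁) :=
    (hcompIso (F.str.comp (d.hor M) (d.hor N)) (Iso.refl (tot (F.toMap.hor (d.hor K))))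
      (Iso.refl _) (F.str.right_comp _ _) (D.left_id _)).isIso_hom
  rw [← cancel_epi (D.hcompSq (F.str.comp (d.hor M) (d.hor N)).hom
      (𝟙 (tot (F.toMap.hor (d.hor K)))) k₁ ≫
        (F.str.comp (C.hcomp (d.hor M) (d.hor N)) (d.hor K)).hom),
    ← cancel_mono (d.sq (D.hcomp M (D.hcomp N K))).hom]
  simp only [F.toMap.sq_comp, Category.assoc]
  have e := F.str.comp_assoc (d.hor M) (d.hor N) (d.hor K) k₁ k₂
  rw [comp_sq_hcompSq, sq_mapSq_comp]
  have e₁ := d.sq_comp (D.hcomp M N) K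
  have e₂ := d.sq_comp M (D.hcomp N K)
  have l : D.right (D.hcompSq (d.sq M).hom (d.sq N).hom (d.right_left_sq M N)) =
      D.left (d.sq K).hom := (D.right_hcompSq _ _ _).trans (d.right_left_sq N K)
  have r : D.right (d.sq M).hom =
      D.left (D.hcompSq (d.sq N).hom (d.sq K).hom (d.right_left_sq N K)) :=
    (d.right_left_sq M N).trans (D.left_hcompSq _ _ _).symm
  -- Both sides become the comparison of the three factors, moved past the associativity of `D`.
  trans D.hcompSq (D.hcompSq (d.sq M).hom (d.sq N).hom (d.right_left_sq M N)) (d.sq K).hom l ≫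
    (D.assoc M N K).hom
  · rw [hcompSq_merge_assoc, ← Category.assoc (F.toMap.sq (d.comp (D.hcomp M N) K).hom),
      ← Category.assoc (F.str.comp (d.hor (D.hcomp M N)) (d.hor K)).hom, e₁, hcompSq_merge_assoc]
    refine congrArg (· ≫ _) (hcompSq_congr ?_ ?_ _ _)
    · rw [Category.assoc, d.sq_comp]
    · rw [F.toMap.sq_id, Category.id_comp, Category.id_comp]
  · rw [D.assoc_naturality _ _ _ _ (d.right_left_sq N K) _ r]
    simp only [← Category.assoc] at e ⊢
    rw [e]
    simp only [Category.assoc]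
    rw [comp_sq_hcompSq, e₂, hcompSq_merge, hcompSq_merge]
    refine congrArg (_ ≫ ·) (hcompSq_congr ?_ ?_ _ _)
    · rw [F.toMap.sq_id, Category.id_comp, Category.id_comp]
    · rw [d.sq_comp])

theorem comp_lunit {X Y : D.Obj} (M : D.Hor X Y)
    (h : C.right (d.unit X).hom = C.left (𝟙 (tot (d.hor M)))) :
    C.hcompSq (d.unit X).hom (𝟙 (tot (d.hor M))) h ≫ (d.comp (D.hid X) M).hom ≫
      d.mapSq (D.lunit M).hom = (C.lunit (d.hor M)).hom := d.sq_injective (by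
  have k : D.right (F.str.unit (d.vert.obj X)).hom = D.left (𝟙 (tot (F.toMap.hor (d.hor M)))) := by
    rw [F.str.right_unit, D.left_id]
  have : IsIso (D.hcompSq (F.str.unit (d.vert.obj X)).hom
      (𝟙 (tot (F.toMap.hor (d.hor M)))) k) :=
    (hcompIso (F.str.unit (d.vert.obj X)) (Iso.refl (tot (F.toMap.hor (d.hor M))))
      (Iso.refl _) (F.str.right_unit _) (D.left_id _)).isIso_hom
  rw [← cancel_epi (D.hcompSq (F.str.unit (d.vert.obj X)).hom
      (𝟙 (tot (F.toMap.hor (d.hor M)))) k ≫ (F.str.comp (C.hid (d.vert.obj X)) (d.hor M)).hom),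
    ← cancel_mono (d.sq M).hom]
  simp only [F.toMap.sq_comp, Category.assoc]
  have e := F.str.comp_lunit (d.hor M) k
  have n : D.right (D.hidSq (D.left (d.sq M).hom)) = D.left (d.sq M).hom := D.right_hidSq _
  rw [comp_sq_hcompSq, sq_mapSq_comp]
  have e₁ := d.sq_comp (D.hid X) M
  trans D.hcompSq (D.hidSq (D.left (d.sq M).hom)) (d.sq M).hom n ≫ (D.lunit M).hom
  · rw [hcompSq_merge_assoc, ← Category.assoc (F.toMap.sq (d.comp (D.hid X) M).hom),
      ← Category.assoc (F.str.comp (d.hor (D.hid X)) (d.hor M)).hom, e₁, hcompSq_merge_assoc]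
    refine congrArg (· ≫ _) (hcompSq_congr ?_ ?_ _ _)
    · rw [Category.assoc, d.sq_unit, d.left_sq]
    · rw [F.toMap.sq_id, Category.id_comp, Category.id_comp]
  · rw [D.lunit_naturality]
    simp only [← Category.assoc] at e ⊢
    rw [e])

theorem comp_runit {X Y : D.Obj} (M : D.Hor X Y)
    (h : C.right (𝟙 (tot (d.hor M))) = C.left (d.unit Y).hom) :
    C.hcompSq (𝟙 (tot (d.hor M))) (d.unit Y).hom h ≫ (d.comp M (D.hid Y)).hom ≫
      d.mapSq (D.runit M).hom = (C.runit (d.hor M)).hom := d.sq_injective (by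
  have k : D.right (𝟙 (tot (F.toMap.hor (d.hor M)))) = D.left (F.str.unit (d.vert.obj Y)).hom := by
    rw [F.str.left_unit, D.right_id]
  have : IsIso (D.hcompSq (𝟙 (tot (F.toMap.hor (d.hor M)))) (F.str.unit (d.vert.obj Y)).hom k) :=
    (hcompIso (Iso.refl (tot (F.toMap.hor (d.hor M)))) (F.str.unit (d.vert.obj Y))
      (Iso.refl _) (D.right_id _) (F.str.left_unit _)).isIso_hom
  rw [← cancel_epi (D.hcompSq (𝟙 (tot (F.toMap.hor (d.hor M)))) (F.str.unit (d.vert.obj Y)).hom k ≫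
      (F.str.comp (d.hor M) (C.hid (d.vert.obj Y))).hom), ← cancel_mono (d.sq M).hom]
  simp only [F.toMap.sq_comp, Category.assoc]
  have e := F.str.comp_runit (d.hor M) k
  have n : D.right (d.sq M).hom = D.left (D.hidSq (D.right (d.sq M).hom)) := (D.left_hidSq _).symm
  rw [comp_sq_hcompSq, sq_mapSq_comp]
  have e₁ := d.sq_comp M (D.hid Y)
  trans D.hcompSq (d.sq M).hom (D.hidSq (D.right (d.sq M).hom)) n ≫ (D.runit M).hom
  · rw [hcompSq_merge_assoc, ← Category.assoc (F.toMap.sq (d.comp M (D.hid Y)).hom),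
      ← Category.assoc (F.str.comp (d.hor M) (d.hor (D.hid Y))).hom, e₁, hcompSq_merge_assoc]
    refine congrArg (· ≫ _) (hcompSq_congr ?_ ?_ _ _)
    · rw [F.toMap.sq_id, Category.id_comp, Category.id_comp]
    · rw [Category.assoc, d.sq_unit, d.right_sq]
  · rw [D.runit_naturality]
    simp only [← Category.assoc] at e ⊢
    rw [e])

/-- The quasi-inverse double functor. -/
noncomputable def inverse : DoubleFunctor D C where
  toMap := d.toMap
  str :=
    { comp := d.comp
      unit := d.unit
      left_comp := d.left_comp
      right_comp := d.right_comp
      left_unit := d.left_unit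
      right_unit := d.right_unit
      comp_naturality := d.comp_naturality
      unit_naturality := d.unit_naturality
      comp_assoc := d.comp_assoc
      comp_lunit := d.comp_lunit
      comp_runit := d.comp_runit }

/-- The comparisons form an invertible vertical transformation from the composite of the
quasi-inverse with `F` to the identity. -/
noncomputable def counitIso : DoubleNatIso (d.inverse.comp F) (DoubleFunctor.id D) where
  vert := d.counit
  sq M := d.sq M
  left_sq M := d.left_sq M
  right_sq M := d.right_sq M
  naturality α := d.sq_mapSq_comp α
  comp M N _ := ((Category.assoc _ _ _).trans (d.sq_comp M N)).trans (Category.comp_id _).symm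
  unit X := ((Category.assoc _ _ _).trans (d.sq_unit X)).trans (Category.comp_id _).symm

/-- The comparison of an object with its image under the composite of `F` with the
quasi-inverse. -/
noncomputable def unitObj (X : C.Obj) : X ≅ d.vert.obj (F.toMap.vert.obj X) :=
  have := d.full
  have := d.faithful
  F.toMap.vert.preimageIso (d.counit.app (F.toMap.vert.obj X)).symm

theorem vert_map_unitObj (X : C.Obj) :
    F.toMap.vert.map (d.unitObj X).hom = d.counit.inv.app (F.toMap.vert.obj X) :=
  have := d.full
  F.toMap.vert.map_preimage _

theorem unitObj_naturality {X Y : C.Obj} (f : X ⟶ Y) :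
    f ≫ (d.unitObj Y).hom = (d.unitObj X).hom ≫ d.vert.map (F.toMap.vert.map f) :=
  d.vert_injective (by
    rw [F.toMap.vert.map_comp, F.toMap.vert.map_comp, vert_map_unitObj, vert_map_unitObj]
    exact d.counit.inv.naturality (F.toMap.vert.map f))

/-- The comparison of a horizontal arrow with its image under the composite of `F` with the
quasi-inverse. -/
noncomputable def unitSq {X Y : C.Obj} (M : C.Hor X Y) : tot M ≅ tot (d.hor (F.toMap.hor M)) :=
  d.preimageIso (d.sq (F.toMap.hor M)).symm

theorem sq_unitSq {X Y : C.Obj} (M : C.Hor X Y) :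
    F.toMap.sq (d.unitSq M).hom = (d.sq (F.toMap.hor M)).inv := d.sq_preimageIso _

theorem left_unitSq {X Y : C.Obj} (M : C.Hor X Y) :
    C.left (d.unitSq M).hom = (d.unitObj X).hom := d.vert_injective
  ((d.left_preimageIso _).trans ((d.left_sq_inv _).trans (d.vert_map_unitObj _).symm))

theorem right_unitSq {X Y : C.Obj} (M : C.Hor X Y) :
    C.right (d.unitSq M).hom = (d.unitObj Y).hom := d.vert_injective
  ((d.right_preimageIso _).trans ((d.right_sq_inv _).trans (d.vert_map_unitObj _).symm))

theorem unitSq_naturality {X Y X' Y' : C.Obj} {M : C.Hor X Y} {M' : C.Hor X' Y'}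
    (α : tot M ⟶ tot M') : α ≫ (d.unitSq M').hom = (d.unitSq M).hom ≫ d.mapSq (F.toMap.sq α) :=
  d.sq_injective (by
    rw [F.toMap.sq_comp, F.toMap.sq_comp, sq_unitSq, sq_unitSq, sq_mapSq, Iso.inv_hom_id_assoc])

theorem unitSq_comp {X Y Z : C.Obj} (M : C.Hor X Y) (N : C.Hor Y Z)
    (h : C.right (d.unitSq M).hom = C.left (d.unitSq N).hom) :
    (d.unitSq (C.hcomp M N)).hom = C.hcompSq (d.unitSq M).hom (d.unitSq N).hom h ≫
      (d.comp (F.toMap.hor M) (F.toMap.hor N)).hom ≫ d.mapSq (F.str.comp M N).hom :=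
  d.sq_injective (by
    have e := d.sq_comp (F.toMap.hor M) (F.toMap.hor N)
    rw [F.toMap.sq_comp, F.toMap.sq_comp, ← cancel_epi (F.str.comp M N).hom,
      ← cancel_mono (d.sq (F.toMap.hor (C.hcomp M N))).hom]
    simp only [Category.assoc]
    rw [sq_mapSq_comp, comp_sq_hcompSq, sq_unitSq, Iso.inv_hom_id, Category.comp_id]
    simp only [← Category.assoc] at e ⊢
    rw [Category.assoc (D.hcompSq _ _ _), Category.assoc (D.hcompSq _ _ _), e, hcompSq_merge]
    refine ((Category.id_comp _).symm).trans (congrArg (· ≫ _) (hcompSq_eq_id ?_ ?_ _).symm)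
    · rw [sq_unitSq, Iso.inv_hom_id]
    · rw [sq_unitSq, Iso.inv_hom_id])

theorem unitSq_hid (X : C.Obj) :
    (d.unitSq (C.hid X)).hom = C.hidSq (d.unitObj X).hom ≫
      (d.unit (F.toMap.vert.obj X)).hom ≫ d.mapSq (F.str.unit X).hom :=
  d.sq_injective (by
    have e := d.sq_unit (F.toMap.vert.obj X)
    have n := F.str.unit_naturality (d.unitObj X).hom
    rw [F.toMap.sq_comp, F.toMap.sq_comp,
      ← cancel_epi (F.str.unit X).hom, ← cancel_mono (d.sq (F.toMap.hor (C.hid X))).hom]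
    simp only [Category.assoc]
    rw [sq_mapSq_comp, sq_unitSq, Iso.inv_hom_id, Category.comp_id]
    simp only [← Category.assoc] at e n ⊢
    rw [← n, Category.assoc (D.hidSq _), Category.assoc (D.hidSq _), e, ← D.hidSq_comp,
      vert_map_unitObj]
    refine ((Category.id_comp _).symm).trans (congrArg (· ≫ _) ?_)
    refine (D.hidSq_id _).symm.trans (congrArg _ ?_)
    exact (d.counit.inv_hom_id_app _).symm)

/-- The invertible vertical transformation from the identity to the composite of `F` with the
quasi-inverse. -/
noncomputable def unitIso : DoubleNatIso (DoubleFunctor.id C) (F.comp d.inverse) where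
  vert := NatIso.ofComponents d.unitObj d.unitObj_naturality
  sq M := d.unitSq M
  left_sq M := d.left_unitSq M
  right_sq M := d.right_unitSq M
  naturality α := d.unitSq_naturality α
  comp M N h := (Category.id_comp _).trans (d.unitSq_comp M N h)
  unit X := (Category.id_comp _).trans (d.unitSq_hid X)

/-- A double functor between framed bicategories which is fully faithful on squares and
essentially surjective on horizontal arrows is an equivalence of framed bicategories. -/
theorem isFramedEquivalence (d : InverseData F) (hC : C.IsFramed) (hD : D.IsFramed) :
    F.IsFramedEquivalence :=
  ⟨hC, hD, d.inverse, ⟨d.unitIso⟩, ⟨d.counitIso⟩⟩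

end InverseData

/-! ### Cartesian and opcartesian squares -/

namespace DoubleCat

variable {D : DoubleCat.{u, v, w, x}}

/-- A square is cartesian if every square with the same target and with compatible endpoints
factors uniquely through it, with prescribed endpoints. -/
def IsCart {A B A' B' : D.Obj} {N : D.Hor A' B'} {M : D.Hor A B} (φ : tot N ⟶ tot M) : Prop :=
  ∀ {X Y : D.Obj} (K : D.Hor X Y) (u : X ⟶ A') (v : Y ⟶ B') (β : tot K ⟶ tot M),
    D.left β = u ≫ D.left φ → D.right β = v ≫ D.right φ →
      ∃! χ : tot K ⟶ tot N, (D.left χ = u ∧ D.right χ = v) ∧ χ ≫ φ = β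

/-- A square is opcartesian if every square with the same source and with compatible endpoints
factors uniquely through it, with prescribed endpoints. -/
def IsOpcart {A B A' B' : D.Obj} {M : D.Hor A B} {N : D.Hor A' B'} (φ : tot M ⟶ tot N) : Prop :=
  ∀ {X Y : D.Obj} (K : D.Hor X Y) (u : A' ⟶ X) (v : B' ⟶ Y) (β : tot M ⟶ tot K),
    D.left β = D.left φ ≫ u → D.right β = D.right φ ≫ v →
      ∃! χ : tot N ⟶ tot K, (D.left χ = u ∧ D.right χ = v) ∧ φ ≫ χ = β

theorem ends_isHomLift_iff {M N : HorTotal D.Hor} (φ : M ⟶ N) (f : D.ends.obj M ⟶ D.ends.obj N) :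
    D.ends.IsHomLift f φ ↔ D.left φ = f.1 ∧ D.right φ = f.2 := by
  constructor
  · intro h
    have e := IsHomLift.eq_of_isHomLift D.ends f φ
    rw [e]
    exact ⟨rfl, rfl⟩
  · rintro ⟨h₁, h₂⟩
    have e : f = D.ends.map φ := Prod.ext h₁.symm h₂.symm
    rw [e]
    infer_instance

theorem IsCart.isStronglyCartesian {A B A' B' : D.Obj} {N : D.Hor A' B'} {M : D.Hor A B}
    {φ : tot N ⟶ tot M} (h : IsCart φ) : D.ends.IsStronglyCartesian (D.ends.map φ) φ where
  universal_property' {K} g β hβ := by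
    obtain ⟨h₁, h₂⟩ := (ends_isHomLift_iff β (g ≫ D.ends.map φ)).1 hβ
    obtain ⟨χ, ⟨hχ, hχ'⟩, u⟩ := h K.hor g.1 g.2 β h₁ h₂
    exact ⟨χ, ⟨(ends_isHomLift_iff χ g).2 hχ, hχ'⟩,
      fun χ' k => u χ' ⟨(ends_isHomLift_iff χ' g).1 k.1, k.2⟩⟩

theorem IsOpcart.isStronglyCocartesian {A B A' B' : D.Obj} {M : D.Hor A B} {N : D.Hor A' B'}
    {φ : tot M ⟶ tot N} (h : IsOpcart φ) : D.ends.IsStronglyCocartesian (D.ends.map φ) φ where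
  universal_property' {K} g β hβ := by
    obtain ⟨h₁, h₂⟩ := (ends_isHomLift_iff β (D.ends.map φ ≫ g)).1 hβ
    obtain ⟨χ, ⟨hχ, hχ'⟩, u⟩ := h K.hor g.1 g.2 β h₁ h₂
    exact ⟨χ, ⟨(ends_isHomLift_iff χ g).2 hχ, hχ'⟩,
      fun χ' k => u χ' ⟨(ends_isHomLift_iff χ' g).1 k.1, k.2⟩⟩

theorem isFramed_of_lifts
    (h : ∀ {A B A' B' : D.Obj} (M : D.Hor A B) (f : A' ⟶ A) (g : B' ⟶ B),
      ∃ (N : D.Hor A' B') (φ : tot N ⟶ tot M), D.left φ = f ∧ D.right φ = g ∧ IsCart φ)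
    (h' : ∀ {A B A' B' : D.Obj} (M : D.Hor A B) (f : A ⟶ A') (g : B ⟶ B'),
      ∃ (N : D.Hor A' B') (φ : tot M ⟶ tot N), D.left φ = f ∧ D.right φ = g ∧ IsOpcart φ) :
    D.IsFramed := by
  constructor
  · rintro ⟨A, B, M⟩ ⟨A', B'⟩ f
    obtain ⟨N, φ, hf, hg, hφ⟩ := h M f.1 f.2
    have e : f = D.ends.map φ := Prod.ext hf.symm hg.symm
    exact ⟨tot N, φ, e ▸ hφ.isStronglyCartesian⟩
  · rintro ⟨A, B, M⟩ ⟨A', B'⟩ f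
    obtain ⟨N, φ, hf, hg, hφ⟩ := h' M f.1 f.2
    have e : f = D.ends.map φ := Prod.ext hf.symm hg.symm
    exact ⟨tot N, φ, e ▸ hφ.isStronglyCocartesian⟩

end DoubleCat

/-! ### Restriction and extension of spans along vertical arrows -/

section PSpanFramed

variable {C : Type u} [Category.{v} C] [HasPullbacks C]

namespace PSpan

variable {P : C ⥤ C} {A B A' B' : C}

/-- The restriction of a span along arrows into its endpoints. -/
noncomputable def restrict (M : PSpan P A B) (f : A' ⟶ A) (g : B' ⟶ B) : PSpan P A' B' where
  apex := pullback (pullback.fst M.dom (P.map f) ≫ M.cod) g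
  dom := pullback.fst _ _ ≫ pullback.snd _ _
  cod := pullback.snd _ _

/-- The projection of a restricted span. -/
noncomputable def restrictSq (M : PSpan P A B) (f : A' ⟶ A) (g : B' ⟶ B) :
    tot (restrict M f g) ⟶ tot M :=
  PSpanSq.mk (M := tot (restrict M f g)) (N := tot M) f g (pullback.fst _ _ ≫ pullback.fst _ _)
    (by simp [restrict, pullback.condition]) (by simp [restrict, pullback.condition])

/-- Every square into `M` with endpoints factoring through `f` and `g` factors uniquely through
the restriction of `M`. -/
theorem restrictSq_existsUnique (M : PSpan P A B) (f : A' ⟶ A) (g : B' ⟶ B) {X Y : C}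
    (K : PSpan P X Y) (u : X ⟶ A') (v : Y ⟶ B') (β : tot K ⟶ tot M)
    (h₁ : PSpanSq.left β = u ≫ f) (h₂ : PSpanSq.right β = v ≫ g) :
    ∃! χ : tot K ⟶ tot (restrict M f g),
      (PSpanSq.left χ = u ∧ PSpanSq.right χ = v) ∧ χ ≫ restrictSq M f g = β := by
  have c₁ : PSpanSq.mid β ≫ M.dom = (K.dom ≫ P.map u) ≫ P.map f :=
    (PSpanSq.dom_comm β).trans (by rw [h₁, P.map_comp, Category.assoc])
  have c₂ : PSpanSq.mid β ≫ M.cod = (K.cod ≫ v) ≫ g :=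
    (PSpanSq.cod_comm β).trans (by rw [h₂, Category.assoc])
  have c₃ : pullback.lift (PSpanSq.mid β) (K.dom ≫ P.map u) c₁ ≫
      pullback.fst M.dom (P.map f) ≫ M.cod = (K.cod ≫ v) ≫ g := by
    rw [pullback.lift_fst_assoc, c₂]
  refine ⟨PSpanSq.mk (M := tot K) (N := tot (restrict M f g)) u v
    (pullback.lift (pullback.lift (PSpanSq.mid β) (K.dom ≫ P.map u) c₁) (K.cod ≫ v) c₃)
    ((pullback.lift_fst_assoc _ _ _ _).trans (pullback.lift_snd _ _ _))
    (pullback.lift_snd _ _ _), ⟨⟨rfl, rfl⟩, ?_⟩, ?_⟩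
  · refine PSpanSq.hom_ext h₁.symm h₂.symm ?_
    exact (pullback.lift_fst_assoc _ _ _ _).trans (pullback.lift_fst _ _ _)
  · rintro χ ⟨⟨rfl, rfl⟩, rfl⟩
    refine PSpanSq.hom_ext rfl rfl (pullback.hom_ext (pullback.hom_ext ?_ ?_) ?_)
    · rw [pullback.lift_fst, pullback.lift_fst]
      exact Category.assoc _ _ _
    · rw [pullback.lift_fst, pullback.lift_snd]
      exact (Category.assoc _ _ _).trans (PSpanSq.dom_comm χ)
    · rw [pullback.lift_snd]
      exact PSpanSq.cod_comm χ

/-- The extension of a span along arrows out of its endpoints. -/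
def extend (M : PSpan P A B) (f : A ⟶ A') (g : B ⟶ B') : PSpan P A' B' where
  apex := M.apex
  dom := M.dom ≫ P.map f
  cod := M.cod ≫ g

/-- The inclusion in an extended span. -/
def extendSq (M : PSpan P A B) (f : A ⟶ A') (g : B ⟶ B') : tot M ⟶ tot (extend M f g) :=
  PSpanSq.mk (M := tot M) (N := tot (extend M f g)) f g (𝟙 M.apex) (Category.id_comp _)
    (Category.id_comp _)

/-- Every square out of `M` with endpoints factoring through `f` and `g` factors uniquely through
the extension of `M`. -/
theorem extendSq_existsUnique (M : PSpan P A B) (f : A ⟶ A') (g : B ⟶ B') {X Y : C}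
    (K : PSpan P X Y) (u : A' ⟶ X) (v : B' ⟶ Y) (β : tot M ⟶ tot K)
    (h₁ : PSpanSq.left β = f ≫ u) (h₂ : PSpanSq.right β = g ≫ v) :
    ∃! χ : tot (extend M f g) ⟶ tot K,
      (PSpanSq.left χ = u ∧ PSpanSq.right χ = v) ∧ extendSq M f g ≫ χ = β := by
  refine ⟨PSpanSq.mk (M := tot (extend M f g)) (N := tot K) u v
    (PSpanSq.mid (M := tot M) (N := tot K) β)
    ((PSpanSq.dom_comm β).trans (by rw [h₁, P.map_comp, ← Category.assoc]; rfl))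
    ((PSpanSq.cod_comm β).trans (by rw [h₂, ← Category.assoc]; rfl)), ⟨⟨rfl, rfl⟩, ?_⟩, ?_⟩
  · exact PSpanSq.hom_ext h₁.symm h₂.symm (Category.id_comp _)
  · rintro χ ⟨⟨rfl, rfl⟩, rfl⟩
    exact PSpanSq.hom_ext rfl rfl (Category.id_comp _).symm

end PSpan

/-- Spans form a framed bicategory: cartesian lifts are restrictions, opcartesian lifts are
extensions along vertical arrows. -/
theorem pspanDouble_isFramed {T : Monad C} (hT : IsCartesianMonad T) :
    (pspanDouble T hT).IsFramed :=
  DoubleCat.isFramed_of_lifts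
    (fun M f g => ⟨PSpan.restrict M f g, PSpan.restrictSq M f g, rfl, rfl,
      fun K u v β h₁ h₂ => PSpan.restrictSq_existsUnique M f g K u v β h₁ h₂⟩)
    (fun M f g => ⟨PSpan.extend M f g, PSpan.extendSq M f g, rfl, rfl,
      fun K u v β h₁ h₂ => PSpan.extendSq_existsUnique M f g K u v β h₁ h₂⟩)

end PSpanFramed

/-! ### Spans and cartesian functors over an endofunctor -/

section SpanExt

variable {C : Type u} [Category.{v} C] [HasPullbacks C] {P : C ⥤ C}

/-- At the terminal object of the slice, the extension of a span is the apex. -/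
theorem isIso_extSnd_overOne {A B : C} (M : PSpan P A B) :
    IsIso (extSnd M (Over.mk (𝟙 A))) := by
  have : IsIso (P.map (Over.mk (𝟙 A)).hom) := inferInstanceAs (IsIso (P.map (𝟙 A)))
  exact (ext_isPullback M (Over.mk (𝟙 A))).isIso_snd_of_isIso

namespace CartOver

variable {A B A' B' : C}

/-- The value of a square on the map between terminal objects of slices. -/
noncomputable def apexMap {M N : HorTotal (CartOver P)} (φ : CartOverSq M N) :
    (M.hor.functor.obj (Over.mk (𝟙 M.src))).left ⟶ (N.hor.functor.obj (Over.mk (𝟙 N.src))).left :=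
  valueAt φ.nat (X := Over.mk (𝟙 M.src)) (Y := Over.mk (𝟙 N.src)) φ.left
    ((Category.comp_id _).trans (Category.id_comp _).symm)

/-- All values of a square lie over its value at the terminal objects. -/
theorem valueAt_bang {M N : HorTotal (CartOver P)} (φ : CartOverSq M N) {X : Over M.src}
    {Y : Over N.src} (g : X.left ⟶ Y.left) (h : g ≫ Y.hom = X.hom ≫ φ.left) :
    valueAt φ.nat g h ≫ (N.hor.functor.map (Over.homMk Y.hom : Y ⟶ Over.mk (𝟙 N.src))).left =
      (M.hor.functor.map (Over.homMk X.hom : X ⟶ Over.mk (𝟙 M.src))).left ≫ apexMap φ := by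
  rw [valueAt_comp φ.nat g h (Over.homMk Y.hom : Y ⟶ Over.mk (𝟙 N.src))
    ((Category.comp_id _).trans h), apexMap,
    comp_valueAt φ.nat (X := Over.mk (𝟙 M.src)) (Y := Over.mk (𝟙 N.src))
      (Over.homMk X.hom : X ⟶ Over.mk (𝟙 M.src)) φ.left
      ((Category.comp_id _).trans (Category.id_comp _).symm) (Category.comp_id _)]
  congr 1

end CartOver

theorem extSnd_eq_map_bang {A B : C} (M : PSpan P A B) (X : Over A) :
    ((extFunctor M).map (Over.homMk X.hom : X ⟶ Over.mk (𝟙 A))).left ≫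
      extSnd M (Over.mk (𝟙 A)) = extSnd M X := ext_map_snd M _

/-- A morphism of spans is recovered from the value of its extension at the terminal objects. -/
theorem spanExt_faithful (hP : PreservesLimitsOfShape WalkingCospan P) :
    (spanExt hP).Faithful where
  map_injective {M N} α β h := by
    obtain ⟨A, B, M⟩ := M
    obtain ⟨A', B', N⟩ := N
    have hl : PSpanSq.left α = PSpanSq.left β := congrArg CartOverSq.left h
    have hr : PSpanSq.right α = PSpanSq.right β := congrArg CartOverSq.right h
    refine PSpanSq.hom_ext hl hr ?_
    have := isIso_extSnd_overOne M
    rw [← cancel_epi (extSnd M (Over.mk (𝟙 A)))]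
    have w : PSpanSq.left α ≫ (Over.mk (𝟙 A')).hom =
      (Over.mk (𝟙 A)).hom ≫ PSpanSq.left α :=
      (Category.comp_id _).trans (Category.id_comp _).symm
    have w' : PSpanSq.left α ≫ (Over.mk (𝟙 A')).hom =
      (Over.mk (𝟙 A)).hom ≫ PSpanSq.left β := by rw [w, hl]
    have e₁ := extMap_snd (M := M) (N := N) α (X := Over.mk (𝟙 A)) (Y := Over.mk (𝟙 A'))
      (PSpanSq.left α) w
    have e₂ := extMap_snd (M := M) (N := N) β (X := Over.mk (𝟙 A)) (Y := Over.mk (𝟙 A'))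
      (PSpanSq.left α) w'
    refine e₁.symm.trans (Eq.trans ?_ e₂)
    refine congrArg (· ≫ _) ?_
    refine (valueAt_extNat (M := M) (N := N) α _ w).symm.trans
      (Eq.trans ?_ (valueAt_extNat (M := M) (N := N) β _ w'))
    have key : ∀ (φ ψ : CartOverSq (tot (extObj hP M)) (tot (extObj hP N))) (_ : φ = ψ)
        (g : (Over.mk (𝟙 A)).left ⟶ (Over.mk (𝟙 A')).left)
        (k : g ≫ (Over.mk (𝟙 A')).hom = (Over.mk (𝟙 A)).hom ≫ φ.left)
        (k' : g ≫ (Over.mk (𝟙 A')).hom = (Over.mk (𝟙 A)).hom ≫ ψ.left),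
        valueAt φ.nat g k = valueAt ψ.nat g k' := by
      rintro φ _ rfl g k k'
      rfl
    exact key _ _ h _ w w'

/-- A morphism between extensions is the extension of its value at the terminal objects, conjugated
by the identification of the values there with the apices. -/
theorem spanExt_full (hP : PreservesLimitsOfShape WalkingCospan P) :
    (spanExt hP).Full where
  map_surjective {M N} φ := by
    obtain ⟨A, B, M⟩ := M
    obtain ⟨A', B', N⟩ := N
    have := isIso_extSnd_overOne M
    let φ' : CartOverSq (tot (extObj hP M)) (tot (extObj hP N)) := φ
    have c := φ'.valueAt_comm (X := Over.mk (𝟙 A)) (Y := Over.mk (𝟙 A')) φ'.left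
      ((Category.comp_id _).trans (Category.id_comp _).symm)
    have w := valueAt_w φ'.nat (X := Over.mk (𝟙 A)) (Y := Over.mk (𝟙 A')) φ'.left
      ((Category.comp_id _).trans (Category.id_comp _).symm)
    have p₁ := (ext_isPullback M (Over.mk (𝟙 A))).w
    have p₂ := (ext_isPullback N (Over.mk (𝟙 A'))).w
    have i₁ : P.map (Over.mk (𝟙 A)).hom = 𝟙 _ := P.map_id A
    have i₂ : P.map (Over.mk (𝟙 A')).hom = 𝟙 _ := P.map_id A'
    rw [i₁] at p₁
    rw [i₂] at p₂
    have p₁' : extFst M (Over.mk (𝟙 A)) = extSnd M (Over.mk (𝟙 A)) ≫ M.dom :=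
      (Category.comp_id _).symm.trans p₁
    have p₂' : extFst N (Over.mk (𝟙 A')) = extSnd N (Over.mk (𝟙 A')) ≫ N.dom :=
      (Category.comp_id _).symm.trans p₂
    have m : extSnd M (Over.mk (𝟙 A)) ≫ inv (extSnd M (Over.mk (𝟙 A))) ≫
        CartOver.apexMap φ' ≫ extSnd N (Over.mk (𝟙 A')) =
          CartOver.apexMap φ' ≫ extSnd N (Over.mk (𝟙 A')) := IsIso.hom_inv_id_assoc _ _
    let α : tot M ⟶ tot N := PSpanSq.mk (M := tot M) (N := tot N) φ'.left φ'.right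
      (inv (extSnd M (Over.mk (𝟙 A))) ≫ CartOver.apexMap φ' ≫ extSnd N (Over.mk (𝟙 A')))
      (by
        rw [← cancel_epi (extSnd M (Over.mk (𝟙 A)))]
        refine (Category.assoc _ _ _).symm.trans ((congrArg (· ≫ N.dom) m).trans ?_)
        refine (Category.assoc _ _ _).trans ((congrArg (_ ≫ ·) p₂'.symm).trans ?_)
        refine Eq.trans c ?_
        exact (congrArg (· ≫ _) p₁').trans (Category.assoc _ _ _))
      (by
        rw [← cancel_epi (extSnd M (Over.mk (𝟙 A)))]
        refine (Category.assoc _ _ _).symm.trans ((congrArg (· ≫ N.cod) m).trans ?_)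
        refine (Category.assoc _ _ _).trans ?_
        exact Eq.trans w (Category.assoc _ _ _))
    refine ⟨α, CartOverSq.ext_valueAt rfl rfl fun X Y g h h' => ?_⟩
    refine (valueAt_extNat (M := M) (N := N) α g h).trans ?_
    refine (ext_isPullback N Y).hom_ext ?_ ?_
    · refine (extMap_fst (M := M) (N := N) α g h).trans ?_
      exact (φ'.valueAt_comm g h').symm
    · refine (extMap_snd (M := M) (N := N) α g h).trans ?_
      have b : valueAt φ'.nat g h' ≫ _ = _ := CartOver.valueAt_bang φ' g h'
      rw [← extSnd_eq_map_bang M X, ← extSnd_eq_map_bang N Y]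
      refine (Category.assoc _ _ _).trans ((congrArg (_ ≫ ·) m).trans ?_)
      refine (Category.assoc _ _ _).symm.trans ?_
      exact (congrArg (· ≫ extSnd N (Over.mk (𝟙 A'))) b.symm).trans (Category.assoc _ _ _)

/-- An isomorphism of cartesian functors over `P`, with identity endpoints. -/
def CartOver.globIso {A B : C} {M N : CartOver P A B} (e : M.functor ≅ N.functor)
    (h : ∀ X : Over A, (e.hom.app X).left ≫ N.str X = M.str X) : tot M ≅ tot N where
  hom := CartOverSq.mk (M := tot M) (N := tot N) (𝟙 A) (𝟙 B) (mateOfNat e.hom)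
    (mateOfNat_equifibered e)
    (CartOverSq.comm_of_valueAt (M := tot M) (N := tot N) (l := 𝟙 A) (r := 𝟙 B)
      fun X Y g k => by
        refine (congrArg (· ≫ _) (valueAt_mateOfNat e.hom g k)).trans ?_
        refine (Category.assoc _ _ _).trans ((congrArg (_ ≫ ·) (N.str_naturality _)).trans ?_)
        exact (Category.assoc _ _ _).symm.trans (congrArg (· ≫ _) (h X)))
  inv := CartOverSq.mk (M := tot N) (N := tot M) (𝟙 A) (𝟙 B) (mateOfNat e.inv)
    (mateOfNat_equifibered e.symm)
    (CartOverSq.comm_of_valueAt (M := tot N) (N := tot M) (l := 𝟙 A) (r := 𝟙 B)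
      fun X Y g k => by
        have h' : (e.inv.app X).left ≫ M.str X = N.str X := by
          rw [← h X, ← Category.assoc, ← Over.comp_left, e.inv_hom_id_app]
          exact Category.id_comp _
        refine (congrArg (· ≫ _) (valueAt_mateOfNat e.inv g k)).trans ?_
        refine (Category.assoc _ _ _).trans ((congrArg (_ ≫ ·) (M.str_naturality _)).trans ?_)
        exact (Category.assoc _ _ _).symm.trans (congrArg (· ≫ _) h'))
  hom_inv_id := CartOverSq.ext_valueAt (Category.id_comp (𝟙 A)) (Category.id_comp (𝟙 B))
    fun X Y g h₁ h₂ => by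
      refine (valueAt_comp_glob (mateOfNat e.hom) (mateOfNat e.inv) g h₁ h₂).trans ?_
      refine (congrArg₂ (· ≫ ·) (valueAt_mateOfNat _ g h₂) (valueAt_mateOfNat_id _ _ _)).trans ?_
      refine Eq.trans ?_ (valueAt_mateId _ g h₂).symm
      rw [Category.assoc, ← Over.comp_left, ← Over.comp_left, e.inv.naturality,
        e.hom_inv_id_app_assoc]
  inv_hom_id := CartOverSq.ext_valueAt (Category.id_comp (𝟙 A)) (Category.id_comp (𝟙 B))
    fun X Y g h₁ h₂ => by
      refine (valueAt_comp_glob (mateOfNat e.inv) (mateOfNat e.hom) g h₁ h₂).trans ?_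
      refine (congrArg₂ (· ≫ ·) (valueAt_mateOfNat _ g h₂) (valueAt_mateOfNat_id _ _ _)).trans ?_
      refine Eq.trans ?_ (valueAt_mateId _ g h₂).symm
      rw [Category.assoc, ← Over.comp_left, ← Over.comp_left, e.hom.naturality,
        e.inv_hom_id_app_assoc]

/-- The span of a cartesian functor `Q` over `P`: its apex is the value of `Q` at the terminal
object of the slice. -/
def CartOver.toSpan {A B : C} (Q : CartOver P A B) : PSpan P A B where
  apex := (Q.functor.obj (Over.mk (𝟙 A))).left
  dom := Q.str (Over.mk (𝟙 A))
  cod := (Q.functor.obj (Over.mk (𝟙 A))).hom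

/-- The map from a value of `Q` to its value at the terminal object of the slice. -/
def CartOver.toApex {A B : C} (Q : CartOver P A B) (X : Over A) :
    (Q.functor.obj X).left ⟶ Q.toSpan.apex :=
  (Q.functor.map (Over.homMk X.hom : X ⟶ Over.mk (𝟙 A))).left

theorem CartOver.toApex_cod {A B : C} (Q : CartOver P A B) (X : Over A) :
    Q.toApex X ≫ Q.toSpan.cod = (Q.functor.obj X).hom :=
  Over.w (Q.functor.map (Over.homMk X.hom : X ⟶ Over.mk (𝟙 A)))

theorem CartOver.map_toApex {A B : C} (Q : CartOver P A B) {X Y : Over A} (f : X ⟶ Y) :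
    (Q.functor.map f).left ≫ Q.toApex Y = Q.toApex X := by
  have b : f ≫ Over.homMk Y.hom = (Over.homMk X.hom : X ⟶ Over.mk (𝟙 A)) :=
    Over.OverMorphism.ext (Over.w f)
  exact (congrArg (fun t => t.left)
    (Q.functor.map_comp f (Over.homMk Y.hom : Y ⟶ Over.mk (𝟙 A)))).symm.trans
    (congrArg (fun t => (Q.functor.map t).left) b)

theorem CartOver.isPullback_toSpan {A B : C} (Q : CartOver P A B) (X : Over A) :
    IsPullback (Q.str X) (Q.toApex X) (P.map X.hom) Q.toSpan.dom :=
  (Q.toP_cart (Over.homMk X.hom : X ⟶ Over.mk (𝟙 A))).flip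

/-- The value of `Q` at `X` and the value of the extension of its span are both pullbacks of the
value of `Q` at the terminal object. -/
noncomputable def CartOver.extToSpanApp {A B : C} (Q : CartOver P A B) (X : Over A) :
    ((extFunctor Q.toSpan).obj X).left ≅ (Q.functor.obj X).left :=
  (ext_isPullback Q.toSpan X).isoIsPullback _ _ (Q.isPullback_toSpan X)

theorem CartOver.extToSpanApp_str {A B : C} (Q : CartOver P A B) (X : Over A) :
    (Q.extToSpanApp X).hom ≫ Q.str X = extFst Q.toSpan X :=
  (ext_isPullback Q.toSpan X).isoIsPullback_hom_fst _ _ (Q.isPullback_toSpan X)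

theorem CartOver.extToSpanApp_toApex {A B : C} (Q : CartOver P A B) (X : Over A) :
    (Q.extToSpanApp X).hom ≫ Q.toApex X = extSnd Q.toSpan X :=
  (ext_isPullback Q.toSpan X).isoIsPullback_hom_snd _ _ (Q.isPullback_toSpan X)

/-- A cartesian functor over `P` is the extension of its span. -/
noncomputable def CartOver.extToSpanIso {A B : C} (Q : CartOver P A B) :
    extFunctor Q.toSpan ≅ Q.functor :=
  NatIso.ofComponents
    (fun X => Over.isoMk (Q.extToSpanApp X)
      (by rw [ext_obj_hom, ← Q.extToSpanApp_toApex, Category.assoc, Q.toApex_cod]))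
    (fun {X Y} f => by
      refine Over.OverMorphism.ext ?_
      change ((extFunctor Q.toSpan).map f).left ≫ (Q.extToSpanApp Y).hom =
        (Q.extToSpanApp X).hom ≫ (Q.functor.map f).left
      refine (Q.isPullback_toSpan Y).hom_ext ?_ ?_
      · rw [Category.assoc, Category.assoc, Q.extToSpanApp_str, Q.str_naturality, ext_map_fst,
          ← Category.assoc, Q.extToSpanApp_str]
      · rw [Category.assoc, Category.assoc, Q.extToSpanApp_toApex, ext_map_snd, Q.map_toApex,
          Q.extToSpanApp_toApex])

theorem spanExt_essSurj (hP : PreservesLimitsOfShape WalkingCospan P) :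
    (spanExt hP).EssSurj where
  mem_essImage Q := by
    obtain ⟨A, B, Q⟩ := Q
    exact ⟨tot Q.toSpan, ⟨CartOver.globIso (M := extObj hP Q.toSpan) (N := Q) Q.extToSpanIso
      Q.extToSpanApp_str⟩⟩

theorem spanExt_isEquivalence (hP : PreservesLimitsOfShape WalkingCospan P) :
    (spanExt hP).IsEquivalence :=
  have := spanExt_faithful hP
  have := spanExt_full hP
  have := spanExt_essSurj hP
  {}

end SpanExt

/-! ### Polynomials over a polynomial, and spans -/

section DirectComparison

variable {E : Type u} [Category.{v} E] {I : E} [HasPullbacks E] [LocallyCartesianClosed E]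
  {p : Poly I I} {D C : Over I}

namespace PolyDiagHom

/-- A morphism of polynomials over `p` is determined by its component on codomains. -/
theorem ext_cod {Q Q' : PolyDiagOver p D C} {φ ψ : PolyDiagHom Q Q'} (h : φ.cod = ψ.cod) :
    φ = ψ := by
  refine PolyDiagHom.ext (Q'.isPullback.hom_ext ?_ ?_) h
  · rw [← φ.isPullback.w, ← ψ.isPullback.w, h]
  · rw [φ.β_comm, ψ.β_comm]

section OfLift

variable {Q Q' : PolyDiagOver p D C} (k : Q.row.cod ⟶ Q'.row.cod) (hα : k ≫ Q'.α = Q.α)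

theorem ofLift_w (hα : k ≫ Q'.α = Q.α) : (Q.row.f ≫ k) ≫ Q'.α = Q.β ≫ p.f := by
  rw [Category.assoc, hα, Q.isPullback.w]

/-- The map on domains induced by a map on codomains. -/
noncomputable def ofLiftDom : Q.row.dom ⟶ Q'.row.dom :=
  Q'.isPullback.lift (Q.row.f ≫ k) Q.β (ofLift_w k hα)

theorem ofLiftDom_f : ofLiftDom k hα ≫ Q'.row.f = Q.row.f ≫ k := Q'.isPullback.lift_fst _ _ _

theorem ofLiftDom_β : ofLiftDom k hα ≫ Q'.β = Q.β := Q'.isPullback.lift_snd _ _ _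

theorem coreL_map_ofLiftDom :
    (p.coreL.map (Over.homMk k hα : Over.mk Q.α ⟶ Over.mk Q'.α)).left ≫
      Q'.isPullback.isoPullback.inv = Q.isPullback.isoPullback.inv ≫ ofLiftDom k hα := by
  refine Q'.isPullback.hom_ext ?_ ?_
  · refine (Category.assoc _ _ _).trans ((congrArg (_ ≫ ·)
      Q'.isPullback.isoPullback_inv_fst).trans ((pullback.lift_fst _ _ _).trans ?_))
    rw [Category.assoc, ofLiftDom_f, ← Category.assoc, Q.isPullback.isoPullback_inv_fst]
    rfl
  · refine (Category.assoc _ _ _).trans ((congrArg (_ ≫ ·)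
      Q'.isPullback.isoPullback_inv_snd).trans ((pullback.lift_snd _ _ _).trans ?_))
    rw [Category.assoc, ofLiftDom_β, Q.isPullback.isoPullback_inv_snd]
    rfl

theorem ofLiftDom_s (hl : k ≫ Q'.lift.left = Q.lift.left) :
    ofLiftDom k hα ≫ Q'.row.s = Q.row.s := by
  have h : p.coreL.map (Over.homMk k hα : Over.mk Q.α ⟶ Over.mk Q'.α) ≫ Q'.legMap = Q.legMap := by
    refine (p.coreAdj.homEquiv _ _).injective ?_
    rw [p.coreAdj.homEquiv_naturality_left]
    exact Over.OverMorphism.ext hl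
  have h' := congrArg (fun t => t.left) h
  have e := coreL_map_ofLiftDom k hα
  rw [← cancel_epi Q.isPullback.isoPullback.inv, ← Category.assoc]
  exact (congrArg (· ≫ Q'.row.s) e).symm.trans ((Category.assoc _ _ _).trans h')

/-- A map on codomains which commutes with the maps to `A` and to the source lift, and with the
right legs, extends to a morphism of polynomials over `p`: the map on domains exists since the
middle squares are pullbacks, and it commutes with the left legs since these correspond to the maps
to the source lift under the adjunction. -/
noncomputable def ofLift (hl : k ≫ Q'.lift.left = Q.lift.left) (ht : k ≫ Q'.row.t = Q.row.t) :
    PolyDiagHom Q Q' where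
  dom := ofLiftDom k hα
  cod := k
  s_comm := ofLiftDom_s k hα hl
  isPullback := by
    have h := Q.isPullback
    rw [← hα, ← ofLiftDom_β k hα] at h
    exact h.of_bot (ofLiftDom_f k hα).symm Q'.isPullback
  t_comm := ht
  β_comm := ofLiftDom_β k hα
  α_comm := hα

end OfLift

end PolyDiagHom

theorem PolyDiagOver.lift_w (Q : PolyDiagOver p D C) :
    Q.lift.left ≫ (p.core.obj D).hom = Q.α := Over.w Q.lift

/-- The left leg of the source lift corresponds to the identity under the adjunction. -/
theorem sourceLift_lift (D : Over I) : (sourceLift p D).lift = 𝟙 (p.core.obj D) := by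
  have h : (sourceLift p D).legMap = p.coreAdj.counit.app D := by
    refine Over.OverMorphism.ext ?_
    have e : (sourceLift p D).isPullback.isoPullback = Iso.refl _ := by
      refine Iso.ext (pullback.hom_ext ?_ ?_)
      · rw [IsPullback.isoPullback_hom_fst]
        exact (Category.id_comp _).symm
      · rw [IsPullback.isoPullback_hom_snd]
        exact (Category.id_comp _).symm
    change (sourceLift p D).isPullback.isoPullback.inv ≫ (sourceLift p D).row.s = _
    rw [e]
    exact Category.id_comp _
  have h' := congrArg (p.coreAdj.homEquiv (p.core.obj D) D) h
  refine Eq.trans h' ?_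
  rw [Adjunction.homEquiv_unit]
  exact p.coreAdj.right_triangle_components D

theorem sourceLift_lift_left (D : Over I) : (sourceLift p D).lift.left = 𝟙 (p.core.obj D).left :=
  congrArg (fun t : p.core.obj D ⟶ p.core.obj D => t.left) (sourceLift_lift (p := p) D)

/-- A morphism to the source lift has the map corresponding to the left leg as its component on
codomains. -/
theorem PolyDiagHom.cod_eq_lift {Q : PolyDiagOver p D (Over.mk (𝟙 I))}
    (φ : PolyDiagHom Q (sourceLift p D)) : φ.cod = Q.lift.left := by
  rw [← φ.lift_comm, sourceLift_lift_left]
  exact (Category.comp_id _).symm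

/-- The source lift is terminal. -/
noncomputable def sourceLiftIsTerminal (D : Over I) : IsTerminal (sourceLift p D) :=
  IsTerminal.ofUniqueHom
    (fun Q => PolyDiagHom.ofLift (Q := Q) (Q' := sourceLift p D) Q.lift.left Q.lift_w
      (by rw [sourceLift_lift_left]; exact Category.comp_id _)
      (by
        have h := Q.t_comm
        refine (Category.assoc _ _ _).symm.trans ((congrArg (· ≫ p.t) Q.lift_w).trans ?_)
        exact h.symm.trans (Category.comp_id _)))
    (fun _ φ => PolyDiagHom.ext_cod (PolyDiagHom.cod_eq_lift φ))

variable {P : Over I ⥤ Over I} (e : P ≅ p.ext)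

/-- The left leg of the span read off from `Q` is the component on codomains of any, hence of the
unique, morphism to the source lift. -/
theorem readOff_dom_left (Q : PolyDiagOver p D C) (φ : Q.toBase ⟶ sourceLift p D) :
    (((readOff p D C e).obj Q).dom).left = PolyDiagHom.cod φ ≫ (e.inv.app D).left := by
  have h : PolyDiagHom.cod φ = Q.toBase.lift.left := PolyDiagHom.cod_eq_lift φ
  rw [h]
  rfl

theorem readOffObj_dom_left (Q : PolyDiagOver p D C) :
    (readOffObj p e Q).dom.left ≫ (e.hom.app D).left = Q.lift.left := by
  have h : (e.inv.app D).left ≫ (e.hom.app D).left = 𝟙 _ :=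
    congrArg (fun t => t.left) (e.inv_hom_id_app D)
  exact (Category.assoc _ _ _).trans ((congrArg (Q.lift.left ≫ ·) h).trans (Category.comp_id _))

theorem readOff_faithful : (readOff p D C e).Faithful where
  map_injective {Q Q'} φ ψ h := by
    have h' := congrArg (fun t => Over.Hom.left t.1) h
    exact PolyDiagHom.ext_cod h'

theorem readOff_full : (readOff p D C e).Full where
  map_surjective {Q Q'} g := by
    have hg : g.1.left ≫ (readOffObj p e Q').dom.left = (readOffObj p e Q).dom.left :=
      congrArg (fun t => t.left) g.2.1
    have hl : g.1.left ≫ Q'.lift.left = Q.lift.left := by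
      rw [← readOffObj_dom_left e Q', ← readOffObj_dom_left e Q, ← hg]
      exact (Category.assoc _ _ _).symm
    have hα : g.1.left ≫ Q'.α = Q.α := by
      rw [← Q'.lift_w, ← Q.lift_w, ← hl]
      exact (Category.assoc _ _ _).symm
    have ht : g.1.left ≫ Q'.row.t = Q.row.t := congrArg (fun t => t.left) g.2.2
    exact ⟨PolyDiagHom.ofLift g.1.left hα hl ht, Subtype.ext (Over.OverMorphism.ext rfl)⟩

section OfSpan

variable (M : PSpan P D C)

/-- The leg of a span, as a map to the source lift. -/
noncomputable def ofSpanLeg : M.apex ⟶ p.ext.obj D := M.dom ≫ e.hom.app D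

/-- The map from the apex of a span to `A`. -/
noncomputable def ofSpanA : M.apex.left ⟶ p.cod := (ofSpanLeg e M).left ≫ (p.core.obj D).hom

/-- The map to the source lift, in the slice over `A`. -/
noncomputable def ofSpanLift : Over.mk (ofSpanA e M) ⟶ p.core.obj D :=
  Over.homMk (ofSpanLeg e M).left rfl

/-- The polynomial over `p` given by a span: its middle map is pulled back from that of `p`, and its
left leg corresponds to the leg of the span under the adjunction. -/
noncomputable def ofSpan : PolyDiagOver p D C where
  row :=
    { dom := pullback (ofSpanA e M) p.f
      cod := M.apex.left
      s := ((p.coreAdj.homEquiv (Over.mk (ofSpanA e M)) D).symm (ofSpanLift e M)).left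
      f := pullback.fst _ _
      t := M.cod.left }
  β := pullback.snd _ _
  α := ofSpanA e M
  s_comm := Over.w ((p.coreAdj.homEquiv (Over.mk (ofSpanA e M)) D).symm (ofSpanLift e M))
  isPullback := IsPullback.of_hasPullback _ _
  t_comm := (Over.w M.cod).trans
    ((Over.w (ofSpanLeg e M)).symm.trans (Category.assoc _ _ _).symm)

theorem ofSpan_lift : (ofSpan e M).lift = ofSpanLift e M := by
  have h : (ofSpan e M).legMap =
      (p.coreAdj.homEquiv (Over.mk (ofSpanA e M)) D).symm (ofSpanLift e M) := by
    refine Over.OverMorphism.ext ?_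
    have i : (ofSpan e M).isPullback.isoPullback = Iso.refl _ := by
      refine Iso.ext (pullback.hom_ext ?_ ?_)
      · rw [IsPullback.isoPullback_hom_fst]
        exact (Category.id_comp _).symm
      · rw [IsPullback.isoPullback_hom_snd]
        exact (Category.id_comp _).symm
    change (ofSpan e M).isPullback.isoPullback.inv ≫ (ofSpan e M).row.s = _
    rw [i]
    exact Category.id_comp _
  exact (congrArg (p.coreAdj.homEquiv (Over.mk (ofSpanA e M)) D) h).trans
    (Equiv.apply_symm_apply _ _)

theorem readOff_ofSpan_dom_left : (readOffObj p e (ofSpan e M)).dom.left = M.dom.left := by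
  have h : (ofSpan e M).lift.left = (ofSpanLeg e M).left :=
    congrArg (fun t => t.left) (ofSpan_lift e M)
  have h' : ofSpanLeg e M ≫ e.inv.app D = M.dom :=
    (Category.assoc _ _ _).trans ((congrArg (_ ≫ ·) (e.hom_inv_id_app D)).trans
      (Category.comp_id _))
  exact (congrArg (· ≫ (e.inv.app D).left) h).trans (congrArg (fun t => t.left) h')

/-- The span read off from the polynomial of a span is the given span. -/
noncomputable def readOffOfSpanIso : (readOff p D C e).obj (ofSpan e M) ≅ M where
  hom := ⟨Over.homMk (𝟙 M.apex.left) ((Category.id_comp _).trans (Over.w M.cod).symm),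
    Over.OverMorphism.ext ((Category.id_comp _).trans (readOff_ofSpan_dom_left e M).symm),
    Over.OverMorphism.ext (Category.id_comp _)⟩
  inv := ⟨Over.homMk (𝟙 M.apex.left) ((Category.id_comp _).trans (Over.w M.cod)),
    Over.OverMorphism.ext ((Category.id_comp _).trans (readOff_ofSpan_dom_left e M)),
    Over.OverMorphism.ext (Category.id_comp _)⟩
  hom_inv_id := Subtype.ext (Over.OverMorphism.ext (Category.id_comp _))
  inv_hom_id := Subtype.ext (Over.OverMorphism.ext (Category.id_comp _))

end OfSpan

/-- Polynomials over `p` and spans form equivalent hom categories: a polynomial over `p` amounts to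
the codomain of its middle map, with its map to the source lift and its right leg. -/
theorem readOff_isEquivalence : (readOff p D C e).IsEquivalence :=
  have := readOff_faithful (D := D) (C := C) e
  have := readOff_full (D := D) (C := C) e
  have : (readOff p D C e).EssSurj := ⟨fun M => ⟨ofSpan e M, ⟨readOffOfSpanIso e M⟩⟩⟩
  {}

end DirectComparison

/-! ### Values of squares of polynomials, in the slice over the base -/

section Base

variable {E : Type u} [Category.{v} E] {I : E}

/-- An object of `E/D`, for `D` in `E/I`, as an object of `E/I`. -/
abbrev base {D : Over I} (X : Over D.left) : Over I := (Over.map D.hom).obj X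

/-- The structure map of an object of `E/D`, as a map of `E/I`. -/
abbrev baseHom {D : Over I} (X : Over D.left) : base X ⟶ D := Over.homMk X.hom

/-- A map of `E/D`, as a map of `E/I`. -/
abbrev baseMap {D : Over I} {X Y : Over D.left} (f : X ⟶ Y) : base X ⟶ base Y :=
  (Over.map D.hom).map f

theorem baseMap_baseHom {D : Over I} {X Y : Over D.left} (f : X ⟶ Y) :
    baseMap f ≫ baseHom Y = baseHom X :=
  Over.OverMorphism.ext (Over.w f)

theorem base_id_w {D : Over I} (X : Over D.left) :
    𝟙 (base X) ≫ baseHom X = baseHom X ≫ 𝟙 D :=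
  (Category.id_comp _).trans (Category.comp_id _).symm

end Base

section Values

variable {E : Type u} [Category.{v} E] [HasPullbacks E] [LocallyCartesianClosed E] {I : E}
  {T : Monad (Over I)}

namespace PolyOver

/-- The component of the structure transformation of a polynomial over `T`. -/
def str {D C : Over I} (M : PolyOver T D C) (X : Over D.left) :
    base (M.functor.obj X) ⟶ T.obj (base X) := M.toP.app X

theorem str_naturality {D C : Over I} (M : PolyOver T D C) {X Y : Over D.left} (f : X ⟶ Y) :
    baseMap (M.functor.map f) ≫ M.str Y = M.str X ≫ T.map (baseMap f) := M.toP.naturality f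

theorem str_left {D C : Over I} (M : PolyOver T D C) (X : Over D.left)
    (h : 𝟙 X.left ≫ (base X).hom = X.hom ≫ D.hom) :
    valueAt M.toP (Y := base X) (𝟙 X.left) h = (M.str X).left :=
  (app_left_eq M.toP X).symm

theorem valueAt_toP {D C : Over I} (M : PolyOver T D C) {X : Over D.left} {Z : Over I}
    (k : X.left ⟶ Z.left) (h : k ≫ Z.hom = X.hom ≫ D.hom) :
    valueAt M.toP k h = (M.str X).left ≫ (T.map (Over.homMk k h : base X ⟶ Z)).left := rfl

theorem hcomp_str (hT : IsPolynomialMonad T) {A B C : Over I} (M : PolyOver T A B)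
    (N : PolyOver T B C) (X : Over A.left) :
    (hcomp hT M N).str X =
      N.str (M.functor.obj X) ≫ T.map (M.str X) ≫ T.μ.app (base X) := by
  refine Over.OverMorphism.ext ?_
  refine (str_left (hcomp hT M N) X (Category.id_comp _)).symm.trans ?_
  refine (valueAt_hcomp hT M N (Y := base X) (𝟙 X.left) (Category.id_comp _)).trans ?_
  have h : (Over.homMk (valueAt M.toP (Y := base X) (𝟙 X.left) (Category.id_comp _))
      (valueAt_w M.toP _ _) : base (M.functor.obj X) ⟶ T.obj (base X)) = M.str X :=
    Over.OverMorphism.ext (str_left M X _)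
  refine Eq.trans ?_ (Category.assoc _ _ _)
  exact congrArg (fun t : base (M.functor.obj X) ⟶ T.obj (base X) =>
    ((N.str (M.functor.obj X)).left ≫ (T.map t).left) ≫ (T.μ.app (base X)).left) h

/-- An isomorphism of polynomials over `T` with identity endpoints, from an isomorphism of functors
compatible with the structure transformations. -/
def isoOfFunctorIso {A B : Over I} {M N : PolyOver T A B} (e : M.functor ≅ N.functor)
    (h : ∀ X : Over A.left, baseMap (e.hom.app X) ≫ N.str X = M.str X) : tot M ≅ tot N :=
  globIso e fun X Z k w => by
    rw [valueAt_toP, valueAt_toP, ← h X, Over.comp_left, Category.assoc]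
    rfl

section Squares

variable {A B A' B' A'' B'' : Over I} {M : PolyOver T A B} {M' : PolyOver T A' B'}
  {M'' : PolyOver T A'' B''}

/-- The value of a square of polynomials over `T` at a map of `E/I` lying over its left side. -/
def value (α : tot M ⟶ tot M') {X : Over A.left} {Y : Over A'.left} (g : base X ⟶ base Y)
    (h : g ≫ baseHom Y = baseHom X ≫ PolyOverSq.left (M := tot M) (N := tot M') α) :
    base (M.functor.obj X) ⟶ base (M'.functor.obj Y) :=
  Over.homMk (val α g.left (congrArg (fun t => t.left) h)) (by
    have e := valueAt_w (PolyOverSq.nat α) g.left (congrArg (fun t => t.left) h)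
    have e' := Over.w (PolyOverSq.right (M := tot M) (N := tot M') α)
    refine (Category.assoc _ _ _).symm.trans ((congrArg (· ≫ B'.hom) e).trans ?_)
    exact (Category.assoc _ _ _).trans (congrArg (_ ≫ ·) e'))

variable (α : tot M ⟶ tot M') {X : Over A.left} {Y : Over A'.left} (g : base X ⟶ base Y)
    (h : g ≫ baseHom Y = baseHom X ≫ PolyOverSq.left (M := tot M) (N := tot M') α)

theorem value_w : value α g h ≫ baseHom (M'.functor.obj Y) =
    baseHom (M.functor.obj X) ≫ PolyOverSq.right (M := tot M) (N := tot M') α :=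
  Over.OverMorphism.ext (valueAt_w (PolyOverSq.nat α) g.left (congrArg (fun t => t.left) h))

theorem value_congr {α β : tot M ⟶ tot M'} (e : α = β) {g g' : base X ⟶ base Y} (e' : g = g')
    (h : g ≫ baseHom Y = baseHom X ≫ PolyOverSq.left (M := tot M) (N := tot M') α)
    (h' : g' ≫ baseHom Y = baseHom X ≫ PolyOverSq.left (M := tot M) (N := tot M') β) :
    value α g h = value β g' h' := by
  subst e e'
  rfl

/-- Squares are equal if they have the same endpoints and the same values. -/
theorem ext_value {α β : tot M ⟶ tot M'} (h₁ : PolyOverSq.left α = PolyOverSq.left β)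
    (h₂ : PolyOverSq.right α = PolyOverSq.right β)
    (h₃ : ∀ (X : Over A.left) (Y : Over A'.left) (g : base X ⟶ base Y)
      (h : g ≫ baseHom Y = baseHom X ≫ PolyOverSq.left (M := tot M) (N := tot M') α)
      (h' : g ≫ baseHom Y = baseHom X ≫ PolyOverSq.left (M := tot M) (N := tot M') β),
      value α g h = value β g h') : α = β :=
  val_ext h₁ h₂ fun X Y g h h' =>
    congrArg (fun t => t.left) (h₃ X Y (sliceMap g h) (sliceMap_w g h) (sliceMap_w g h'))

/-- Compatibility of a square with the structure transformations, at an arbitrary value. -/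
theorem value_str : value α g h ≫ M'.str Y = M.str X ≫ T.map g := by
  refine Over.OverMorphism.ext ?_
  have e := PolyOverSq.valueAt_comm (M := tot M) (N := tot M') α g.left
    (congrArg (fun t => t.left) h) (Z := base Y) (𝟙 Y.left) (Category.id_comp _)
  have e' : (Over.homMk (g.left ≫ 𝟙 Y.left) ((congrArg (· ≫ _) (Category.comp_id g.left)).trans
      (Over.w g)) : base X ⟶ base Y) = g :=
    Over.OverMorphism.ext (Category.comp_id g.left)
  refine (congrArg (_ ≫ ·) (str_left M' Y (Category.id_comp _)).symm).trans (e.trans ?_)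
  exact congrArg (fun t : base X ⟶ base Y => (M.str X).left ≫ (T.map t).left) e'

theorem value_hcompSq (hT : IsPolynomialMonad T) {C C' : Over I} {N : PolyOver T B C}
    {N' : PolyOver T B' C'} (β : tot N ⟶ tot N') (w : PolyOverSq.right α = PolyOverSq.left β)
    (h' : value α g h ≫ baseHom (M'.functor.obj Y) =
      baseHom (M.functor.obj X) ≫ PolyOverSq.left (M := tot N) (N := tot N') β) :
    value (hcompSq hT α β w) g h = value β (value α g h) h' :=
  Over.OverMorphism.ext (val_hcompSq hT α β w g.left _)

theorem value_hcompSq_w {C C' : Over I} {N : PolyOver T B C}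
    {N' : PolyOver T B' C'} (β : tot N ⟶ tot N') (w : PolyOverSq.right α = PolyOverSq.left β) :
    value α g h ≫ baseHom (M'.functor.obj Y) =
      baseHom (M.functor.obj X) ≫ PolyOverSq.left (M := tot N) (N := tot N') β :=
  (value_w α g h).trans (congrArg (_ ≫ ·) w)

/-- The value of a composite with a square whose endpoints are identities: by naturality, the second
factor may be evaluated at an identity. -/
theorem value_comp_glob {N : PolyOver T A' B'} (β : tot M' ⟶ tot N)
    (h' : 𝟙 (base Y) ≫ baseHom Y = baseHom Y ≫ PolyOverSq.left (M := tot M') (N := tot N) β)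
    (h'' : g ≫ baseHom Y =
      baseHom X ≫ PolyOverSq.left (M := tot M) (N := tot N) (α ≫ β)) :
    value (α ≫ β) g h'' = value α g h ≫ value β (𝟙 (base Y)) h' :=
  Over.OverMorphism.ext (val_comp_glob α β g.left _ _ _)

theorem value_glob_comp {N : PolyOver T A B} (β : tot N ⟶ tot M)
    (h' : 𝟙 (base X) ≫ baseHom X = baseHom X ≫ PolyOverSq.left (M := tot N) (N := tot M) β)
    (h'' : g ≫ baseHom Y =
      baseHom X ≫ PolyOverSq.left (M := tot N) (N := tot M') (β ≫ α)) :
    value (β ≫ α) g h'' = value β (𝟙 (base X)) h' ≫ value α g h :=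
  Over.OverMorphism.ext (val_glob_comp β α g.left _ _ _)

theorem value_isoOfFunctorIso {M N : PolyOver T A B} (e : M.functor ≅ N.functor)
    (H : ∀ X : Over A.left, baseMap (e.hom.app X) ≫ N.str X = M.str X) {X Y : Over A.left}
    (f : X ⟶ Y) (h : baseMap f ≫ baseHom Y = baseHom X ≫ 𝟙 A) :
    value (isoOfFunctorIso e H).hom (baseMap f) h =
      baseMap (e.hom.app X) ≫ baseMap (N.functor.map f) :=
  Over.OverMorphism.ext (valueAt_mateOfNat e.hom f.left _)

theorem value_hidSq (hT : IsPolynomialMonad T) {A B : Over I} (f : A ⟶ B) {X : Over A.left}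
    {Y : Over B.left} (g : base X ⟶ base Y) (h : g ≫ baseHom Y = baseHom X ≫ f) :
    value (hidSq hT f) g h = g :=
  Over.OverMorphism.ext (val_hidSq hT f g.left _)

end Squares

section Constraints

variable (hT : IsPolynomialMonad T) {A B C D : Over I}

theorem value_assoc (M : PolyOver T A B) (N : PolyOver T B C) (K : PolyOver T C D)
    (X : Over A.left) (h : 𝟙 (base X) ≫ baseHom X = baseHom X ≫ 𝟙 A) :
    value (assocIso hT M N K).hom (𝟙 (base X)) h = 𝟙 _ :=
  Over.OverMorphism.ext (val_assoc hT M N K X _)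

theorem value_lunit (M : PolyOver T A B) (X : Over A.left)
    (h : 𝟙 (base X) ≫ baseHom X = baseHom X ≫ 𝟙 A) :
    value (lunitIso hT M).hom (𝟙 (base X)) h = 𝟙 _ :=
  Over.OverMorphism.ext (val_lunit hT M X _)

theorem value_runit (M : PolyOver T A B) (X : Over A.left)
    (h : 𝟙 (base X) ≫ baseHom X = baseHom X ≫ 𝟙 A) :
    value (runitIso hT M).hom (𝟙 (base X)) h = 𝟙 _ :=
  Over.OverMorphism.ext (val_runit hT M X _)

/-- Two squares with identity left sides are equal if their values at identities are. -/
theorem ext_value_glob {M : PolyOver T A B} {N : PolyOver T A C} {α β : tot M ⟶ tot N}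
    (h₁ : PolyOverSq.left α = 𝟙 A) (h₁' : PolyOverSq.left β = 𝟙 A)
    (h₂ : PolyOverSq.right α = PolyOverSq.right β)
    (h₃ : ∀ (X : Over A.left)
      (h : 𝟙 (base X) ≫ baseHom X = baseHom X ≫ PolyOverSq.left (M := tot M) (N := tot N) α)
      (h' : 𝟙 (base X) ≫ baseHom X = baseHom X ≫ PolyOverSq.left (M := tot M) (N := tot N) β),
      value α (𝟙 (base X)) h = value β (𝟙 (base X)) h') : α = β :=
  glob_ext h₁ h₁' h₂ fun X h h' => congrArg (fun t => t.left)
    (h₃ X (Over.OverMorphism.ext h) (Over.OverMorphism.ext h'))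

end Constraints

end PolyOver

end Values

/-! ### Extensions as pullbacks in the slice over the base -/

section ExtValues

variable {E : Type u} [Category.{v} E] [HasPullbacks E] {I : E} {T : Monad (Over I)}

/-- The projection of the value of an extension to the value of the monad, as a map of `E/I`. -/
noncomputable def polyExtFstOver {D C : Over I} (M : PSpan T.toFunctor D C) (X : Over D.left) :
    base ((polyExtFunctor M).obj X) ⟶ T.obj (base X) := (polyExtToP M).app X

theorem polyExtFstOver_left {D C : Over I} (M : PSpan T.toFunctor D C) (X : Over D.left) :
    (polyExtFstOver M X).left = polyExtFst M X := Category.id_comp _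

/-- The value of the extension of `M` at `X` is the pullback of `M ⟶ T D ⟵ T X`, in `E/I`. -/
theorem polyExt_isPullback {D C : Over I} (M : PSpan T.toFunctor D C) (X : Over D.left) :
    IsPullback (polyExtFstOver M X) (polyExtSndOver M X) (T.map (baseHom X)) M.dom := by
  have h := (ext_isPullback M ((Over.iteratedSliceBackward D).obj X)).map (Over.forget I)
  have h' : IsPullback (polyExtFstOver M X).left (polyExtSndOver M X).left
      (T.map (baseHom X)).left M.dom.left := by
    rw [polyExtFstOver_left]
    exact h
  exact IsPullback.of_map (Over.forget I) (Over.OverMorphism.ext h'.w) h'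

theorem polyExtSndOver_cod {D C : Over I} (M : PSpan T.toFunctor D C) (X : Over D.left) :
    polyExtSndOver M X ≫ M.cod = baseHom ((polyExtFunctor M).obj X) :=
  Over.OverMorphism.ext rfl

theorem polyExt_map_fst {D C : Over I} (M : PSpan T.toFunctor D C) {X Y : Over D.left}
    (f : X ⟶ Y) : baseMap ((polyExtFunctor M).map f) ≫ polyExtFstOver M Y =
      polyExtFstOver M X ≫ T.map (baseMap f) := (polyExtToP M).naturality f

theorem polyExt_map_snd {D C : Over I} (M : PSpan T.toFunctor D C) {X Y : Over D.left}
    (f : X ⟶ Y) :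
    baseMap ((polyExtFunctor M).map f) ≫ polyExtSndOver M Y = polyExtSndOver M X :=
  Over.OverMorphism.ext (congrArg (fun t => t.left)
    (ext_map_snd M ((Over.iteratedSliceBackward D).map f)))

variable [LocallyCartesianClosed E] (hT : IsPolynomialMonad T)

/-- The values of the extension of a morphism of spans lie over its map of apices. -/
theorem value_polyExtSq_snd {D C D' C' : Over I} {M : PSpan T.toFunctor D C}
    {N : PSpan T.toFunctor D' C'} (α : tot M ⟶ tot N) {X : Over D.left} {Y : Over D'.left}
    (g : base X ⟶ base Y)
    (h : g ≫ baseHom Y = baseHom X ≫ PSpanSq.left (M := tot M) (N := tot N) α) :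
    PolyOver.value (polyExtSq hT α) g h ≫ polyExtSndOver N Y =
      polyExtSndOver M X ≫ PSpanSq.mid (M := tot M) (N := tot N) α := by
  refine Over.OverMorphism.ext ?_
  have e := valueAt_polyExtNat α g.left (congrArg (fun t => t.left) h)
  refine (congrArg (· ≫ polyExtSnd N Y) e).trans ?_
  exact congrArg (fun t => t.left) (extMap_snd α (sliceMap g.left (congrArg (fun t => t.left) h))
    (sliceMap_w g.left (congrArg (fun t => t.left) h)))

/-- A square into an extension is determined by its endpoints and by the projections of its values
to the apex: the projections to the values of the monad are determined by the compatibility with the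
structure transformations. -/
theorem ext_value_snd {A B D C : Over I} {Q : PolyOver T A B} {K : PSpan T.toFunctor D C}
    {α β : tot Q ⟶ tot (polyExtObj hT K)} (h₁ : PolyOverSq.left α = PolyOverSq.left β)
    (h₂ : PolyOverSq.right α = PolyOverSq.right β)
    (h₃ : ∀ (X : Over A.left) (Y : Over D.left) (g : base X ⟶ base Y)
      (h : g ≫ baseHom Y =
        baseHom X ≫ PolyOverSq.left (M := tot Q) (N := tot (polyExtObj hT K)) α)
      (h' : g ≫ baseHom Y =
        baseHom X ≫ PolyOverSq.left (M := tot Q) (N := tot (polyExtObj hT K)) β),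
      PolyOver.value α g h ≫ polyExtSndOver K Y = PolyOver.value β g h' ≫ polyExtSndOver K Y) :
    α = β :=
  PolyOver.ext_value h₁ h₂ fun X Y g h h' => (polyExt_isPullback K Y).hom_ext
    ((PolyOver.value_str α g h).trans (PolyOver.value_str β g h').symm) (h₃ X Y g h h')

end ExtValues

/-! ### Recognizing extensions, and the comparison isomorphisms -/

section Recognize

variable {E : Type u} [Category.{v} E] [HasPullbacks E] [LocallyCartesianClosed E] {I : E}
  {T : Monad (Over I)}

/-- A polynomial `Q` over `T` exhibited as the extension of a span `M`: natural maps from the values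
of `Q` to the apex of `M`, for which the structure transformation of `Q` is a pullback of the left
leg of `M`. -/
structure ExtPresentation {D C : Over I} (Q : PolyOver T D C) (M : PSpan T.toFunctor D C) where
  /-- the projection to the apex -/
  proj : ∀ X : Over D.left, base (Q.functor.obj X) ⟶ M.apex
  proj_cod : ∀ X : Over D.left, proj X ≫ M.cod = baseHom (Q.functor.obj X)
  map_proj : ∀ {X Y : Over D.left} (f : X ⟶ Y), baseMap (Q.functor.map f) ≫ proj Y = proj X
  isPullback : ∀ X : Over D.left, IsPullback (Q.str X) (proj X) (T.map (baseHom X)) M.dom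

namespace ExtPresentation

variable {D C : Over I} {Q : PolyOver T D C} {M : PSpan T.toFunctor D C} (p : ExtPresentation Q M)

/-- The values of `Q` and of the extension of `M` are pullbacks of the same maps. -/
noncomputable def app (X : Over D.left) :
    base (Q.functor.obj X) ≅ base ((polyExtFunctor M).obj X) :=
  (p.isPullback X).isoIsPullback _ _ (polyExt_isPullback M X)

theorem app_fst (X : Over D.left) : (p.app X).hom ≫ polyExtFstOver M X = Q.str X :=
  (p.isPullback X).isoIsPullback_hom_fst _ _ (polyExt_isPullback M X)

theorem app_snd (X : Over D.left) : (p.app X).hom ≫ polyExtSndOver M X = p.proj X :=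
  (p.isPullback X).isoIsPullback_hom_snd _ _ (polyExt_isPullback M X)

theorem app_baseHom (X : Over D.left) :
    (p.app X).hom ≫ baseHom ((polyExtFunctor M).obj X) = baseHom (Q.functor.obj X) :=
  (congrArg ((p.app X).hom ≫ ·) (polyExtSndOver_cod M X).symm).trans
    ((Category.assoc _ _ _).symm.trans ((congrArg (· ≫ M.cod) (p.app_snd X)).trans (p.proj_cod X)))

theorem app_naturality {X Y : Over D.left} (f : X ⟶ Y) :
    baseMap (Q.functor.map f) ≫ (p.app Y).hom =
      (p.app X).hom ≫ baseMap ((polyExtFunctor M).map f) := by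
  refine (polyExt_isPullback M Y).hom_ext ?_ ?_
  · rw [Category.assoc, Category.assoc, p.app_fst, Q.str_naturality, polyExt_map_fst,
      ← Category.assoc, p.app_fst]
  · rw [Category.assoc, Category.assoc, p.app_snd, p.map_proj, polyExt_map_snd, p.app_snd]

/-- The isomorphism of functors between `Q` and the extension of `M`. -/
noncomputable def functorIso : Q.functor ≅ polyExtFunctor M :=
  NatIso.ofComponents
    (fun X => Over.isoMk ((Over.forget I).mapIso (p.app X))
      (congrArg (fun t => t.left) (p.app_baseHom X)))
    (fun f => Over.OverMorphism.ext (congrArg (fun t => t.left) (p.app_naturality f)))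

theorem baseMap_functorIso (X : Over D.left) :
    baseMap (p.functorIso.hom.app X) = (p.app X).hom := Over.OverMorphism.ext rfl

variable (hT : IsPolynomialMonad T)

/-- The isomorphism of polynomials over `T`, with identity endpoints, between `Q` and the extension
of `M`. -/
noncomputable def iso : tot Q ≅ tot (polyExtObj hT M) :=
  PolyOver.isoOfFunctorIso (N := polyExtObj hT M) p.functorIso fun X =>
    (congrArg (· ≫ polyExtFstOver M X) (p.baseMap_functorIso X)).trans (p.app_fst X)

theorem value_iso_snd {X Y : Over D.left} (g : base X ⟶ base Y)
    (h : g ≫ baseHom Y = baseHom X ≫ 𝟙 D) :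
    PolyOver.value (p.iso hT).hom g h ≫ polyExtSndOver M Y = p.proj X := by
  obtain ⟨f, rfl⟩ : ∃ f : X ⟶ Y, g = baseMap f :=
    ⟨Over.homMk g.left (congrArg (fun t => t.left) (h.trans (Category.comp_id _))),
      Over.OverMorphism.ext rfl⟩
  refine (congrArg (· ≫ polyExtSndOver M Y) (PolyOver.value_isoOfFunctorIso _ _ f h)).trans ?_
  refine (Category.assoc _ _ _).trans ?_
  refine (congrArg (_ ≫ ·) (polyExt_map_snd M f)).trans ?_
  exact (congrArg (· ≫ polyExtSndOver M X) (p.baseMap_functorIso X)).trans (p.app_snd X)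

end ExtPresentation

section Comparisons

variable (hT : IsPolynomialMonad T) {A B C : Over I}

theorem polyExt_comp_cond (M : PSpan T.toFunctor A B) (N : PSpan T.toFunctor B C)
    (X : Over A.left) :
    (polyExtFstOver N ((polyExtFunctor M).obj X) ≫ T.map (polyExtSndOver M X)) ≫ T.map M.cod =
      polyExtSndOver N ((polyExtFunctor M).obj X) ≫ N.dom := by
  rw [Category.assoc, ← T.map_comp, polyExtSndOver_cod]
  exact (polyExt_isPullback N _).w

/-- The projection from a composite of extensions to the apex of the composite span. -/
noncomputable def polyExtCompProj (M : PSpan T.toFunctor A B) (N : PSpan T.toFunctor B C)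
    (X : Over A.left) :
    base ((polyExtFunctor N).obj ((polyExtFunctor M).obj X)) ⟶ (PSpan.hcomp M N).apex :=
  PSpan.lift (polyExtFstOver N _ ≫ T.map (polyExtSndOver M X)) (polyExtSndOver N _)
    (polyExt_comp_cond M N X)

/-- The Beck-Chevalley square: the value of a composite of extensions is a pullback of the pullback
`T M ⟶ T B ⟵ N`. -/
theorem polyExtComp_isPullback_fst (M : PSpan T.toFunctor A B) (N : PSpan T.toFunctor B C)
    (X : Over A.left) : IsPullback (polyExtFstOver N ((polyExtFunctor M).obj X))
      (polyExtCompProj M N X) (T.map (polyExtSndOver M X)) (PSpan.fst M N) := by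
  refine IsPullback.of_bot (v₂₁ := PSpan.snd M N) (v₂₂ := T.map M.cod) (h₃₁ := N.dom) ?_
    (PSpan.lift_fst _ _ _).symm (PSpan.isPullback M N)
  rw [polyExtCompProj, PSpan.lift_snd, ← T.map_comp, polyExtSndOver_cod]
  exact polyExt_isPullback N _

/-- A composite of extensions is the extension of the composite span. -/
noncomputable def polyExtCompPresentation (M : PSpan T.toFunctor A B)
    (N : PSpan T.toFunctor B C) :
    ExtPresentation (PolyOver.hcomp hT (polyExtObj hT M) (polyExtObj hT N))
      (PSpan.hcomp M N) where
  proj X := polyExtCompProj M N X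
  proj_cod X := by
    refine (congrArg (polyExtCompProj M N X ≫ ·) (PSpan.hcomp_cod M N)).trans ?_
    refine (Category.assoc _ _ _).symm.trans ?_
    exact (congrArg (· ≫ N.cod) (PSpan.lift_snd _ _ _)).trans (polyExtSndOver_cod N _)
  map_proj {X Y} f := by
    refine PSpan.hom_ext ?_ ?_
    · refine (Category.assoc _ _ _).trans ((congrArg (_ ≫ ·) (PSpan.lift_fst _ _ _)).trans
        (Eq.trans ?_ (PSpan.lift_fst _ _ _).symm))
      refine (Category.assoc _ _ _).symm.trans
        ((congrArg (· ≫ _) (polyExt_map_fst N ((polyExtFunctor M).map f))).trans ?_)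
      rw [Category.assoc, ← T.map_comp, polyExt_map_snd]
    · refine (Category.assoc _ _ _).trans ((congrArg (_ ≫ ·) (PSpan.lift_snd _ _ _)).trans
        (Eq.trans ?_ (PSpan.lift_snd _ _ _).symm))
      exact polyExt_map_snd N ((polyExtFunctor M).map f)
  isPullback X := by
    have := hT.isCartesianMonad.preserves
    -- Paste the Beck-Chevalley square, `T` of the square of `M` at `X`, and a naturality square of
    -- the multiplication.
    have h := ((polyExtComp_isPullback_fst M N X).paste_horiz
      ((polyExt_isPullback M X).map T.toFunctor)).paste_horiz (hT.mult (baseHom X)).flip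
    rw [PolyOver.hcomp_str]
    simp only [Category.assoc] at h
    exact h

/-- The identity polynomial is the extension of the identity span. -/
noncomputable def polyExtHidPresentation (A : Over I) :
    ExtPresentation (PolyOver.hid hT A) (PSpan.hid T A) where
  proj X := baseHom X
  proj_cod _ := Category.comp_id _
  map_proj f := baseMap_baseHom f
  isPullback X := (hT.unit (baseHom X)).flip

end Comparisons

end Recognize

/-! ### Naturality of the comparison isomorphisms -/

section Naturality

variable {E : Type u} [Category.{v} E] [HasPullbacks E] [LocallyCartesianClosed E] {I : E}
  {T : Monad (Over I)} (hT : IsPolynomialMonad T)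

theorem polyExtCompProj_fst {A B C : Over I} (M : PSpan T.toFunctor A B)
    (N : PSpan T.toFunctor B C) (X : Over A.left) :
    polyExtCompProj M N X ≫ PSpan.fst M N =
      polyExtFstOver N ((polyExtFunctor M).obj X) ≫ T.map (polyExtSndOver M X) :=
  PSpan.lift_fst _ _ _

theorem polyExtCompProj_snd {A B C : Over I} (M : PSpan T.toFunctor A B)
    (N : PSpan T.toFunctor B C) (X : Over A.left) :
    polyExtCompProj M N X ≫ PSpan.snd M N = polyExtSndOver N ((polyExtFunctor M).obj X) :=
  PSpan.lift_snd _ _ _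

/-- Maps into a composite of extensions are compared in the apex of the composite span through its
two projections. -/
theorem comp_polyExtCompProj_eq {A B C : Over I} {M : PSpan T.toFunctor A B}
    {N : PSpan T.toFunctor B C} {X : Over A.left} {Z : Over I}
    (a : Z ⟶ base ((polyExtFunctor N).obj ((polyExtFunctor M).obj X)))
    (c : Z ⟶ (PSpan.hcomp M N).apex)
    (h₁ : (a ≫ polyExtFstOver N _) ≫ T.map (polyExtSndOver M X) = c ≫ PSpan.fst M N)
    (h₂ : a ≫ polyExtSndOver N _ = c ≫ PSpan.snd M N) : a ≫ polyExtCompProj M N X = c :=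
  PSpan.hom_ext
    (by rw [Category.assoc, polyExtCompProj_fst, ← Category.assoc, h₁])
    (by rw [Category.assoc, polyExtCompProj_snd, h₂])

theorem polyExtCompProj_map {A B C A' B' C' : Over I} {M : PSpan T.toFunctor A B}
    {N : PSpan T.toFunctor B C} {M' : PSpan T.toFunctor A' B'} {N' : PSpan T.toFunctor B' C'}
    (α : tot M ⟶ tot M') (β : tot N ⟶ tot N') (h : PSpanSq.right α = PSpanSq.left β)
    {X : Over A.left} {Y : Over A'.left}
    {a : base ((polyExtFunctor N).obj ((polyExtFunctor M).obj X)) ⟶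
      base ((polyExtFunctor N').obj ((polyExtFunctor M').obj Y))}
    {b : base ((polyExtFunctor M).obj X) ⟶ base ((polyExtFunctor M').obj Y)}
    (h₁ : a ≫ polyExtFstOver N' _ = polyExtFstOver N _ ≫ T.map b)
    (h₂ : a ≫ polyExtSndOver N' _ =
      polyExtSndOver N _ ≫ PSpanSq.mid (M := tot N) (N := tot N') β)
    (h₃ : b ≫ polyExtSndOver M' Y =
      polyExtSndOver M X ≫ PSpanSq.mid (M := tot M) (N := tot M') α) :
    a ≫ polyExtCompProj M' N' Y =
      polyExtCompProj M N X ≫ PSpanSq.mid (PSpan.hcompSq α β h) := by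
  refine comp_polyExtCompProj_eq _ _ ?_ ?_
  · rw [h₁, Category.assoc, ← T.map_comp, h₃, Category.assoc, PSpan.hcompSq_fst,
      ← Category.assoc, polyExtCompProj_fst, Category.assoc, ← T.map_comp]
  · rw [h₂, Category.assoc, PSpan.hcompSq_snd, ← Category.assoc, polyExtCompProj_snd]

/-- The comparison for horizontal composition. -/
noncomputable def polyExtCompIso {A B C : Over I} (M : PSpan T.toFunctor A B)
    (N : PSpan T.toFunctor B C) :
    tot (PolyOver.hcomp hT (polyExtObj hT M) (polyExtObj hT N)) ≅
      tot (polyExtObj hT (PSpan.hcomp M N)) :=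
  (polyExtCompPresentation hT M N).iso hT

/-- The comparison for horizontal identities. -/
noncomputable def polyExtHidIso (A : Over I) :
    tot (PolyOver.hid hT A) ≅ tot (polyExtObj hT (PSpan.hid T A)) :=
  (polyExtHidPresentation hT A).iso hT

theorem value_polyExtCompIso_snd {A B C : Over I} (M : PSpan T.toFunctor A B)
    (N : PSpan T.toFunctor B C) {X Y : Over A.left} (g : base X ⟶ base Y)
    (h : g ≫ baseHom Y = baseHom X ≫ 𝟙 A) :
    PolyOver.value (polyExtCompIso hT M N).hom g h ≫ polyExtSndOver (PSpan.hcomp M N) Y =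
      polyExtCompProj M N X :=
  (polyExtCompPresentation hT M N).value_iso_snd hT g h

theorem value_polyExtHidIso_snd {A : Over I} {X Y : Over A.left} (g : base X ⟶ base Y)
    (h : g ≫ baseHom Y = baseHom X ≫ 𝟙 A) :
    PolyOver.value (polyExtHidIso hT A).hom g h ≫ polyExtSndOver (PSpan.hid T A) Y =
      baseHom X :=
  (polyExtHidPresentation hT A).value_iso_snd hT g h

theorem value_one_snd {A B : Over I} (M : PSpan T.toFunctor A B) {X Y : Over A.left}
    (g : base X ⟶ base Y) (h : g ≫ baseHom Y = baseHom X ≫ 𝟙 A) :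
    PolyOver.value (𝟙 (tot (polyExtObj hT M))) g h ≫ polyExtSndOver M Y = polyExtSndOver M X :=
  (congrArg (· ≫ polyExtSndOver M Y) (PolyOver.value_congr (polyExtSq_id hT M).symm rfl h h)).trans
    ((value_polyExtSq_snd hT (𝟙 (tot M)) g h).trans (Category.comp_id _))

/-- Two squares with identity left sides into an extension are equal if they have the same right
side and the projections of their values at identities agree. -/
theorem ext_value_snd_glob {A B C : Over I} {Q : PolyOver T A B} {K : PSpan T.toFunctor A C}
    {α β : tot Q ⟶ tot (polyExtObj hT K)} (h₁ : PolyOverSq.left α = 𝟙 A)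
    (h₁' : PolyOverSq.left β = 𝟙 A) (h₂ : PolyOverSq.right α = PolyOverSq.right β)
    (h₃ : ∀ (X : Over A.left)
      (h : 𝟙 (base X) ≫ baseHom X =
        baseHom X ≫ PolyOverSq.left (M := tot Q) (N := tot (polyExtObj hT K)) α)
      (h' : 𝟙 (base X) ≫ baseHom X =
        baseHom X ≫ PolyOverSq.left (M := tot Q) (N := tot (polyExtObj hT K)) β),
      PolyOver.value α (𝟙 (base X)) h ≫ polyExtSndOver K X =
        PolyOver.value β (𝟙 (base X)) h' ≫ polyExtSndOver K X) :
    α = β :=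
  PolyOver.ext_value_glob h₁ h₁' h₂ fun X h h' => (polyExt_isPullback K X).hom_ext
    ((PolyOver.value_str α _ h).trans (PolyOver.value_str β _ h').symm) (h₃ X h h')

theorem polyExtComp_naturality {A B C A' B' C' : Over I} {M : PSpan T.toFunctor A B}
    {N : PSpan T.toFunctor B C} {M' : PSpan T.toFunctor A' B'} {N' : PSpan T.toFunctor B' C'}
    (α : tot M ⟶ tot M') (β : tot N ⟶ tot N') (h : PSpanSq.right α = PSpanSq.left β)
    (h' : PolyOverSq.right (polyExtSq hT α) = PolyOverSq.left (polyExtSq hT β)) :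
    PolyOver.hcompSq hT (polyExtSq hT α) (polyExtSq hT β) h' ≫ (polyExtCompIso hT M' N').hom =
      (polyExtCompIso hT M N).hom ≫ polyExtSq hT (PSpan.hcompSq α β h) := by
  refine ext_value_snd hT ((Category.comp_id _).trans (Category.id_comp _).symm)
    ((Category.comp_id _).trans (Category.id_comp _).symm) fun X Y g k k' => ?_
  have kα : g ≫ baseHom Y = baseHom X ≫ PSpanSq.left (M := tot M) (N := tot M') α :=
    k'.trans (congrArg (_ ≫ ·) (Category.id_comp _))
  have e₁ := PolyOver.value_comp_glob (PolyOver.hcompSq hT (polyExtSq hT α) (polyExtSq hT β) h') g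
    kα (polyExtCompIso hT M' N').hom (base_id_w Y) k
  have e₂ := PolyOver.value_glob_comp (polyExtSq hT (PSpan.hcompSq α β h)) g kα
    (polyExtCompIso hT M N).hom (base_id_w X) k'
  have w := PolyOver.value_hcompSq_w (polyExtSq hT α) g kα (polyExtSq hT β) h'
  have e₃ := PolyOver.value_hcompSq (polyExtSq hT α) g kα hT (polyExtSq hT β) h' w
  refine (congrArg (· ≫ _) e₁).trans ((Category.assoc _ _ _).trans
    ((congrArg (_ ≫ ·) (value_polyExtCompIso_snd hT M' N' _ _)).trans ?_))
  refine (congrArg (· ≫ _) e₃).trans ?_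
  refine Eq.trans ?_ ((congrArg (· ≫ _) e₂).trans ((Category.assoc _ _ _).trans
    ((congrArg (_ ≫ ·) (value_polyExtSq_snd hT (PSpan.hcompSq α β h) g kα)).trans
      ((Category.assoc _ _ _).symm.trans
        (congrArg (· ≫ _) (value_polyExtCompIso_snd hT M N _ _)))))).symm
  exact polyExtCompProj_map α β h (PolyOver.value_str (polyExtSq hT β) _ w)
    (value_polyExtSq_snd hT β _ w) (value_polyExtSq_snd hT α g kα)

theorem polyExtHid_naturality {A B : Over I} (f : A ⟶ B)
    (σ : tot (PSpan.hid T A) ⟶ tot (PSpan.hid T B)) (h₁ : PSpanSq.left σ = f)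
    (h₂ : PSpanSq.right σ = f) (h₃ : PSpanSq.mid σ = f) :
    PolyOver.hidSq hT f ≫ (polyExtHidIso hT B).hom =
      (polyExtHidIso hT A).hom ≫ polyExtSq hT σ := by
  refine ext_value_snd hT ((Category.comp_id _).trans (h₁.symm.trans (Category.id_comp _).symm))
    ((Category.comp_id _).trans (h₂.symm.trans (Category.id_comp _).symm)) fun X Y g k k' => ?_
  have kσ : g ≫ baseHom Y =
      baseHom X ≫ PSpanSq.left (M := tot (PSpan.hid T A)) (N := tot (PSpan.hid T B)) σ :=
    k'.trans (congrArg (_ ≫ ·) (Category.id_comp _))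
  have kf : g ≫ baseHom Y = baseHom X ≫ f := kσ.trans (congrArg (_ ≫ ·) h₁)
  have e₁ := PolyOver.value_comp_glob (PolyOver.hidSq hT f) g kf (polyExtHidIso hT B).hom
    (base_id_w Y) k
  have e₂ := PolyOver.value_glob_comp (polyExtSq hT σ) g kσ (polyExtHidIso hT A).hom
    (base_id_w X) k'
  refine (congrArg (· ≫ _) e₁).trans ((Category.assoc _ _ _).trans
    ((congrArg (_ ≫ ·) (value_polyExtHidIso_snd hT _ _)).trans ?_))
  refine Eq.trans ?_ ((congrArg (· ≫ _) e₂).trans ((Category.assoc _ _ _).trans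
    ((congrArg (_ ≫ ·) (value_polyExtSq_snd hT σ g kσ)).trans
      ((Category.assoc _ _ _).symm.trans
        (congrArg (· ≫ _) (value_polyExtHidIso_snd hT _ _)))))).symm
  refine (congrArg (· ≫ baseHom Y) (PolyOver.value_hidSq hT f g kf)).trans ?_
  exact kf.trans (congrArg (_ ≫ ·) h₃.symm)

end Naturality

/-! ### Extension as a pseudo double functor -/

section Coherence

variable {E : Type u} [Category.{v} E] [HasPullbacks E] [LocallyCartesianClosed E] {I : E}
  {T : Monad (Over I)}

/-- The associativity law on apices. Here `c` and `d` stand for values of comparison squares, `a`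
and `k` for values of identity squares, and only the equations which determine them are used. -/
theorem polyExtCompProj_assoc {A B C D : Over I} (M : PSpan T.toFunctor A B)
    (N : PSpan T.toFunctor B C) (K : PSpan T.toFunctor C D) (X : Over A.left)
    {a : base ((polyExtFunctor K).obj ((polyExtFunctor N).obj ((polyExtFunctor M).obj X))) ⟶
      base ((polyExtFunctor K).obj ((polyExtFunctor (PSpan.hcomp M N)).obj X))}
    {c : base ((polyExtFunctor N).obj ((polyExtFunctor M).obj X)) ⟶
      base ((polyExtFunctor (PSpan.hcomp M N)).obj X)}
    {d : base ((polyExtFunctor K).obj ((polyExtFunctor N).obj ((polyExtFunctor M).obj X))) ⟶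
      base ((polyExtFunctor (PSpan.hcomp N K)).obj ((polyExtFunctor M).obj X))}
    {k : base ((polyExtFunctor M).obj X) ⟶ base ((polyExtFunctor M).obj X)}
    (ha : a ≫ polyExtFstOver K _ = polyExtFstOver K _ ≫ T.map c)
    (ha' : a ≫ polyExtSndOver K _ = polyExtSndOver K _)
    (hc : c ≫ polyExtSndOver (PSpan.hcomp M N) X = polyExtCompProj M N X)
    (hd : d ≫ polyExtFstOver (PSpan.hcomp N K) _ =
      (polyExtFstOver K _ ≫ T.map (polyExtFstOver N _) ≫ T.μ.app _) ≫ T.map k)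
    (hd' : d ≫ polyExtSndOver (PSpan.hcomp N K) _ = polyExtCompProj N K _)
    (hk : k ≫ polyExtSndOver M X = polyExtSndOver M X) :
    a ≫ polyExtCompProj (PSpan.hcomp M N) K X ≫ PSpan.assocHom M N K =
      d ≫ polyExtCompProj M (PSpan.hcomp N K) X := by
  have e : a ≫ polyExtCompProj (PSpan.hcomp M N) K X ≫ PSpan.fst (PSpan.hcomp M N) K =
      polyExtFstOver K _ ≫ T.map (polyExtCompProj M N X) := by
    rw [polyExtCompProj_fst, ← Category.assoc, ha, Category.assoc, ← T.map_comp, hc]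
  have e' : a ≫ polyExtCompProj (PSpan.hcomp M N) K X ≫ PSpan.snd (PSpan.hcomp M N) K =
      polyExtSndOver K _ := by
    rw [polyExtCompProj_snd, ha']
  have f' : d ≫ polyExtCompProj M (PSpan.hcomp N K) X ≫ PSpan.snd M (PSpan.hcomp N K) =
      polyExtCompProj N K _ := by
    rw [polyExtCompProj_snd, hd']
  have hμ : T.map (T.map (polyExtSndOver M X)) ≫ T.μ.app M.apex =
    T.μ.app _ ≫ T.map (polyExtSndOver M X) := T.μ.naturality (polyExtSndOver M X)
  refine PSpan.hcomp₃_hom_ext M N K ?_ ?_ ?_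
  · rw [Category.assoc, Category.assoc, PSpan.assocHom_fst,
      ← Category.assoc (polyExtCompProj _ _ _), ← Category.assoc a, e, Category.assoc,
      ← T.map_comp_assoc, polyExtCompProj_fst, Category.assoc, polyExtCompProj_fst,
      ← Category.assoc d, hd, Category.assoc, ← T.map_comp, hk, T.map_comp, Category.assoc, hμ]
    simp only [Category.assoc]
  · rw [Category.assoc, Category.assoc, PSpan.assocHom_snd_fst,
      ← Category.assoc (polyExtCompProj _ _ _), ← Category.assoc a, e, Category.assoc,
      ← T.map_comp, polyExtCompProj_snd]
    simp only [Category.assoc]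
    rw [← Category.assoc (polyExtCompProj _ _ _), ← Category.assoc d, f', polyExtCompProj_fst]
  · rw [Category.assoc, Category.assoc, PSpan.assocHom_snd_snd, e']
    simp only [Category.assoc]
    rw [← Category.assoc (polyExtCompProj _ _ _), ← Category.assoc d, f', polyExtCompProj_snd]

/-- The right unit law on apices: maps to the apex of `M` are compared after composition with
`M.cod` and with the unit, since the naturality square of the unit at `M.cod` is a pullback. -/
theorem polyExtCompProj_runit (hT : IsPolynomialMonad T) {A B : Over I}
    (M : PSpan T.toFunctor A B) (X : Over A.left)
    {d : base ((polyExtFunctor M).obj X) ⟶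
      base ((polyExtFunctor (PSpan.hid T B)).obj ((polyExtFunctor M).obj X))}
    {k : base ((polyExtFunctor M).obj X) ⟶ base ((polyExtFunctor M).obj X)}
    (hd : d ≫ polyExtFstOver (PSpan.hid T B) _ = T.η.app _ ≫ T.map k)
    (hd' : d ≫ polyExtSndOver (PSpan.hid T B) _ = baseHom ((polyExtFunctor M).obj X))
    (hk : k ≫ polyExtSndOver M X = polyExtSndOver M X) :
    d ≫ polyExtCompProj M (PSpan.hid T B) X ≫ (PSpan.runitApex M hT.isCartesianMonad).hom =
      polyExtSndOver M X := by
  refine (hT.unit M.cod).hom_ext ?_ ?_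
  · refine Eq.trans ?_ (polyExtSndOver_cod M X).symm
    refine (Category.assoc _ _ _).trans ((congrArg (d ≫ ·) ((Category.assoc _ _ _).trans
      ((congrArg (_ ≫ ·) (PSpan.runit_snd M hT.isCartesianMonad)).trans
        (polyExtCompProj_snd M (PSpan.hid T B) X)))).trans hd')
  · refine (Category.assoc _ _ _).trans ((congrArg (d ≫ ·) ((Category.assoc _ _ _).trans
      ((congrArg (_ ≫ ·) (PSpan.runit_fst M hT.isCartesianMonad)).trans
        (polyExtCompProj_fst M (PSpan.hid T B) X)))).trans ?_)
    rw [← Category.assoc, hd, Category.assoc, ← T.map_comp, hk]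
    exact (T.η.naturality (polyExtSndOver M X)).symm

variable (hT : IsPolynomialMonad T)

theorem polyExtComp_assoc {A B C D : Over I} (M : PSpan T.toFunctor A B)
    (N : PSpan T.toFunctor B C) (K : PSpan T.toFunctor C D)
    (h₁ : PolyOverSq.right (polyExtCompIso hT M N).hom =
      PolyOverSq.left (𝟙 (tot (polyExtObj hT K))))
    (h₂ : PolyOverSq.right (𝟙 (tot (polyExtObj hT M))) =
      PolyOverSq.left (polyExtCompIso hT N K).hom) :
    PolyOver.hcompSq hT (polyExtCompIso hT M N).hom (𝟙 (tot (polyExtObj hT K))) h₁ ≫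
        (polyExtCompIso hT (PSpan.hcomp M N) K).hom ≫
          polyExtSq hT (PSpan.assocIso M N K hT.isCartesianMonad).hom =
      (PolyOver.assocIso hT (polyExtObj hT M) (polyExtObj hT N) (polyExtObj hT K)).hom ≫
        PolyOver.hcompSq hT (𝟙 (tot (polyExtObj hT M))) (polyExtCompIso hT N K).hom h₂ ≫
          (polyExtCompIso hT M (PSpan.hcomp N K)).hom := by
  have i : 𝟙 A ≫ 𝟙 A ≫ 𝟙 A = 𝟙 A := by simp
  refine ext_value_snd_glob hT i i (congrArg (𝟙 D ≫ ·) rfl) fun X k k' => ?_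
  have w : 𝟙 (base X) ≫ baseHom X = baseHom X ≫ 𝟙 A := base_id_w X
  have w₂ : 𝟙 (base X) ≫ baseHom X = baseHom X ≫ 𝟙 A ≫ 𝟙 A := by simp
  have e₁ := PolyOver.value_comp_glob
    (PolyOver.hcompSq hT (polyExtCompIso hT M N).hom (𝟙 (tot (polyExtObj hT K))) h₁) (𝟙 (base X)) w
    ((polyExtCompIso hT (PSpan.hcomp M N) K).hom ≫
      polyExtSq hT (PSpan.assocIso M N K hT.isCartesianMonad).hom) w₂ k
  have e₂ := PolyOver.value_comp_glob (polyExtCompIso hT (PSpan.hcomp M N) K).hom (𝟙 (base X)) w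
    (polyExtSq hT (PSpan.assocIso M N K hT.isCartesianMonad).hom) w w₂
  have f₁ := PolyOver.value_comp_glob
    (PolyOver.assocIso hT (polyExtObj hT M) (polyExtObj hT N) (polyExtObj hT K)).hom (𝟙 (base X)) w
    (PolyOver.hcompSq hT (𝟙 (tot (polyExtObj hT M))) (polyExtCompIso hT N K).hom h₂ ≫
      (polyExtCompIso hT M (PSpan.hcomp N K)).hom) w₂ k'
  have f₂ := PolyOver.value_comp_glob
    (PolyOver.hcompSq hT (𝟙 (tot (polyExtObj hT M))) (polyExtCompIso hT N K).hom h₂) (𝟙 (base X)) w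
    (polyExtCompIso hT M (PSpan.hcomp N K)).hom w w₂
  have f₃ := PolyOver.value_assoc hT (polyExtObj hT M) (polyExtObj hT N) (polyExtObj hT K) X w
  have u := PolyOver.value_hcompSq_w (polyExtCompIso hT M N).hom (𝟙 (base X)) w
    (𝟙 (tot (polyExtObj hT K))) h₁
  have u' := PolyOver.value_hcompSq_w (𝟙 (tot (polyExtObj hT M))) (𝟙 (base X)) w
    (polyExtCompIso hT N K).hom h₂
  have g₁ := PolyOver.value_hcompSq (polyExtCompIso hT M N).hom (𝟙 (base X)) w hT
    (𝟙 (tot (polyExtObj hT K))) h₁ u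
  have g₂ := PolyOver.value_hcompSq (𝟙 (tot (polyExtObj hT M))) (𝟙 (base X)) w hT
    (polyExtCompIso hT N K).hom h₂ u'
  have L := (congrArg (· ≫ polyExtSndOver (PSpan.hcomp M (PSpan.hcomp N K)) X)
    (e₁.trans (congrArg₂ (· ≫ ·) g₁ e₂)))
  have R := (congrArg (· ≫ polyExtSndOver (PSpan.hcomp M (PSpan.hcomp N K)) X)
    (f₁.trans ((congrArg₂ (· ≫ ·) f₃ (f₂.trans (congrArg (· ≫ _) g₂))).trans
      (Category.id_comp _))))
  refine L.trans (Eq.trans ?_ R.symm)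
  refine (Category.assoc _ _ _).trans ((congrArg (_ ≫ ·) ((Category.assoc _ _ _).trans
    ((congrArg (_ ≫ ·) (value_polyExtSq_snd hT
      (PSpan.assocIso M N K hT.isCartesianMonad).hom _ w)).trans
        ((Category.assoc _ _ _).symm.trans (congrArg (· ≫ _)
          (value_polyExtCompIso_snd hT (PSpan.hcomp M N) K _ _)))))).trans ?_)
  refine Eq.trans ?_ ((Category.assoc _ _ _).trans (congrArg (_ ≫ ·)
    (value_polyExtCompIso_snd hT M (PSpan.hcomp N K) _ _))).symm
  refine polyExtCompProj_assoc M N K X (PolyOver.value_str _ _ u) (value_one_snd hT K _ u)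
    (value_polyExtCompIso_snd hT M N _ w) ?_ (value_polyExtCompIso_snd hT N K _ u')
    (value_one_snd hT M _ w)
  exact (PolyOver.value_str _ _ u').trans
    (congrArg (· ≫ _) (PolyOver.hcomp_str hT (polyExtObj hT N) (polyExtObj hT K) _))

theorem polyExtComp_lunit {A B : Over I} (M : PSpan T.toFunctor A B)
    (h : PolyOverSq.right (polyExtHidIso hT A).hom =
      PolyOverSq.left (𝟙 (tot (polyExtObj hT M)))) :
    PolyOver.hcompSq hT (polyExtHidIso hT A).hom (𝟙 (tot (polyExtObj hT M))) h ≫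
        (polyExtCompIso hT (PSpan.hid T A) M).hom ≫ polyExtSq hT (PSpan.lunitIso M).hom =
      (PolyOver.lunitIso hT (polyExtObj hT M)).hom := by
  have i : 𝟙 A ≫ 𝟙 A ≫ 𝟙 A = 𝟙 A := by simp
  have i' : 𝟙 B ≫ 𝟙 B ≫ 𝟙 B = 𝟙 B := by simp
  refine ext_value_snd_glob hT i rfl i' fun X k k' => ?_
  have w : 𝟙 (base X) ≫ baseHom X = baseHom X ≫ 𝟙 A := base_id_w X
  have w₂ : 𝟙 (base X) ≫ baseHom X = baseHom X ≫ 𝟙 A ≫ 𝟙 A := by simp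
  have e₁ := PolyOver.value_comp_glob
    (PolyOver.hcompSq hT (polyExtHidIso hT A).hom (𝟙 (tot (polyExtObj hT M))) h) (𝟙 (base X)) w
    ((polyExtCompIso hT (PSpan.hid T A) M).hom ≫ polyExtSq hT (PSpan.lunitIso M).hom) w₂ k
  have e₂ := PolyOver.value_comp_glob (polyExtCompIso hT (PSpan.hid T A) M).hom (𝟙 (base X)) w
    (polyExtSq hT (PSpan.lunitIso M).hom) w w₂
  have f := PolyOver.value_lunit hT (polyExtObj hT M) X k'
  have u := PolyOver.value_hcompSq_w (polyExtHidIso hT A).hom (𝟙 (base X)) w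
    (𝟙 (tot (polyExtObj hT M))) h
  have g := PolyOver.value_hcompSq (polyExtHidIso hT A).hom (𝟙 (base X)) w hT
    (𝟙 (tot (polyExtObj hT M))) h u
  have L := (congrArg (· ≫ polyExtSndOver M X) (e₁.trans (congrArg₂ (· ≫ ·) g e₂)))
  refine L.trans (Eq.trans ?_
    ((congrArg (· ≫ polyExtSndOver M X) f).trans (Category.id_comp _)).symm)
  refine (Category.assoc _ _ _).trans ((congrArg (_ ≫ ·) ((Category.assoc _ _ _).trans
    ((congrArg (_ ≫ ·) (value_polyExtSq_snd hT (PSpan.lunitIso M).hom _ w)).trans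
        ((Category.assoc _ _ _).symm.trans ((congrArg (· ≫ _)
          (value_polyExtCompIso_snd hT (PSpan.hid T A) M _ _)).trans
            (polyExtCompProj_snd (PSpan.hid T A) M X)))))).trans ?_)
  exact value_one_snd hT M _ u

theorem polyExtComp_runit {A B : Over I} (M : PSpan T.toFunctor A B)
    (h : PolyOverSq.right (𝟙 (tot (polyExtObj hT M))) =
      PolyOverSq.left (polyExtHidIso hT B).hom) :
    PolyOver.hcompSq hT (𝟙 (tot (polyExtObj hT M))) (polyExtHidIso hT B).hom h ≫
        (polyExtCompIso hT M (PSpan.hid T B)).hom ≫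
          polyExtSq hT (PSpan.runitIso M hT.isCartesianMonad).hom =
      (PolyOver.runitIso hT (polyExtObj hT M)).hom := by
  have i : 𝟙 A ≫ 𝟙 A ≫ 𝟙 A = 𝟙 A := by simp
  have i' : 𝟙 B ≫ 𝟙 B ≫ 𝟙 B = 𝟙 B := by simp
  refine ext_value_snd_glob hT i rfl i' fun X k k' => ?_
  have w : 𝟙 (base X) ≫ baseHom X = baseHom X ≫ 𝟙 A := base_id_w X
  have w₂ : 𝟙 (base X) ≫ baseHom X = baseHom X ≫ 𝟙 A ≫ 𝟙 A := by simp
  have e₁ := PolyOver.value_comp_glob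
    (PolyOver.hcompSq hT (𝟙 (tot (polyExtObj hT M))) (polyExtHidIso hT B).hom h) (𝟙 (base X)) w
    ((polyExtCompIso hT M (PSpan.hid T B)).hom ≫
      polyExtSq hT (PSpan.runitIso M hT.isCartesianMonad).hom) w₂ k
  have e₂ := PolyOver.value_comp_glob (polyExtCompIso hT M (PSpan.hid T B)).hom (𝟙 (base X)) w
    (polyExtSq hT (PSpan.runitIso M hT.isCartesianMonad).hom) w w₂
  have f := PolyOver.value_runit hT (polyExtObj hT M) X k'
  have u := PolyOver.value_hcompSq_w (𝟙 (tot (polyExtObj hT M))) (𝟙 (base X)) w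
    (polyExtHidIso hT B).hom h
  have g := PolyOver.value_hcompSq (𝟙 (tot (polyExtObj hT M))) (𝟙 (base X)) w hT
    (polyExtHidIso hT B).hom h u
  have L := (congrArg (· ≫ polyExtSndOver M X) (e₁.trans (congrArg₂ (· ≫ ·) g e₂)))
  refine L.trans (Eq.trans ?_
    ((congrArg (· ≫ polyExtSndOver M X) f).trans (Category.id_comp _)).symm)
  refine (Category.assoc _ _ _).trans ((congrArg (_ ≫ ·) ((Category.assoc _ _ _).trans
    ((congrArg (_ ≫ ·) (value_polyExtSq_snd hT
      (PSpan.runitIso M hT.isCartesianMonad).hom _ w)).trans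
        ((Category.assoc _ _ _).symm.trans (congrArg (· ≫ _)
          (value_polyExtCompIso_snd hT M (PSpan.hid T B) _ _)))))).trans ?_)
  exact polyExtCompProj_runit hT M X (PolyOver.value_str _ _ u)
    (value_polyExtHidIso_snd hT _ u) (value_one_snd hT M _ w)

/-- Extension as a pseudo double functor: the comparisons for composition are the Beck-Chevalley
isomorphisms, the comparisons for identities come from the cartesianness of the unit. -/
noncomputable def polyExtPseudo : PseudoStructure (polyExt hT) where
  comp M N := polyExtCompIso hT M N
  unit X := polyExtHidIso hT X
  left_comp _ _ := rfl
  right_comp _ _ := rfl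
  left_unit _ := rfl
  right_unit _ := rfl
  comp_naturality α β h h' := polyExtComp_naturality hT α β h h'
  unit_naturality f := polyExtHid_naturality hT f _ rfl rfl rfl
  comp_assoc M N K h₁ h₂ := polyExtComp_assoc hT M N K h₁ h₂
  comp_lunit M h := polyExtComp_lunit hT M h
  comp_runit M h := polyExtComp_runit hT M h

/-- The comparison for composition has the projections of the Beck-Chevalley isomorphism. -/
theorem polyExtPseudo_isBeckChevalley : IsBeckChevalley (polyExtPseudo hT) := by
  intro D C B M N X
  have w : 𝟙 X.left ≫ ((Over.map (𝟙 D : D ⟶ D).left).obj X).hom =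
    X.hom ≫ (𝟙 D : D ⟶ D).left := Category.id_comp _
  let g : base X ⟶ base ((Over.map (𝟙 D : D ⟶ D).left).obj X) :=
    Over.homMk (𝟙 X.left) (by simp)
  have h : g ≫ baseHom ((Over.map (𝟙 D : D ⟶ D).left).obj X) = baseHom X ≫ 𝟙 D :=
    Over.OverMorphism.ext w
  -- The component at `X` is the value at the identity map from `X` to its pushforward along `𝟙 D`.
  have e := app_left_eq (PolyOverSq.nat (polyExtCompIso hT M N).hom) X
  have s := (congrArg (· ≫ _) e).trans
    (congrArg (fun t => t.left) (value_polyExtCompIso_snd hT M N g h))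
  constructor
  · exact (Category.assoc _ _ _).symm.trans ((congrArg (· ≫ (PSpan.snd M N).left) s).trans
      (congrArg (fun t => t.left) (polyExtCompProj_snd M N X)))
  · refine (Category.assoc _ _ _).symm.trans ((congrArg (· ≫ (PSpan.fst M N).left) s).trans
      ((congrArg (fun t => t.left) (polyExtCompProj_fst M N X)).trans ?_))
    exact congrArg (· ≫ _) (polyExtFstOver_left N _)

end Coherence

/-! ### Extension is fully faithful on squares and essentially surjective -/

section Bijective

variable {E : Type u} [Category.{v} E] {I : E}

/-- The terminal object of `E/A`. -/
abbrev one (A : Over I) : Over A.left := Over.mk (𝟙 A.left)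

/-- The map to the terminal object of `E/A`. -/
abbrev toOne {A : Over I} (X : Over A.left) : X ⟶ one A := Over.homMk X.hom

instance isIso_baseHom_one (A : Over I) : IsIso (baseHom (one A)) :=
  have : IsIso ((Over.forget I).map (baseHom (one A))) := inferInstanceAs (IsIso (𝟙 A.left))
  isIso_of_reflects_iso _ (Over.forget I)

/-- A map of `E/I`, as a map between terminal objects of slices. -/
abbrev oneMap {A A' : Over I} (l : A ⟶ A') : base (one A) ⟶ base (one A') :=
  Over.homMk l.left (by simp)

theorem oneMap_w {A A' : Over I} (l : A ⟶ A') :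
    oneMap l ≫ baseHom (one A') = baseHom (one A) ≫ l :=
  Over.OverMorphism.ext ((Category.comp_id _).trans (Category.id_comp _).symm)

variable [HasPullbacks E] [LocallyCartesianClosed E] {T : Monad (Over I)}

/-- All values of a square lie over its value at the terminal objects. -/
theorem PolyOver.value_toOne {A B A' B' : Over I} {M : PolyOver T A B} {M' : PolyOver T A' B'}
    (α : tot M ⟶ tot M') {X : Over A.left} {Y : Over A'.left} (g : base X ⟶ base Y)
    (h : g ≫ baseHom Y = baseHom X ≫ PolyOverSq.left (M := tot M) (N := tot M') α) :
    value α g h ≫ baseMap (M'.functor.map (toOne Y)) =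
      baseMap (M.functor.map (toOne X)) ≫ value α (oneMap (PolyOverSq.left α)) (oneMap_w _) := by
  have k := congrArg (fun t => t.left) h
  have k' : g.left ≫ Y.hom = X.hom ≫ (PolyOverSq.left (M := tot M) (N := tot M') α).left := k
  refine Over.OverMorphism.ext ?_
  refine (valueAt_comp (PolyOverSq.nat α) g.left k' (toOne Y)
    ((Category.comp_id _).trans k')).trans ?_
  refine Eq.trans ?_ (comp_valueAt (PolyOverSq.nat α) (X := one A) (Y := one A') (toOne X)
    (PolyOverSq.left (M := tot M) (N := tot M') α).left
    ((Category.comp_id _).trans (Category.id_comp _).symm) (Category.comp_id _)).symm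
  congr 1

/-- At the terminal object of the slice, the extension of a span is the apex. -/
theorem isIso_polyExtSndOver_one {A B : Over I} (M : PSpan T.toFunctor A B) :
    IsIso (polyExtSndOver M (one A)) :=
  (polyExt_isPullback M (one A)).isIso_snd_of_isIso

variable (hT : IsPolynomialMonad T)

/-- A morphism of spans is recovered from the value of its extension at the terminal objects. -/
theorem polyExtSq_injective {A B A' B' : Over I} {M : PSpan T.toFunctor A B}
    {M' : PSpan T.toFunctor A' B'} :
    Function.Injective (fun α : tot M ⟶ tot M' => polyExtSq hT α) := by
  intro α β e
  have e' : polyExtSq hT α = polyExtSq hT β := e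
  have hl : PSpanSq.left α = PSpanSq.left β := congrArg PolyOverSq.left e'
  refine PSpanSq.hom_ext hl (congrArg PolyOverSq.right e') ?_
  have := isIso_polyExtSndOver_one M
  rw [← cancel_epi (polyExtSndOver M (one A))]
  have w := oneMap_w (PSpanSq.left (M := tot M) (N := tot M') α)
  have w' := w.trans (congrArg (_ ≫ ·) hl)
  refine (value_polyExtSq_snd hT α _ w).symm.trans
    (Eq.trans ?_ (value_polyExtSq_snd hT β _ w'))
  exact congrArg (· ≫ _) (PolyOver.value_congr e' rfl w w')

/-- A square between extensions is the extension of its value at the terminal objects. -/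
theorem polyExtSq_surjective {A B A' B' : Over I} {M : PSpan T.toFunctor A B}
    {M' : PSpan T.toFunctor A' B'} :
    Function.Surjective (fun α : tot M ⟶ tot M' => polyExtSq hT α) := by
  intro φ
  let l : A ⟶ A' := PolyOverSq.left φ
  let r : B ⟶ B' := PolyOverSq.right φ
  let n : base ((polyExtFunctor M).obj (one A)) ⟶ base ((polyExtFunctor M').obj (one A')) :=
    PolyOver.value φ (oneMap l) (oneMap_w l)
  have n_fst : n ≫ polyExtFstOver M' (one A') = polyExtFstOver M (one A) ≫ T.map (oneMap l) :=
    PolyOver.value_str φ (oneMap l) (oneMap_w l)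
  have n_cod : n ≫ baseHom ((polyExtFunctor M').obj (one A')) =
    baseHom ((polyExtFunctor M).obj (one A)) ≫ r := PolyOver.value_w φ (oneMap l) (oneMap_w l)
  have := isIso_polyExtSndOver_one M
  have m : polyExtSndOver M (one A) ≫ inv (polyExtSndOver M (one A)) ≫ n ≫
    polyExtSndOver M' (one A') = n ≫ polyExtSndOver M' (one A') := IsIso.hom_inv_id_assoc _ _
  refine ⟨PSpanSq.mk (M := tot M) (N := tot M') l r
    (inv (polyExtSndOver M (one A)) ≫ n ≫ polyExtSndOver M' (one A')) ?_ ?_,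
    ext_value_snd hT rfl rfl fun X Y g h h' => ?_⟩
  · rw [← cancel_epi (polyExtSndOver M (one A)), ← Category.assoc, m, Category.assoc,
      ← (polyExt_isPullback M' (one A')).w, ← Category.assoc, n_fst, Category.assoc,
      ← Functor.map_comp, oneMap_w, Functor.map_comp, ← Category.assoc,
      (polyExt_isPullback M (one A)).w, Category.assoc]
  · rw [← cancel_epi (polyExtSndOver M (one A)), ← Category.assoc, m, Category.assoc,
      polyExtSndOver_cod, n_cod, ← polyExtSndOver_cod M, Category.assoc]
  · refine (value_polyExtSq_snd hT _ g h).trans ?_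
    have e := PolyOver.value_toOne φ g h'
    refine Eq.trans ?_ (congrArg (_ ≫ ·) (polyExt_map_snd M' (toOne Y)))
    refine Eq.trans ?_ ((Category.assoc _ _ _).symm.trans
      (congrArg (· ≫ polyExtSndOver M' (one A')) e)).symm
    refine (congrArg (· ≫ _) (polyExt_map_snd M (toOne X)).symm).trans ?_
    exact (Category.assoc _ _ _).trans
      ((congrArg (_ ≫ ·) m).trans (Category.assoc _ _ _).symm)

/-- The span of a polynomial `Q` over `T`: its apex is the value of `Q` at the terminal object of
the slice. -/
def PolyOver.toSpan {A B : Over I} (Q : PolyOver T A B) : PSpan T.toFunctor A B where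
  apex := base (Q.functor.obj (one A))
  dom := Q.str (one A) ≫ T.map (baseHom (one A))
  cod := baseHom (Q.functor.obj (one A))

/-- A polynomial over `T` is the extension of its span. -/
def PolyOver.toSpanPresentation {A B : Over I} (Q : PolyOver T A B) :
    ExtPresentation Q Q.toSpan where
  proj X := baseMap (Q.functor.map (toOne X))
  proj_cod X := baseMap_baseHom _
  map_proj {X Y} f := by
    have e : f ≫ toOne Y = toOne X := Over.OverMorphism.ext (Over.w f)
    rw [← e, Q.functor.map_comp]
    exact ((Over.map B.hom).map_comp _ _).symm
  isPullback X := by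
    have h₁ : IsPullback (baseMap (Q.functor.map (toOne X))) (Q.str X) (Q.str (one A))
      (T.map (baseMap (toOne X))) := Q.toP_cart (toOne X)
    have h₂ : IsPullback (T.map (baseMap (toOne X))) (𝟙 _) (T.map (baseHom (one A)))
        (T.map (baseHom X)) :=
      IsPullback.of_vert_isIso ⟨by rw [← T.map_comp, baseMap_baseHom, Category.id_comp]⟩
    have h := (h₁.paste_vert h₂).flip
    rw [Category.comp_id] at h
    exact h

/-- The isomorphism of a polynomial over `T` with the extension of its span. -/
noncomputable def PolyOver.spanIso {A B : Over I} (Q : PolyOver T A B) :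
    tot Q ≅ tot (polyExtObj hT Q.toSpan) :=
  Q.toSpanPresentation.iso hT

end Bijective

/-! ### The framed structure on polynomials, and the equivalence -/

namespace DoubleCat

variable {D : DoubleCat.{u, v, w, x}}

theorem IsCart.comp_iso {A B A' B' A'' B'' : D.Obj} {N : D.Hor A' B'} {M : D.Hor A B}
    {M' : D.Hor A'' B''} {φ : tot N ⟶ tot M} (h : IsCart φ) (e : tot M ≅ tot M') :
    IsCart (φ ≫ e.hom) := by
  intro X Y K a b β h₁ h₂
  have i₁ : D.left e.hom ≫ D.left e.inv = 𝟙 _ := by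
    rw [← D.left_comp, e.hom_inv_id, D.left_id]
  have i₂ : D.right e.hom ≫ D.right e.inv = 𝟙 _ := by
    rw [← D.right_comp, e.hom_inv_id, D.right_id]
  obtain ⟨χ, ⟨hχ, hχ'⟩, hu⟩ := h K a b (β ≫ e.inv)
    (by rw [D.left_comp, h₁, D.left_comp, Category.assoc, Category.assoc, i₁, Category.comp_id])
    (by rw [D.right_comp, h₂, D.right_comp, Category.assoc, Category.assoc, i₂, Category.comp_id])
  refine ⟨χ, ⟨hχ, ?_⟩, fun χ' k => hu χ' ⟨k.1, ?_⟩⟩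
  · rw [← Category.assoc, hχ', Category.assoc, e.inv_hom_id, Category.comp_id]
  · rw [← k.2, Category.assoc, Category.assoc, e.hom_inv_id, Category.comp_id]

theorem IsOpcart.iso_comp {A B A' B' A'' B'' : D.Obj} {N : D.Hor A' B'} {M : D.Hor A B}
    {M' : D.Hor A'' B''} {φ : tot M ⟶ tot N} (h : IsOpcart φ) (e : tot M' ≅ tot M) :
    IsOpcart (e.hom ≫ φ) := by
  intro X Y K a b β h₁ h₂
  have i₁ : D.left e.inv ≫ D.left e.hom = 𝟙 _ := by
    rw [← D.left_comp, e.inv_hom_id, D.left_id]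
  have i₂ : D.right e.inv ≫ D.right e.hom = 𝟙 _ := by
    rw [← D.right_comp, e.inv_hom_id, D.right_id]
  obtain ⟨χ, ⟨hχ, hχ'⟩, hu⟩ := h K a b (e.inv ≫ β)
    (by rw [D.left_comp, h₁, D.left_comp, ← Category.assoc, ← Category.assoc, i₁,
      Category.id_comp])
    (by rw [D.right_comp, h₂, D.right_comp, ← Category.assoc, ← Category.assoc, i₂,
      Category.id_comp])
  refine ⟨χ, ⟨hχ, ?_⟩, fun χ' k => hu χ' ⟨k.1, ?_⟩⟩
  · rw [Category.assoc, hχ', ← Category.assoc, e.hom_inv_id, Category.id_comp]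
  · rw [← k.2, ← Category.assoc, ← Category.assoc, e.inv_hom_id, Category.id_comp]

end DoubleCat

section Framed

variable {E : Type u} [Category.{v} E] [HasPullbacks E] [LocallyCartesianClosed E] {I : E}
  {T : Monad (Over I)} (hT : IsPolynomialMonad T)

/-- Extension preserves cartesian squares: a square from an arbitrary polynomial `K` is transported
along the isomorphism of `K` with the extension of its span. -/
theorem polyExtSq_isCart {A B A' B' : Over I} {M : PSpan T.toFunctor A B}
    {M' : PSpan T.toFunctor A' B'} {φ : tot M ⟶ tot M'}
    (hφ : DoubleCat.IsCart (D := pspanDouble T hT.isCartesianMonad) φ) :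
    DoubleCat.IsCart (D := polyDouble hT) (polyExtSq hT φ) := by
  intro X Y K a b β h₁ h₂
  obtain ⟨γ, hγ⟩ := polyExtSq_surjective hT ((K.spanIso hT).inv ≫ β)
  have hγ' : polyExtSq hT γ = (K.spanIso hT).inv ≫ β := hγ
  have l₁ : PSpanSq.left γ = PolyOverSq.left β :=
    (congrArg PolyOverSq.left hγ').trans (Category.id_comp _)
  have l₂ : PSpanSq.right γ = PolyOverSq.right β :=
    (congrArg PolyOverSq.right hγ').trans (Category.id_comp _)
  obtain ⟨χ, ⟨hχ, hχ'⟩, hu⟩ := hφ K.toSpan a b γ (l₁.trans h₁) (l₂.trans h₂)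
  refine ⟨(K.spanIso hT).hom ≫ polyExtSq hT χ, ⟨⟨(Category.id_comp _).trans hχ.1,
    (Category.id_comp _).trans hχ.2⟩, ?_⟩, fun χ' k => ?_⟩
  · refine (Category.assoc _ _ _).trans ?_
    refine (congrArg ((K.spanIso hT).hom ≫ ·) ((polyExtSq_comp hT χ φ).symm.trans
      ((congrArg (polyExtSq hT) hχ').trans hγ'))).trans ?_
    exact Iso.hom_inv_id_assoc _ _
  · obtain ⟨δ, hδ⟩ := polyExtSq_surjective hT ((K.spanIso hT).inv ≫ χ')
    have hδ' : polyExtSq hT δ = (K.spanIso hT).inv ≫ χ' := hδ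
    have e : δ = χ := by
      refine hu δ ⟨⟨?_, ?_⟩, polyExtSq_injective hT ?_⟩
      · exact ((congrArg PolyOverSq.left hδ').trans (Category.id_comp _)).trans k.1.1
      · exact ((congrArg PolyOverSq.right hδ').trans (Category.id_comp _)).trans k.1.2
      · refine (polyExtSq_comp hT δ φ).trans ((congrArg (· ≫ polyExtSq hT φ) hδ').trans ?_)
        exact (Category.assoc _ _ _).trans ((congrArg (_ ≫ ·) k.2).trans hγ'.symm)
    rw [← e]
    exact ((Iso.hom_inv_id_assoc (K.spanIso hT) χ').symm.trans
      (congrArg ((K.spanIso hT).hom ≫ ·) hδ'.symm))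

/-- Extension preserves opcartesian squares. -/
theorem polyExtSq_isOpcart {A B A' B' : Over I} {M : PSpan T.toFunctor A B}
    {M' : PSpan T.toFunctor A' B'} {φ : tot M ⟶ tot M'}
    (hφ : DoubleCat.IsOpcart (D := pspanDouble T hT.isCartesianMonad) φ) :
    DoubleCat.IsOpcart (D := polyDouble hT) (polyExtSq hT φ) := by
  intro X Y K a b β h₁ h₂
  obtain ⟨γ, hγ⟩ := polyExtSq_surjective hT (β ≫ (K.spanIso hT).hom)
  have hγ' : polyExtSq hT γ = β ≫ (K.spanIso hT).hom := hγ
  have l₁ : PSpanSq.left γ = PolyOverSq.left β :=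
    (congrArg PolyOverSq.left hγ').trans (Category.comp_id _)
  have l₂ : PSpanSq.right γ = PolyOverSq.right β :=
    (congrArg PolyOverSq.right hγ').trans (Category.comp_id _)
  obtain ⟨χ, ⟨hχ, hχ'⟩, hu⟩ := hφ K.toSpan a b γ (l₁.trans h₁) (l₂.trans h₂)
  refine ⟨polyExtSq hT χ ≫ (K.spanIso hT).inv, ⟨⟨(Category.comp_id _).trans hχ.1,
    (Category.comp_id _).trans hχ.2⟩, ?_⟩, fun χ' k => ?_⟩
  · refine (Category.assoc _ _ _).symm.trans ?_
    refine (congrArg (· ≫ (K.spanIso hT).inv) ((polyExtSq_comp hT φ χ).symm.trans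
      ((congrArg (polyExtSq hT) hχ').trans hγ'))).trans ?_
    exact (Category.assoc _ _ _).trans
      ((congrArg (β ≫ ·) (K.spanIso hT).hom_inv_id).trans (Category.comp_id _))
  · obtain ⟨δ, hδ⟩ := polyExtSq_surjective hT (χ' ≫ (K.spanIso hT).hom)
    have hδ' : polyExtSq hT δ = χ' ≫ (K.spanIso hT).hom := hδ
    have e : δ = χ := by
      refine hu δ ⟨⟨?_, ?_⟩, polyExtSq_injective hT ?_⟩
      · exact ((congrArg PolyOverSq.left hδ').trans (Category.comp_id _)).trans k.1.1
      · exact ((congrArg PolyOverSq.right hδ').trans (Category.comp_id _)).trans k.1.2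
      · refine (polyExtSq_comp hT φ δ).trans ((congrArg (polyExtSq hT φ ≫ ·) hδ').trans ?_)
        exact (Category.assoc _ _ _).symm.trans ((congrArg (· ≫ _) k.2).trans hγ'.symm)
    rw [← e]
    refine Eq.trans ?_ (congrArg (· ≫ (K.spanIso hT).inv) hδ'.symm)
    exact ((Category.assoc _ _ _).trans
      ((congrArg (χ' ≫ ·) (K.spanIso hT).hom_inv_id).trans (Category.comp_id _))).symm

/-- Polynomials over `T` form a framed bicategory: every polynomial is the extension of its span,
and the lifts are extensions of lifts of spans. -/
theorem polyDouble_isFramed : (polyDouble hT).IsFramed :=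
  DoubleCat.isFramed_of_lifts
    (fun M f g => ⟨polyExtObj hT (PSpan.restrict M.toSpan f g),
      polyExtSq hT (PSpan.restrictSq M.toSpan f g) ≫ (M.spanIso hT).symm.hom,
      Category.comp_id _, Category.comp_id _,
      DoubleCat.IsCart.comp_iso (polyExtSq_isCart hT fun K a b β h₁ h₂ =>
        PSpan.restrictSq_existsUnique M.toSpan f g K a b β h₁ h₂) (M.spanIso hT).symm⟩)
    (fun M f g => ⟨polyExtObj hT (PSpan.extend M.toSpan f g),
      (M.spanIso hT).hom ≫ polyExtSq hT (PSpan.extendSq M.toSpan f g),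
      Category.id_comp _, Category.id_comp _,
      DoubleCat.IsOpcart.iso_comp (polyExtSq_isOpcart hT fun K a b β h₁ h₂ =>
        PSpan.extendSq_existsUnique M.toSpan f g K a b β h₁ h₂) (M.spanIso hT)⟩)

/-- The span of a polynomial over `T` gives an inverse of extension. -/
noncomputable def polyExtInverseData :
    InverseData (⟨polyExt hT, polyExtPseudo hT⟩ :
      DoubleFunctor (pspanDouble T hT.isCartesianMonad) (polyDouble hT)) where
  vert := 𝟭 (Over I)
  counit := Iso.refl _
  full := inferInstanceAs (𝟭 (Over I)).Full
  faithful := inferInstanceAs (𝟭 (Over I)).Faithful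
  bijective := ⟨polyExtSq_injective hT, polyExtSq_surjective hT⟩
  hor Q := PolyOver.toSpan Q
  sq Q := (PolyOver.spanIso hT Q).symm
  left_sq _ := rfl
  right_sq _ := rfl

end Framed

end PolySpan


theorem mainTheorem6
    {𝒞 : Type*} [Category 𝒞] [HasPullbacks 𝒞]
    {E : Type*} [Category E] [HasPullbacks E] [PolySpan.LocallyCartesianClosed E]
    {I : E} (T : Monad (Over I)) (hT : PolySpan.IsPolynomialMonad T) :
    (∀ (P : 𝒞 ⥤ 𝒞) (hP : PreservesLimitsOfShape WalkingCospan P),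
      (PolySpan.spanExt hP).IsEquivalence) ∧
    (∃ S : PolySpan.PseudoStructure (PolySpan.polyExt hT),
      PolySpan.IsBeckChevalley S ∧
        PolySpan.DoubleFunctor.IsFramedEquivalence ⟨PolySpan.polyExt hT, S⟩) ∧
    (∀ (p : PolySpan.Poly I I) (e : T.toFunctor ≅ p.ext) (D C : Over I),
      (PolySpan.readOff p D C e).IsEquivalence ∧
      Nonempty (IsTerminal (PolySpan.sourceLift p D)) ∧
      ∀ (Q : PolySpan.PolyDiagOver p D C) (φ : Q.toBase ⟶ PolySpan.sourceLift p D),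
        (((PolySpan.readOff p D C e).obj Q).dom).left =
          PolySpan.PolyDiagHom.cod φ ≫ (e.inv.app D).left) :=
  ⟨fun _ hP => PolySpan.spanExt_isEquivalence hP,
    ⟨PolySpan.polyExtPseudo hT, PolySpan.polyExtPseudo_isBeckChevalley hT,
      (PolySpan.polyExtInverseData hT).isFramedEquivalence
        (PolySpan.pspanDouble_isFramed hT.isCartesianMonad) (PolySpan.polyDouble_isFramed hT)⟩,
    fun _ e D _ => ⟨PolySpan.readOff_isEquivalence e, ⟨PolySpan.sourceLiftIsTerminal D⟩,
      fun Q φ => PolySpan.readOff_dom_left e Q φ⟩⟩
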